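/- **Definitions.** A clustering of a finite metric space $(X,d)$, $|X|=n$, is a partition of $X$ into $k\ge 1$ non-empty clusters $C_1,\dots,C_k$; an objective $\mathcal H$ assigns a real cost $\mathcal H(C_1,\dots,C_k;d)$, to be minimized, to a clustering and a metric on $X$. The objective $\mathcal H$ is a *natural center-based objective* if, for some functions $f_c$ ($c\in X$) and $g_u(r)$ ($u\in X$, $r\in\mathbb R$), $$\mathcal H(C_1,\dots,C_k;d)=\min_{c_i\in C_i}\sum_{i=1}^k\Big(f_{c_i}+\sum_{u\in C_i}g_u(d(u,c_i))\Big)$$ or $$\mathcal H(C_1,\dots,C_k;d)=\min_{c_i\in C_i}\max\Big(\max_{i}f_{c_i},\ \max_{i,\;u\in C_i}g_u(d(u,c_i))\Big),$$ and if it is center-based: for every metric $d$ on $X$ there are an optimal clustering $C_1,\dots,C_k$ and centers $c_i\in C_i$ attaining the minimum above such that $d(u,c_i)\le d(u,c_j)$ for all $i,j$ and all $u\in C_i$ (this holds for instance whenever all $g_u$ are non-decreasing on $[0,\infty)$). An instance $((X,d),\mathcal H,k)$ is *2-metric perturbation resilient* if it has an optimal clustering that is the unique optimal clustering of $((X,d'),\mathcal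 H,k)$ for every metric $d'$ on $X$ with $d(u,v)\le d'(u,v)\le 2d(u,v)$ for all $u,v\in X$. **Theorem.** There is a polynomial-time algorithm that, given any 2-metric perturbation resilient instance $((X,d),\mathcal H,k)$ of a clustering problem with natural center-based objective, returns the (unique) optimal clustering of $X$. Precisely, there are one program and one polynomial $T$ such that on every such instance the program halts with the optimal clustering after at most $T(n)$ steps. Here programs are random access programs on natural and real numbers, in which every addition, subtraction (truncated at zero for natural numbers), comparison, memory access and query of the input counts as a step; there are no other arithmetic operations. The input consists of $n$, $k$, which of the two forms the objective has, and the values $d(u,v)$, $f_c$ and $g_u(d(u,c))$ for $u,v,c\in X$, which can be queried one at a time. Moreover, for $1\le k\le n$ the following are natural center-based objectives: $k$-means, $k$-median and $k$-center, that is, the minimum over all choices of centers $c_i\in C_i$ of $\sum_i\sum_{u\in C_i}d(u,c_i)^2$, of $\sum_i\sum_{u\in C_i}d(u,c_i)$ and of $\max_i\max_{u\in C_i}d(u,c_i)$, respectively; and metric facility location with arbitrary opening costs $f_c$, that is, the minimum of $\sum_i f_{c_i}+\sum_i\sum_{u\in C_i}d(u,c_i)$. -/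

import Mathlib

namespace Clustering

/-! ## Clusterings, objectives and metric perturbation resilience -/

/-- `d` is a metric on the finite set of points `{0, …, n - 1}`. -/
structure IsMetric {n : ℕ} (d : Fin n → Fin n → ℝ) : Prop where
  eq_zero_iff : ∀ u v, d u v = 0 ↔ u = v
  symm : ∀ u v, d u v = d v u
  triangle : ∀ u v w, d u w ≤ d u v + d v w

/-- A partition of the `n` points into `k` nonempty clusters `C_i = {u | C u = i}`. -/
def IsClustering {n k : ℕ} (C : Fin n → Fin k) : Prop :=
  Function.Surjective C

/-- Two labelings define the same partition (they agree up to the names of the clusters). -/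
def SamePartition {n k : ℕ} (C C' : Fin n → Fin k) : Prop :=
  ∀ u v, C u = C v ↔ C' u = C' v

/-- A clustering objective: it assigns a cost to a clustering and a metric. -/
abbrev Objective (n k : ℕ) : Type :=
  (Fin n → Fin k) → (Fin n → Fin n → ℝ) → ℝ

/-- `C` is an optimal clustering for the distances `d`. -/
def IsOptimal {n k : ℕ} (H : Objective n k) (d : Fin n → Fin n → ℝ) (C : Fin n → Fin k) : Prop :=
  IsClustering C ∧ ∀ C', IsClustering C' → H C d ≤ H C' d

/-- `d'` is a metric `α`-perturbation of `d`. -/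
def IsMetricPerturbation {n : ℕ} (α : ℝ) (d d' : Fin n → Fin n → ℝ) : Prop :=
  IsMetric d' ∧ ∀ u v, d u v ≤ d' u v ∧ d' u v ≤ α * d u v

/-- The instance has an optimal clustering which is, up to the names of the clusters, the unique
optimal clustering for every metric `α`-perturbation of `d`. -/
def IsMetricPerturbationResilient {n k : ℕ} (α : ℝ) (H : Objective n k)
    (d : Fin n → Fin n → ℝ) : Prop :=
  ∃ C, IsOptimal H d C ∧ ∀ d', IsMetricPerturbation α d d' →
    IsOptimal H d' C ∧ ∀ C', IsOptimal H d' C' → SamePartition C C'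

/-! ## Natural center-based objectives -/

/-- A choice of centers `c i ∈ C_i`. -/
abbrev Centers {n k : ℕ} (C : Fin n → Fin k) : Type :=
  {c : Fin k → Fin n // ∀ i, C (c i) = i}

/-- How the individual costs are combined: by their sum or by their maximum. -/
inductive Kind
  | total
  | bottleneck

/-- The data of a natural center-based objective: the cost `f c` of having a center at `c` and the
cost `g u r` of connecting `u` to a center at distance `r` from `u`. -/
structure CostData (n : ℕ) where
  kind : Kind
  f : Fin n → ℝ
  g : Fin n → ℝ → ℝ

/-- The cost of a clustering together with a choice of centers. -/
noncomputable def CostData.cost {n k : ℕ} (R : CostData n) (C : Fin n → Fin k)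
    (c : Fin k → Fin n) (d : Fin n → Fin n → ℝ) : ℝ :=
  match R.kind with
  | .total => ∑ i, (R.f (c i) + ∑ u with C u = i, R.g u (d u (c i)))
  | .bottleneck => max (⨆ i, R.f (c i)) (⨆ u, R.g u (d u (c (C u))))

/-- The cost of a clustering: the minimum over all choices of centers. -/
noncomputable def CostData.objective {n : ℕ} (R : CostData n) (k : ℕ) : Objective n k :=
  fun C d => ⨅ c : Centers C, R.cost C c.1 d

/-- `H` is the natural center-based objective given by the data `R`: it has the form prescribed
by `R`, and it is center-based, which means that for every metric there is an optimal clustering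
with optimal centers in which each point belongs to the cluster of a center nearest to it. -/
structure IsNaturalWith {n k : ℕ} (H : Objective n k) (R : CostData n) : Prop where
  eq_objective : ∀ C d, IsClustering C → IsMetric d → H C d = R.objective k C d
  voronoi : ∀ d, IsMetric d → ∃ C, IsOptimal H d C ∧ ∃ c : Centers C,
    R.cost C c.1 d = H C d ∧ ∀ u j, d u (c.1 (C u)) ≤ d u (c.1 j)

/-- `H` is a natural center-based objective. -/
def IsNaturalCenterBased {n k : ℕ} (H : Objective n k) : Prop :=
  ∃ R, IsNaturalWith H R

/-- The `k`-means objective. -/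
noncomputable def kMeans (n k : ℕ) : Objective n k :=
  fun C d => ⨅ c : Centers C, ∑ i, ∑ u with C u = i, d u (c.1 i) ^ 2

/-- The `k`-median objective. -/
noncomputable def kMedian (n k : ℕ) : Objective n k :=
  fun C d => ⨅ c : Centers C, ∑ i, ∑ u with C u = i, d u (c.1 i)

/-- The `k`-center objective. -/
noncomputable def kCenter (n k : ℕ) : Objective n k :=
  fun C d => ⨅ c : Centers C, ⨆ i, ⨆ u : {u // C u = i}, d u.1 (c.1 i)

/-- The metric facility location objective with opening costs `f`. -/
noncomputable def facilityLocation {n : ℕ} (f : Fin n → ℝ) (k : ℕ) : Objective n k :=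
  fun C d => ⨅ c : Centers C, (∑ i, f (c.1 i) + ∑ u, d u (c.1 (C u)))

/-! ## The machine model

Random access programs that work on natural numbers and on real numbers, with a step count.
Memory consists of natural and of real cells. A cell is addressed by the name of an array and
three indices. The operations are additions, subtractions and comparisons; there is no
multiplication, no rounding, and no way to turn a real number into a natural number. -/

/-- The read-only input. The entries are queried one at a time. -/
structure Input where
  size : ℕ
  clusters : ℕ
  kind : Kind
  dist : ℕ → ℕ → ℝ
  centerCost : ℕ → ℝ
  connCost : ℕ → ℕ → ℝ

/-- The input that presents an instance: the numbers `n` and `k`, the kind of the objective, and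
the values `d u v`, `f c` and `g u (d u c)` (queries outside of the range return zero). -/
noncomputable def instanceInput {n : ℕ} (k : ℕ) (R : CostData n) (d : Fin n → Fin n → ℝ) :
    Input where
  size := n
  clusters := k
  kind := R.kind
  dist u v := if h : u < n ∧ v < n then d ⟨u, h.1⟩ ⟨v, h.2⟩ else 0
  centerCost c := if h : c < n then R.f ⟨c, h⟩ else 0
  connCost u c := if h : u < n ∧ c < n then R.g ⟨u, h.1⟩ (d ⟨u, h.1⟩ ⟨c, h.2⟩) else 0

/-- The name of an array and three indices. -/
abbrev Cell : Type := ℕ × ℕ × ℕ × ℕ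

/-- The contents of the memory. -/
structure Store where
  nat : Cell → ℕ
  real : Cell → ℝ

/-- The initial memory, in which all cells are zero. -/
def Store.init : Store where
  nat _ := 0
  real _ := 0

/-- Expressions for natural numbers. -/
inductive NExp
  | lit (m : ℕ)
  | size
  | clusters
  | kind
  | get (a : ℕ) (i j l : NExp)
  | add (x y : NExp)
  | sub (x y : NExp)

/-- Expressions for real numbers. -/
inductive RExp
  | zero
  | dist (u v : NExp)
  | centerCost (c : NExp)
  | connCost (u c : NExp)
  | get (a : ℕ) (i j l : NExp)
  | add (x y : RExp)
  | sub (x y : RExp)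

/-- Tests. -/
inductive BExp
  | natLt (x y : NExp)
  | realLt (x y : RExp)
  | neg (b : BExp)
  | conj (b b' : BExp)

/-- Programs. -/
inductive Prog
  | skip
  | setNat (a : ℕ) (i j l e : NExp)
  | setReal (a : ℕ) (i j l : NExp) (e : RExp)
  | seq (p q : Prog)
  | branch (b : BExp) (p q : Prog)
  | loop (b : BExp) (p : Prog)

/-- The value of an expression. Subtraction of natural numbers is truncated at zero. -/
def NExp.eval (I : Input) (s : Store) : NExp → ℕ
  | .lit m => m
  | .size => I.size
  | .clusters => I.clusters
  | .kind => match I.kind with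
    | .total => 0
    | .bottleneck => 1
  | .get a i j l => s.nat (a, i.eval I s, j.eval I s, l.eval I s)
  | .add x y => x.eval I s + y.eval I s
  | .sub x y => x.eval I s - y.eval I s

/-- The value of an expression. -/
noncomputable def RExp.eval (I : Input) (s : Store) : RExp → ℝ
  | .zero => 0
  | .dist u v => I.dist (u.eval I s) (v.eval I s)
  | .centerCost c => I.centerCost (c.eval I s)
  | .connCost u c => I.connCost (u.eval I s) (c.eval I s)
  | .get a i j l => s.real (a, i.eval I s, j.eval I s, l.eval I s)
  | .add x y => x.eval I s + y.eval I s
  | .sub x y => x.eval I s - y.eval I s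

/-- The truth value of a test. -/
def BExp.Holds (I : Input) (s : Store) : BExp → Prop
  | .natLt x y => x.eval I s < y.eval I s
  | .realLt x y => x.eval I s < y.eval I s
  | .neg b => ¬ b.Holds I s
  | .conj b b' => b.Holds I s ∧ b'.Holds I s

/-- The number of steps that the evaluation takes: one for every operation. -/
def NExp.steps : NExp → ℕ
  | .lit _ | .size | .clusters | .kind => 1
  | .get _ i j l => i.steps + j.steps + l.steps + 1
  | .add x y | .sub x y => x.steps + y.steps + 1

/-- The number of steps that the evaluation takes: one for every operation. -/
def RExp.steps : RExp → ℕ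
  | .zero => 1
  | .centerCost c => c.steps + 1
  | .dist u v | .connCost u v => u.steps + v.steps + 1
  | .get _ i j l => i.steps + j.steps + l.steps + 1
  | .add x y | .sub x y => x.steps + y.steps + 1

/-- The number of steps that the evaluation takes: one for every operation. -/
def BExp.steps : BExp → ℕ
  | .natLt x y => x.steps + y.steps + 1
  | .realLt x y => x.steps + y.steps + 1
  | .neg b => b.steps + 1
  | .conj b b' => b.steps + b'.steps + 1

/-- `Runs I p s s' t`: on input `I`, the program `p`, started with memory `s`, halts after `t`
steps with memory `s'`. -/
inductive Runs (I : Input) : Prog → Store → Store → ℕ → Prop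
  | skip (s : Store) : Runs I .skip s s 1
  | setNat (s : Store) (a : ℕ) (i j l e : NExp) :
      Runs I (.setNat a i j l e) s
        { s with nat := Function.update s.nat (a, i.eval I s, j.eval I s, l.eval I s) (e.eval I s) }
        (i.steps + j.steps + l.steps + e.steps + 1)
  | setReal (s : Store) (a : ℕ) (i j l : NExp) (e : RExp) :
      Runs I (.setReal a i j l e) s
        { s with
          real := Function.update s.real (a, i.eval I s, j.eval I s, l.eval I s) (e.eval I s) }
        (i.steps + j.steps + l.steps + e.steps + 1)
  | seq {p q : Prog} {s s' s'' : Store} {t t' : ℕ} :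
      Runs I p s s' t → Runs I q s' s'' t' → Runs I (.seq p q) s s'' (t + t')
  | branch_pos {b : BExp} {p q : Prog} {s s' : Store} {t : ℕ} :
      b.Holds I s → Runs I p s s' t → Runs I (.branch b p q) s s' (b.steps + t + 1)
  | branch_neg {b : BExp} {p q : Prog} {s s' : Store} {t : ℕ} :
      ¬ b.Holds I s → Runs I q s s' t → Runs I (.branch b p q) s s' (b.steps + t + 1)
  | loop_halt {b : BExp} {p : Prog} {s : Store} :
      ¬ b.Holds I s → Runs I (.loop b p) s s (b.steps + 1)
  | loop_next {b : BExp} {p : Prog} {s s' s'' : Store} {t t' : ℕ} :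
      b.Holds I s → Runs I p s s' t → Runs I (.loop b p) s' s'' t' →
      Runs I (.loop b p) s s'' (b.steps + t + t' + 1)

/-- Programs are deterministic: the final memory and the number of steps are unique. -/
theorem Runs.deterministic {I : Input} {p : Prog} {s s₁ s₂ : Store} {t₁ t₂ : ℕ}
    (h₁ : Runs I p s s₁ t₁) (h₂ : Runs I p s s₂ t₂) : s₁ = s₂ ∧ t₁ = t₂ := by
  induction h₁ generalizing s₂ t₂ with
  | skip | setNat | setReal => cases h₂; exact ⟨rfl, rfl⟩
  | seq _ _ ih ih' =>
    cases h₂ with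
    | seq a b =>
      obtain ⟨rfl, rfl⟩ := ih a
      obtain ⟨rfl, rfl⟩ := ih' b
      exact ⟨rfl, rfl⟩
  | branch_pos hb _ ih =>
    cases h₂ with
    | branch_pos _ a => obtain ⟨rfl, rfl⟩ := ih a; exact ⟨rfl, rfl⟩
    | branch_neg hb' _ => exact absurd hb hb'
  | branch_neg hb _ ih =>
    cases h₂ with
    | branch_neg _ a => obtain ⟨rfl, rfl⟩ := ih a; exact ⟨rfl, rfl⟩
    | branch_pos hb' _ => exact absurd hb' hb
  | loop_halt hb =>
    cases h₂ with
    | loop_halt _ => exact ⟨rfl, rfl⟩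
    | loop_next hb' _ _ => exact absurd hb' hb
  | loop_next hb _ _ ih ih' =>
    cases h₂ with
    | loop_halt hb' => exact absurd hb hb'
    | loop_next _ a b =>
      obtain ⟨rfl, rfl⟩ := ih a
      obtain ⟨rfl, rfl⟩ := ih' b
      exact ⟨rfl, rfl⟩

/-- The memory `s` holds the labeling `C` as output: the label of the point `u` is stored in the
natural array `0` at the indices `(u, 0, 0)`. -/
def Outputs {n k : ℕ} (s : Store) (C : Fin n → Fin k) : Prop :=
  ∀ u : Fin n, s.nat (0, u, 0, 0) = C u

end Clustering

open Clustering

/-! Let m send each point to its center in an optimal Voronoi solution for the metric 2d. Suppose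
that q is another center and d(p,q) ≤ 2 d(p, m p). Add to 2d an edge of length 2 d(p, m p) between p
and q. The shortest-path metric is a 2-perturbation of d that still doubles all distances inside
clusters, so m stays optimal. But p is now equally far from q and from m p and can change its
cluster for free, which contradicts uniqueness. Hence each point is more than twice as close to its
own center as to any other (`ResilientMaps.proximity`), and therefore closer to its own center than
to any point of another cluster (`ResilientMaps.exists_hubs`). Monotonicity of the connection costs
plays no role here, only the existence of a Voronoi optimum.

A minimum spanning tree recognizes such clusters. A tree edge is shortest across the cut that it
defines (`IsRootedTree.cut`), so the first tree edge on the way from a point to the center of its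
cluster cannot leave the cluster: clusters are connected in the tree (`IsRootedTree.connected`).

Label each vertex of the rooted tree by its center. Connected clusters satisfy the local condition
`Allowed` at every vertex (`isTreeLabeling_of_hubs`). Conversely, the local conditions alone make a
labeling idempotent (`IsTreeLabeling.idem`), so with k fixed points it is a center map. The
labelings with local conditions thus include an optimal center map and nothing that is not a center
map, and a cheapest one among those with k centers is optimal. Local conditions suit dynamic
programming over the tree, with the children of each vertex arranged in a list:
`Table.Correct.le_labelCost` shows that no labeling beats the table, and
`Table.PartialLabeling.optimal` that reading the table from the root down attains its value. Sums
and maxima are treated together, as a commutative, associative, monotone operation with an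
idempotent start value.

The program uses only loops of n + 1 rounds, which gives the polynomial bound (`Blk.runs_exec`).
`Blk.exec_clustering` states what it computes, and `outputs_clustering` combines this with the
geometry. -/

namespace Clustering

/-! ## Center maps

A clustering together with a choice of centers is encoded by the map that sends each point to the
center of its cluster. -/

/-- Combination of costs: the sum or the maximum. -/
noncomputable def Kind.op (κ : Kind) (x y : ℝ) : ℝ :=
  match κ with
  | .total => x + y
  | .bottleneck => max x y

/-- The contribution of the point `u` to the cost if it is connected to the center `c`. -/
noncomputable def CostData.own {n : ℕ} (R : CostData n) (d : Fin n → Fin n → ℝ) (u c : Fin n) : ℝ :=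
  if c = u then R.kind.op (R.g u (d u c)) (R.f u) else R.g u (d u c)

/-- The cost of a center map. -/
noncomputable def CostData.mapCost {n : ℕ} (R : CostData n) (m : Fin n → Fin n)
    (d : Fin n → Fin n → ℝ) : ℝ :=
  match R.kind with
  | .total => ∑ u, R.own d u (m u)
  | .bottleneck => ⨆ u, R.own d u (m u)

/-- `m` sends each point to the center of its cluster, for some clustering with `k` clusters. -/
structure IsCenterMap {n : ℕ} (k : ℕ) (m : Fin n → Fin n) : Prop where
  idem : ∀ u, m (m u) = m u
  card : (Finset.univ.filter fun u => m u = u).card = k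

/-- `m` is a cheapest center map. -/
def IsOptimalMap {n : ℕ} (R : CostData n) (k : ℕ) (d : Fin n → Fin n → ℝ) (m : Fin n → Fin n) :
    Prop :=
  IsCenterMap k m ∧ ∀ m', IsCenterMap k m' → R.mapCost m d ≤ R.mapCost m' d

theorem image_centers {n k : ℕ} {C : Fin n → Fin k} {c : Fin k → Fin n} (hc : ∀ i, C (c i) = i) :
    (Finset.univ.filter fun u => c (C u) = u) = Finset.univ.image c := by
  ext u
  simp only [Finset.mem_filter, Finset.mem_univ, true_and, Finset.mem_image]
  constructor
  · intro h; exact ⟨_, h⟩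
  · rintro ⟨i, rfl⟩; rw [hc]

theorem centers_injective {n k : ℕ} {C : Fin n → Fin k} {c : Fin k → Fin n}
    (hc : ∀ i, C (c i) = i) : Function.Injective c := by
  intro i j h
  rw [← hc i, ← hc j, h]

theorem isCenterMap_comp {n k : ℕ} {C : Fin n → Fin k} {c : Fin k → Fin n}
    (hc : ∀ i, C (c i) = i) : IsCenterMap k fun u => c (C u) where
  idem u := by simp only [hc]
  card := by
    rw [image_centers hc, Finset.card_image_of_injective _ (centers_injective hc)]
    simp

/-- Each opening cost is charged to the center itself, which is the unique point of its cluster that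
is its own center. Positivity of k makes the suprema range over nonempty types. -/
theorem cost_eq_mapCost {n k : ℕ} (hk : 0 < k) (R : CostData n) {C : Fin n → Fin k}
    {c : Fin k → Fin n} (hc : ∀ i, C (c i) = i) (d : Fin n → Fin n → ℝ) :
    R.cost C c d = R.mapCost (fun u => c (C u)) d := by
  have : Nonempty (Fin k) := ⟨⟨0, hk⟩⟩
  have : Nonempty (Fin n) := ⟨c ⟨0, hk⟩⟩
  unfold CostData.cost CostData.mapCost
  cases h : R.kind
  · simp only [CostData.own, h, Kind.op]
    have h1 : ∀ u, (if c (C u) = u then R.g u (d u (c (C u))) + R.f u else R.g u (d u (c (C u))))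
        = R.g u (d u (c (C u))) + if c (C u) = u then R.f u else 0 := by
      intro u; split_ifs <;> simp
    simp only [h1, Finset.sum_add_distrib]
    rw [← Finset.sum_filter, image_centers hc,
      Finset.sum_image fun i _ j _ hij => centers_injective hc hij, add_comm]
    congr 1
    rw [← Finset.sum_fiberwise Finset.univ C]
    refine Finset.sum_congr rfl fun i _ => Finset.sum_congr rfl fun u hu => ?_
    rw [(Finset.mem_filter.1 hu).2]
  · simp only
    refine eq_of_forall_ge_iff fun x => ?_
    rw [max_le_iff, ciSup_le_iff (Set.finite_range _).bddAbove,
      ciSup_le_iff (Set.finite_range _).bddAbove, ciSup_le_iff (Set.finite_range _).bddAbove]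
    simp only [CostData.own, h, Kind.op]
    constructor
    · rintro ⟨h1, h2⟩ u
      split_ifs with hu
      · refine max_le (h2 u) ?_
        conv_lhs => rw [← hu]
        exact h1 _
      · exact h2 u
    · intro h1
      refine ⟨fun i => ?_, fun u => ?_⟩
      · have := h1 (c i)
        rw [if_pos (by rw [hc])] at this
        exact (le_max_right _ _).trans this
      · have := h1 u
        split_ifs at this with hu
        · exact (le_max_left _ _).trans this
        · exact this

/-- The value that m takes on a cluster is a fixed point of m, so it lies in that same cluster and
can serve as its center. -/
theorem exists_centers {n k : ℕ} {C : Fin n → Fin k} {m : Fin n → Fin n} (hC : IsClustering C)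
    (hm : ∀ u, m (m u) = m u) (hker : ∀ u v, C u = C v ↔ m u = m v) :
    ∃ c : Centers C, ∀ u, c.1 (C u) = m u := by
  choose r hr using hC
  refine ⟨⟨fun i => m (r i), fun i => ?_⟩, fun u => ?_⟩
  · conv_rhs => rw [← hr i]
    exact (hker _ _).2 (hm _)
  · exact (hker _ _).1 (hr _)

theorem IsCenterMap.exists_clustering {n k : ℕ} {m : Fin n → Fin n} (hm : IsCenterMap k m) :
    ∃ C : Fin n → Fin k, IsClustering C ∧ ∀ u v, C u = C v ↔ m u = m v := by
  have hcard : Fintype.card {u // m u = u} = k := by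
    rw [Fintype.card_subtype]; exact hm.card
  let e := Fintype.equivFinOfCardEq hcard
  refine ⟨fun u => e ⟨m u, hm.idem u⟩, fun i => ?_, fun u v => ?_⟩
  · refine ⟨(e.symm i).1, ?_⟩
    have : (⟨m (e.symm i).1, hm.idem _⟩ : {u // m u = u}) = e.symm i :=
      Subtype.ext (e.symm i).2
    simp [this]
  · simp

/-! ### Optimal clusterings and cheapest center maps -/

section Natural

variable {n k : ℕ} {H : Objective n k} {R : CostData n}

theorem IsClustering.nonempty_centers {C : Fin n → Fin k} (hC : IsClustering C) :
    Nonempty (Centers C) := by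
  choose r hr using hC
  exact ⟨⟨r, hr⟩⟩

theorem objective_le (hk : 0 < k) {C : Fin n → Fin k} {m : Fin n → Fin n} (hC : IsClustering C)
    (hm : ∀ u, m (m u) = m u) (hker : ∀ u v, C u = C v ↔ m u = m v) (d : Fin n → Fin n → ℝ) :
    R.objective k C d ≤ R.mapCost m d := by
  obtain ⟨c, hc⟩ := exists_centers hC hm hker
  have : R.cost C c.1 d = R.mapCost m d := by
    rw [cost_eq_mapCost hk R c.2]; simp only [hc]
  rw [← this]
  exact ciInf_le (Set.finite_range _).bddBelow c

theorem exists_map_eq_objective (hk : 0 < k) {C : Fin n → Fin k} (hC : IsClustering C)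
    (d : Fin n → Fin n → ℝ) :
    ∃ m, IsCenterMap k m ∧ R.objective k C d = R.mapCost m d := by
  have := hC.nonempty_centers
  obtain ⟨c, hc⟩ := exists_eq_ciInf_of_finite (f := fun c : Centers C => R.cost C c.1 d)
  refine ⟨_, isCenterMap_comp c.2, ?_⟩
  rw [← cost_eq_mapCost hk R c.2, hc]; rfl

/-- The cost of a clustering is a minimum over the center maps with its kernel, so minimizing over
clusterings amounts to minimizing over all center maps. -/
theorem isOptimal_of_ker (hk : 0 < k)
    (heq : ∀ C d, IsClustering C → IsMetric d → H C d = R.objective k C d)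
    {d : Fin n → Fin n → ℝ} (hd : IsMetric d)
    {m : Fin n → Fin n} (hm : IsOptimalMap R k d m) {C : Fin n → Fin k} (hC : IsClustering C)
    (hker : ∀ u v, C u = C v ↔ m u = m v) : IsOptimal H d C := by
  refine ⟨hC, fun C' hC' => ?_⟩
  rw [heq C d hC hd, heq C' d hC' hd]
  obtain ⟨m', hm', h'⟩ := exists_map_eq_objective (R := R) hk hC' d
  rw [h']
  exact (objective_le hk hC hm.1.idem hker d).trans (hm.2 m' hm')

theorem IsNaturalWith.exists_voronoi (hk : 0 < k) (hH : IsNaturalWith H R)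
    {d : Fin n → Fin n → ℝ} (hd : IsMetric d) :
    ∃ m, IsOptimalMap R k d m ∧ ∀ u v, d u (m u) ≤ d u (m v) := by
  obtain ⟨C, hC, c, hc, hv⟩ := hH.voronoi d hd
  refine ⟨_, ⟨isCenterMap_comp c.2, fun m' hm' => ?_⟩, fun u v => hv u _⟩
  rw [← cost_eq_mapCost hk R c.2, hc]
  obtain ⟨C', hC', hker⟩ := hm'.exists_clustering
  refine (hC.2 C' hC').trans ?_
  rw [hH.eq_objective C' d hC' hd]
  exact objective_le hk hC' hm'.idem hker d

end Natural

/-! ### Non-decreasing connection costs and the classical objectives -/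

theorem IsMetric.nonneg {n : ℕ} {d : Fin n → Fin n → ℝ} (hd : IsMetric d) (u v : Fin n) :
    0 ≤ d u v := by
  have h1 := hd.triangle u v u
  rw [(hd.eq_zero_iff u u).2 rfl, hd.symm v u] at h1
  linarith

theorem IsMetric.self {n : ℕ} {d : Fin n → Fin n → ℝ} (hd : IsMetric d) (u : Fin n) :
    d u u = 0 := (hd.eq_zero_iff u u).2 rfl

theorem mapCost_mono {n : ℕ} (R : CostData n) {d d' : Fin n → Fin n → ℝ} {m m' : Fin n → Fin n}
    (h : ∀ u, R.own d u (m u) ≤ R.own d' u (m' u)) : R.mapCost m d ≤ R.mapCost m' d' := by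
  unfold CostData.mapCost
  cases R.kind
  · exact Finset.sum_le_sum fun u _ => h u
  · exact ciSup_mono (Set.finite_range _).bddAbove h

theorem exists_isCenterMap {n k : ℕ} (hk : 0 < k) (hkn : k ≤ n) :
    ∃ m : Fin n → Fin n, IsCenterMap k m := by
  have hs : Function.Surjective
      fun u : Fin n => if h : u.1 < k then (⟨u.1, h⟩ : Fin k) else ⟨0, hk⟩ := by
    intro i
    exact ⟨⟨i.1, i.2.trans_le hkn⟩, by simp⟩
  choose r hr using hs
  exact ⟨_, isCenterMap_comp
    (C := fun u : Fin n => if h : u.1 < k then (⟨u.1, h⟩ : Fin k) else ⟨0, hk⟩) hr⟩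

/-- Reassigning each point to a nearest center does not increase the cost if all `g u` are
nondecreasing. -/
theorem exists_voronoi_of_monotone {n k : ℕ} (hk : 0 < k) (hkn : k ≤ n) (R : CostData n)
    (hg : ∀ u, MonotoneOn (R.g u) (Set.Ici 0)) {d : Fin n → Fin n → ℝ} (hd : IsMetric d) :
    ∃ m, IsOptimalMap R k d m ∧ ∀ u v, d u (m u) ≤ d u (m v) := by
  obtain ⟨m, hm, hmin⟩ := Set.exists_min_image {m : Fin n → Fin n | IsCenterMap k m}
    (fun m => R.mapCost m d) (Set.toFinite _) (exists_isCenterMap hk hkn)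
  have hex : ∀ u, ∃ c, m c = c ∧ ∀ v, d u c ≤ d u (m v) := by
    intro u
    obtain ⟨c, hc, hc'⟩ := Finset.exists_min_image (Finset.univ.filter fun c => m c = c)
      (fun c => d u c) ⟨m u, by simpa using hm.idem u⟩
    exact ⟨c, by simpa using hc, fun v => hc' _ (by simpa using hm.idem v)⟩
  choose q hq hq' using hex
  -- A center is at distance zero from itself and from no other point, so reassignment keeps the set
  -- of centers, and with it the opening costs.
  have hfix : ∀ u, q u = u ↔ m u = u := by
    intro u
    constructor
    · intro h; rw [← h]; exact hq u
    · intro h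
      have h1 := hq' u u
      rw [h, hd.self] at h1
      exact ((hd.eq_zero_iff _ _).1 (le_antisymm h1 (hd.nonneg _ _))).symm
  have hqm : IsCenterMap k q := ⟨fun u => (hfix _).2 (hq u), by simp only [hfix]; exact hm.card⟩
  refine ⟨q, ⟨hqm, fun m' hm' => le_trans ?_ (hmin m' hm')⟩, fun u v => ?_⟩
  · refine mapCost_mono R fun u => ?_
    have h1 : R.g u (d u (q u)) ≤ R.g u (d u (m u)) :=
      hg u (hd.nonneg _ _) (hd.nonneg _ _) (hq' u u)
    unfold CostData.own
    by_cases h : m u = u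
    · rw [(hfix u).2 h, h]
    · rw [if_neg h, if_neg (fun h' => h ((hfix u).1 h'))]
      exact h1
  · rw [← hq v]
    exact hq' u _

theorem isNaturalWith_of_monotone {n k : ℕ} (hk : 0 < k) (hkn : k ≤ n) {H : Objective n k}
    (R : CostData n) (hg : ∀ u, MonotoneOn (R.g u) (Set.Ici 0))
    (heq : ∀ C d, IsClustering C → IsMetric d → H C d = R.objective k C d) :
    IsNaturalWith H R where
  eq_objective := heq
  voronoi d hd := by
    obtain ⟨m, hm, hv⟩ := exists_voronoi_of_monotone hk hkn R hg hd
    obtain ⟨C, hC, hker⟩ := hm.1.exists_clustering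
    have hopt := isOptimal_of_ker hk heq hd hm hC hker
    obtain ⟨c, hc⟩ := exists_centers hC hm.1.idem hker
    have hcost : R.cost C c.1 d = R.mapCost m d := by
      rw [cost_eq_mapCost hk R c.2]; simp only [hc]
    refine ⟨C, hopt, c, ?_, fun u j => ?_⟩
    · refine le_antisymm ?_ ?_
      · rw [hcost, heq C d hC hd]
        obtain ⟨m', hm', h'⟩ := exists_map_eq_objective (R := R) hk hC d
        rw [h']; exact hm.2 m' hm'
      · rw [heq C d hC hd]
        exact ciInf_le (Set.finite_range _).bddBelow c
    · obtain ⟨v, rfl⟩ := hC j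
      rw [hc, hc]; exact hv u v

theorem isNaturalCenterBased_kMeans {n k : ℕ} (hk : 0 < k) (hkn : k ≤ n) :
    IsNaturalCenterBased (kMeans n k) := by
  refine ⟨⟨.total, fun _ => 0, fun _ r => r ^ 2⟩, isNaturalWith_of_monotone hk hkn _ ?_ ?_⟩
  · intro u x hx y _ hxy
    exact pow_le_pow_left₀ hx hxy 2
  · intro C d _ _
    simp [kMeans, CostData.objective, CostData.cost]

theorem isNaturalCenterBased_kMedian {n k : ℕ} (hk : 0 < k) (hkn : k ≤ n) :
    IsNaturalCenterBased (kMedian n k) := by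
  refine ⟨⟨.total, fun _ => 0, fun _ r => r⟩, isNaturalWith_of_monotone hk hkn _ ?_ ?_⟩
  · intro u x _ y _ hxy
    exact hxy
  · intro C d _ _
    simp [kMedian, CostData.objective, CostData.cost]

theorem isNaturalCenterBased_kCenter {n k : ℕ} (hk : 0 < k) (hkn : k ≤ n) :
    IsNaturalCenterBased (kCenter n k) := by
  refine ⟨⟨.bottleneck, fun _ => 0, fun _ r => r⟩, isNaturalWith_of_monotone hk hkn _ ?_ ?_⟩
  · intro u x _ y _ hxy
    exact hxy
  · intro C d hC hd
    have : Nonempty (Fin k) := ⟨⟨0, hk⟩⟩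
    have : Nonempty (Fin n) := ⟨⟨0, hk.trans_le hkn⟩⟩
    unfold kCenter CostData.objective
    refine congrArg _ (funext fun c => ?_)
    simp only [CostData.cost]
    have : ∀ i, Nonempty {u // C u = i} := fun i => ⟨⟨c.1 i, c.2 i⟩⟩
    refine eq_of_forall_ge_iff fun x => ?_
    rw [max_le_iff, ciSup_le_iff (Set.finite_range _).bddAbove,
      ciSup_le_iff (Set.finite_range _).bddAbove, ciSup_le_iff (Set.finite_range _).bddAbove]
    constructor
    · intro h
      have h' : ∀ u, d u (c.1 (C u)) ≤ x := fun u =>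
        (le_ciSup (f := fun v : {v // C v = C u} => d v.1 (c.1 (C u)))
          (Set.finite_range _).bddAbove ⟨u, rfl⟩).trans (h _)
      -- The zero opening costs do not raise the maximum, because distances are nonnegative.
      exact ⟨fun _ => (hd.nonneg _ _).trans (h' (c.1 ⟨0, hk⟩)), h'⟩
    · rintro ⟨-, h⟩ i
      refine ciSup_le fun u => ?_
      obtain ⟨u, rfl⟩ := u
      exact h u

theorem isNaturalCenterBased_facilityLocation {n k : ℕ} (hk : 0 < k) (hkn : k ≤ n)
    (f : Fin n → ℝ) : IsNaturalCenterBased (facilityLocation f k) := by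
  refine ⟨⟨.total, f, fun _ r => r⟩, isNaturalWith_of_monotone hk hkn _ ?_ ?_⟩
  · intro u x _ y _ hxy
    exact hxy
  · intro C d _ _
    unfold facilityLocation CostData.objective
    refine congrArg _ (funext fun c => ?_)
    simp only [CostData.cost, Finset.sum_add_distrib]
    congr 1
    rw [← Finset.sum_fiberwise Finset.univ C]
    refine Finset.sum_congr rfl fun i _ => Finset.sum_congr rfl fun u hu => ?_
    rw [(Finset.mem_filter.1 hu).2]

/-! ## Separation of the clusters of a resilient instance -/

/-- The metric obtained from `2 d` by adding an edge of length `2 r` between `p` and `q`. -/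
noncomputable def shortcut {n : ℕ} (d : Fin n → Fin n → ℝ) (r : ℝ) (p q u v : Fin n) : ℝ :=
  min (2 * d u v) (min (2 * d u p + 2 * r + 2 * d q v) (2 * d u q + 2 * r + 2 * d p v))

/-- This is a shortest-path metric: a shortest path uses the new edge at most once, in one of two
directions. Positivity of r keeps distinct points apart. -/
theorem isMetric_shortcut {n : ℕ} {d : Fin n → Fin n → ℝ} (hd : IsMetric d) {r : ℝ} (hr : 0 < r)
    (p q : Fin n) : IsMetric (shortcut d r p q) where
  eq_zero_iff u v := by
    have h1 := hd.nonneg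
    constructor
    · intro h
      by_contra huv
      have h2 : 0 < d u v := lt_of_le_of_ne (h1 u v) fun h => huv ((hd.eq_zero_iff _ _).1 h.symm)
      have h3 : 0 < shortcut d r p q u v := by
        refine lt_min (by linarith) (lt_min ?_ ?_)
        · linarith [h1 u p, h1 q v]
        · linarith [h1 u q, h1 p v]
      linarith
    · rintro rfl
      unfold shortcut
      rw [hd.self, min_eq_left]
      · simp
      · refine le_min ?_ ?_
        · linarith [h1 u p, h1 q u]
        · linarith [h1 u q, h1 p u]
  symm u v := by
    unfold shortcut
    rw [hd.symm u v, hd.symm u p, hd.symm u q, hd.symm v p, hd.symm v q, min_comm (_ + _)]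
    congr 2 <;> ring
  triangle u v w := by
    have h1 := hd.nonneg
    have t := hd.triangle
    have s := hd.symm
    have key : ∀ a b, (2 * d u w ≤ a + b ∨ 2 * d u p + 2 * r + 2 * d q w ≤ a + b ∨
        2 * d u q + 2 * r + 2 * d p w ≤ a + b) → shortcut d r p q u w ≤ a + b := by
      intro a b h
      unfold shortcut
      rcases h with h | h | h
      · exact (min_le_left _ _).trans h
      · exact ((min_le_right _ _).trans (min_le_left _ _)).trans h
      · exact ((min_le_right _ _).trans (min_le_right _ _)).trans h
    have cases3 : ∀ a b : Fin n, shortcut d r p q a b = 2 * d a b ∨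
        shortcut d r p q a b = 2 * d a p + 2 * r + 2 * d q b ∨
        shortcut d r p q a b = 2 * d a q + 2 * r + 2 * d p b := by
      intro a b
      unfold shortcut
      rcases min_choice (2 * d a b) (min (2 * d a p + 2 * r + 2 * d q b)
        (2 * d a q + 2 * r + 2 * d p b)) with h | h
      · exact Or.inl h
      · rw [h]
        exact Or.inr (min_choice _ _)
    apply key
    -- Concatenate two shortest paths. If both use the new edge in the same direction, one use can
    -- be cut out; if in opposite directions, both can.
    rcases cases3 u v with h | h | h <;> rcases cases3 v w with h' | h' | h' <;> rw [h, h']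
    · left; linarith [t u v w]
    · right; left; linarith [t u v p]
    · right; right; linarith [t u v q]
    · right; left; linarith [t q v w]
    · right; left; linarith [h1 q v, h1 v p]
    · left; linarith [t u p w, t q v q, h1 v q, h1 q v]
    · right; right; linarith [t p v w]
    · left; linarith [t u q w, h1 p v, h1 v p]
    · right; right; linarith [h1 p v, h1 v q]

/-- Reformulation of a natural center-based objective and of resilience in terms of center maps. -/
structure ResilientMaps {n : ℕ} (R : CostData n) (k : ℕ) (d : Fin n → Fin n → ℝ)
    (C : Fin n → Fin k) : Prop where
  metric : IsMetric d
  ker : ∀ d', IsMetricPerturbation 2 d d' → ∀ m, IsOptimalMap R k d' m →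
    ∀ u v, C u = C v ↔ m u = m v
  voronoi : ∀ d', IsMetric d' → ∃ m, IsOptimalMap R k d' m ∧ ∀ u v, d' u (m u) ≤ d' u (m v)

theorem exists_resilientMaps {n k : ℕ} {d : Fin n → Fin n → ℝ} {H : Objective n k} {R : CostData n}
    (hk : 0 < k) (hd : IsMetric d) (hH : IsNaturalWith H R)
    (hres : IsMetricPerturbationResilient 2 H d) : ∃ C, ResilientMaps R k d C := by
  obtain ⟨C, hC, hu⟩ := hres
  refine ⟨C, hd, fun d' hd' m hm u v => ?_, fun d' hd' => hH.exists_voronoi hk hd'⟩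
  obtain ⟨C', hC', hker⟩ := hm.1.exists_clustering
  rw [(hu d' hd').2 C' (isOptimal_of_ker hk hH.eq_objective hd'.1 hm hC' hker) u v, hker]

theorem isMetricPerturbation_self {n : ℕ} {d : Fin n → Fin n → ℝ} (hd : IsMetric d) :
    IsMetricPerturbation 2 d d :=
  ⟨hd, fun u v => ⟨le_rfl, by linarith [hd.nonneg u v]⟩⟩

theorem isMetricPerturbation_two_mul {n : ℕ} {d : Fin n → Fin n → ℝ} (hd : IsMetric d) :
    IsMetricPerturbation 2 d fun u v => 2 * d u v := by
  refine ⟨⟨fun u v => ?_, fun u v => ?_, fun u v w => ?_⟩, fun u v => ⟨?_, le_rfl⟩⟩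
  · simp [hd.eq_zero_iff]
  · simp [hd.symm u v]
  · linarith [hd.triangle u v w]
  · linarith [hd.nonneg u v]

theorem own_congr {n : ℕ} (R : CostData n) {d d' : Fin n → Fin n → ℝ} {u c : Fin n}
    (h : d u c = d' u c) : R.own d u c = R.own d' u c := by
  unfold CostData.own; rw [h]

theorem mapCost_congr {n : ℕ} (R : CostData n) {d d' : Fin n → Fin n → ℝ} {m m' : Fin n → Fin n}
    (h : ∀ u, R.own d u (m u) = R.own d' u (m' u)) : R.mapCost m d = R.mapCost m' d' :=
  le_antisymm (mapCost_mono R fun u => (h u).le) (mapCost_mono R fun u => (h u).ge)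

/-- Center proximity: each point is more than twice as close to its own center as to any other
center. -/
theorem ResilientMaps.proximity {n k : ℕ} {R : CostData n} {d : Fin n → Fin n → ℝ}
    {C : Fin n → Fin k} (h : ResilientMaps R k d C) {m : Fin n → Fin n}
    (hm : IsOptimalMap R k (fun u v => 2 * d u v) m)
    (hv : ∀ u v, d u (m u) ≤ d u (m v)) {p q : Fin n} (hq : m q = q) (hpq : m p ≠ q) :
    2 * d p (m p) < d p q := by
  by_contra hcon
  push Not at hcon
  have hd := h.metric
  have hnn := hd.nonneg
  have htri := hd.triangle
  have hsymm := hd.symm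
  have hne : p ≠ q := by rintro rfl; exact hpq hq
  have hr : 0 < d p (m p) := by
    refine lt_of_le_of_ne (hnn _ _) fun h0 => hne ?_
    rw [← h0] at hcon
    exact (hd.eq_zero_iff _ _).1 (le_antisymm (by linarith) (hnn _ _))
  have hmp : m p ≠ p := by
    intro h'
    rw [h', hd.self] at hr
    exact lt_irrefl _ hr
  have hnear : ∀ u v, m v = v → d u (m u) ≤ d u v := fun u v hv' => by
    have := hv u v
    rwa [hv'] at this
  -- The new edge is as long as the doubled distance from p to its own center. The assumption d(p,q)
  -- ≤ 2 d(p, m p) ensures that no distance falls below its value in d.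
  set d' := shortcut d (d p (m p)) p q with hd'
  have hmet : IsMetric d' := isMetric_shortcut hd hr p q
  have hpert : IsMetricPerturbation 2 d d' := by
    refine ⟨hmet, fun u v => ⟨le_min ?_ (le_min ?_ ?_), min_le_left _ _⟩⟩
    · linarith [hnn u v]
    · linarith [hnn u p, hnn q v, htri u p v, htri p q v]
    · linarith [hnn u q, hnn p v, htri u q v, htri q p v, hsymm p q]
  have hpert2 := isMetricPerturbation_two_mul hd
  -- A detour over the new edge does not help inside a cluster: the part from u over p, plus r, is
  -- at least the distance from u to m p, hence to its own center; the part from q to v is at least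
  -- the distance from v to that same center. The other direction is symmetric.
  have hin : ∀ u v, m u = m v → d' u v = 2 * d u v := by
    intro u v huv
    refine min_eq_left (le_min ?_ ?_)
    · have h1 := hnear u (m p) (hm.1.idem p)
      have h2 := hnear v q hq
      rw [← huv] at h2
      linarith [htri u p (m p), htri u (m u) v, hsymm v (m u), hsymm v q]
    · have h1 := hnear v (m p) (hm.1.idem p)
      have h2 := hnear u q hq
      rw [← huv] at h1
      linarith [htri v p (m p), htri u (m u) v, hsymm v (m u), hsymm v p]
  have hker2 := h.ker _ hpert2 m hm
  -- By resilience an optimal map for d' has the clusters of m. Costs depend only on distances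
  -- inside clusters, where d' and 2d agree, so optimality of m passes from 2d to d'.
  have hopt : IsOptimalMap R k d' m := by
    obtain ⟨m₁, hm₁, -⟩ := h.voronoi d' hmet
    have hker1 := h.ker _ hpert m₁ hm₁
    refine ⟨hm.1, fun m' hm' => le_trans ?_ (hm₁.2 m' hm')⟩
    have e1 : R.mapCost m d' = R.mapCost m fun u v => 2 * d u v :=
      mapCost_congr R fun u => own_congr R (hin u _ (hm.1.idem u).symm)
    have e2 : R.mapCost m₁ d' = R.mapCost m₁ fun u v => 2 * d u v := by
      refine mapCost_congr R fun u => own_congr R (hin u _ ?_)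
      rw [← hker2, hker1, hm₁.1.idem]
    rw [e1, e2]
    exact hm.2 m₁ hm₁.1
  have hd'pq : d' p q = 2 * d p (m p) := by
    have h1 := hnear p q hq
    rw [hd']
    unfold shortcut
    rw [hd.self, hd.self, min_eq_right, min_eq_left]
    · ring
    · linarith [hnn p q]
    · refine (min_le_left _ _).trans ?_
      linarith
  -- The competitor moves p to q. Since p is not a center, the set of centers is unchanged; since
  -- both distances agree in d', so is the cost. Only the partition differs.
  have hm'fix : ∀ u, Function.update m p q u = u ↔ m u = u := by
    intro u
    by_cases hu : u = p
    · subst hu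
      simp only [Function.update_self, hmp, iff_false]
      exact fun h' => hne h'.symm
    · rw [Function.update_of_ne hu]
  have hm' : IsCenterMap k (Function.update m p q) := by
    refine ⟨fun u => ?_, by simp only [hm'fix]; exact hm.1.card⟩
    rw [hm'fix]
    by_cases hu : u = p
    · subst hu
      simpa using hq
    · rw [Function.update_of_ne hu]
      exact hm.1.idem u
  have hcost : R.mapCost (Function.update m p q) d' = R.mapCost m d' := by
    refine mapCost_congr R fun u => ?_
    by_cases hu : u = p
    · subst hu
      unfold CostData.own
      rw [Function.update_self, if_neg hne.symm, if_neg hmp, hd'pq,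
        hin u (m u) (hm.1.idem u).symm]
    · rw [Function.update_of_ne hu]
  have hopt' : IsOptimalMap R k d' (Function.update m p q) :=
    ⟨hm', fun m'' hm'' => hcost.trans_le (hopt.2 m'' hm'')⟩
  have h1 := h.ker _ hpert _ hopt' p q
  rw [hker2, Function.update_self, Function.update_of_ne hne.symm, hq] at h1
  exact hpq (h1.2 rfl)

/-- In a resilient instance, each cluster has a point that is closer to each point of the cluster
than all points of other clusters. -/
theorem ResilientMaps.exists_hubs {n k : ℕ} {R : CostData n} {d : Fin n → Fin n → ℝ}
    {C : Fin n → Fin k} (h : ResilientMaps R k d C) :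
    ∃ m : Fin n → Fin n, (∀ u, C (m u) = C u) ∧ (∀ u v, C u = C v → m u = m v) ∧
      ∀ p q, C p ≠ C q → d p (m p) < d p q := by
  have hpert2 := isMetricPerturbation_two_mul h.metric
  obtain ⟨m, hm, hv⟩ := h.voronoi _ hpert2.1
  have hker := h.ker _ hpert2 m hm
  have hv' : ∀ u v, d u (m u) ≤ d u (m v) := fun u v => by linarith [hv u v]
  refine ⟨m, fun u => (hker _ _).2 (hm.1.idem u), fun u v => (hker u v).1, fun p q hpq => ?_⟩
  rw [Ne, hker] at hpq
  have h1 := h.proximity hm hv' (hm.1.idem q) hpq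
  have h2 := h.proximity hm hv' (hm.1.idem p) (Ne.symm hpq)
  -- With a = d(p, m p), b = d(q, m q), D = d(p,q), proximity gives 2a < D + b and 2b < D + a. Twice
  -- the first plus the second is 3a < 3D.
  linarith [h.metric.triangle p q (m q), h.metric.triangle q p (m p), h.metric.symm p q]

/-! ## Rooted trees on the positions `1, …, n`

Position `0` stands for the missing parent of the root `1`. -/

/-- `par` is the parent function of a tree on `1, …, n` and `sub t x` says that `x` belongs to the
subtree of `t`. -/
structure IsRootedTree (n : ℕ) (par : ℕ → ℕ) (sub : ℕ → ℕ → Prop) : Prop where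
  par_lt : ∀ t, 1 ≤ t → t ≤ n → par t < t
  par_pos : ∀ t, 2 ≤ t → t ≤ n → 1 ≤ par t
  self : ∀ t, 1 ≤ t → t ≤ n → sub t t
  step : ∀ t x, 1 ≤ t → 1 ≤ x → x ≤ n → t ≠ x → (sub t x ↔ sub t (par x))
  zero : ∀ t, 1 ≤ t → ¬ sub t 0

/-- The tree grows by shortest edges, as in Prim's algorithm. -/
def IsGreedyTree (n : ℕ) (D : ℕ → ℕ → ℝ) (par : ℕ → ℕ) : Prop :=
  ∀ t a b, 2 ≤ t → 1 ≤ a → a < t → t ≤ b → b ≤ n → D (par t) t ≤ D a b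

namespace IsRootedTree

variable {n : ℕ} {par : ℕ → ℕ} {sub : ℕ → ℕ → Prop} (h : IsRootedTree n par sub)

include h

theorem le_of_sub {t x : ℕ} (ht : 1 ≤ t) (hx : x ≤ n) (hs : sub t x) : t ≤ x := by
  induction x using Nat.strong_induction_on with
  | _ x ih =>
    rcases Nat.eq_zero_or_pos x with rfl | hx0
    · exact absurd hs (h.zero t ht)
    · by_cases htx : t = x
      · exact htx.le
      · have hp := h.par_lt x hx0 hx
        exact (ih _ hp (by omega) ((h.step t x ht hx0 hx htx).1 hs)).trans hp.le

theorem trans {t x y : ℕ} (ht : 1 ≤ t) (hx : 1 ≤ x) (hy : y ≤ n) (h1 : sub t x) (h2 : sub x y) :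
    sub t y := by
  induction y using Nat.strong_induction_on with
  | _ y ih =>
    by_cases hxy : x = y
    · rwa [← hxy]
    · have hle := h.le_of_sub hx hy h2
      have htx := h.le_of_sub ht (hle.trans hy) h1
      have hp := h.par_lt y (by omega) hy
      rw [h.step t y ht (by omega) hy (by omega)]
      exact ih _ hp (by omega) ((h.step x y hx (by omega) hy hxy).1 h2)

theorem comparable {a b c : ℕ} (ha : 1 ≤ a) (hb : 1 ≤ b) (hc : c ≤ n) (h1 : sub a c)
    (h2 : sub b c) : sub a b ∨ sub b a := by
  induction c using Nat.strong_induction_on with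
  | _ c ih =>
    by_cases hac : a = c
    · right; rwa [hac]
    by_cases hbc : b = c
    · left; rwa [hbc]
    have hc0 : 1 ≤ c := ha.trans (h.le_of_sub ha hc h1)
    have hp := h.par_lt c hc0 hc
    exact ih _ hp (by omega) ((h.step a c ha hc0 hc hac).1 h1) ((h.step b c hb hc0 hc hbc).1 h2)

theorem root {x : ℕ} (hx : 1 ≤ x) (hxn : x ≤ n) : sub 1 x := by
  induction x using Nat.strong_induction_on with
  | _ x ih =>
    by_cases hx1 : 1 = x
    · rw [← hx1]; exact h.self 1 le_rfl (by omega)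
    · rw [h.step 1 x le_rfl hx hxn hx1]
      have hp := h.par_lt x hx hxn
      exact ih _ hp (h.par_pos x (by omega) hxn) (by omega)

/-- Positions decrease on the way from x to the root, so some edge on this way crosses from at least
r to below r. -/
theorem exists_crossing {r x : ℕ} (hr : 1 ≤ r) (hrx : r ≤ x) (hx : x ≤ n) :
    ∃ b, r ≤ b ∧ b ≤ x ∧ par b < r ∧ sub b x := by
  induction x using Nat.strong_induction_on with
  | _ x ih =>
    have hp := h.par_lt x (by omega) hx
    by_cases hpr : par x < r
    · exact ⟨x, hrx, le_rfl, hpr, h.self x (by omega) hx⟩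
    · obtain ⟨b, h1, h2, h3, h4⟩ := ih _ hp (by omega) (by omega)
      exact ⟨b, h1, by omega, h3,
        (h.step b x (by omega) (by omega) hx (by omega)).2 h4⟩

/-- A tree edge of a greedy tree is a shortest edge across the cut that it defines. -/
theorem cut {D : ℕ → ℕ → ℝ} (hsymm : ∀ x y, D x y = D y x) (hg : IsGreedyTree n D par) {t : ℕ}
    (ht : 2 ≤ t) (htn : t ≤ n) {x y : ℕ} (hy : 1 ≤ y) (hxn : x ≤ n) (hyn : y ≤ n)
    (hsx : sub t x) (hsy : ¬ sub t y) : D (par t) t ≤ D x y := by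
  induction hk : n - t using Nat.strong_induction_on generalizing t with
  | _ k ih =>
    have htx := h.le_of_sub (by omega) hxn hsx
    -- If y precedes t, then the pair was a candidate when t was attached.
    by_cases hyt : y < t
    · rw [hsymm x y]; exact hg t y x ht hy hyt htx hxn
    have hgrow : ∀ r, (∀ s, t < s → s < r → s ≤ n → t ≤ par s) → ∀ s, t ≤ s → s < r → s ≤ n →
        sub t s := by
      intro r hr s
      induction s using Nat.strong_induction_on with
      | _ s ihs =>
        intro h1 h2 h3
        by_cases hts : t = s
        · rw [← hts]; exact h.self t (by omega) htn
        · rw [h.step t s (by omega) (by omega) h3 hts]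
          have hp := h.par_lt s (by omega) h3
          exact ihs _ hp (hr s (by omega) h2 h3) (by omega) (by omega)
    -- Let r be the first position after t that is attached to a position before t. It exists
    -- because otherwise everything after t, including y, would descend from t. All positions from t
    -- up to r - 1 do descend from t, so y is at least r.
    have hex : ∃ r, t < r ∧ r ≤ n ∧ par r < t := by
      by_contra hno
      push Not at hno
      exact hsy (hgrow (n + 1) (fun s h1 _ h3 => hno s h1 h3) y (by omega) (by omega) hyn)
    classical
    obtain ⟨hr1, hr2, hr3⟩ := Nat.find_spec hex
    have hmin := fun s (hs : s < Nat.find hex) => Nat.find_min hex hs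
    generalize Nat.find hex = r at *
    have hpre := hgrow r fun s h1 h2 h3 => by
      by_contra hcon
      exact hmin s h2 ⟨h1, h3, by omega⟩
    have hyr : r ≤ y := by
      by_contra hcon
      exact hsy (hpre y (by omega) (by omega) hyn)
    -- The edge above r was already available when t was attached, so the edge above t is no longer.
    -- It remains to compare the edge above r with the pair x, y.
    refine (hg t (par r) r ht (h.par_pos r (by omega) hr2) hr3 hr1.le hr2).trans ?_
    by_cases hxr : x < r
    · exact hg r x y (by omega) (by omega) hxr hyr hyn
    -- Here neither x nor y was in the tree when r was attached. The edge above b was a candidate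
    -- then, and its own cut separates x from y, so induction applies to b.
    · obtain ⟨b, hb1, hb2, hb3, hb4⟩ := h.exists_crossing (r := r) (by omega) (not_lt.1 hxr) hxn
      have hb0 := h.par_pos b (by omega) (by omega)
      refine (hg r (par b) b (by omega) hb0 hb3 hb1 (by omega)).trans ?_
      have htb : sub t b := by
        rcases h.comparable (by omega) (by omega) hxn hsx hb4 with h' | h'
        · exact h'
        · have := h.le_of_sub (by omega) htn h'
          omega
      exact ih (n - b) (by omega) (by omega) (by omega) hb4
        (fun h' => hsy (h.trans (by omega) (by omega) hyn htb h')) rfl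

/-- A set of positions with a hub is connected in a greedy tree: it contains both ends of each tree
edge that separates two of its elements. -/
theorem connected {D : ℕ → ℕ → ℝ} (hsymm : ∀ x y, D x y = D y x) (hg : IsGreedyTree n D par)
    {S : ℕ → Prop} {c : ℕ} (hc : 1 ≤ c) (hcn : c ≤ n)
    (hub : ∀ x z, 1 ≤ x → x ≤ n → 1 ≤ z → z ≤ n → S x → ¬ S z → D x c < D x z)
    {v : ℕ} (hv : 2 ≤ v) (hvn : v ≤ n) {x y : ℕ} (hxn : x ≤ n) (hy : 1 ≤ y)
    (hyn : y ≤ n) (hSx : S x) (hSy : S y) (hvx : sub v x) (hvy : ¬ sub v y) :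
    S v ∧ S (par v) := by
  -- Leaving S upwards, with the hub outside the subtree, is impossible: v is closer to the hub than
  -- to a parent outside S, but the pair of v and the hub crosses the cut of the edge above v.
  have hup : ∀ v, 2 ≤ v → v ≤ n → S v → ¬ sub v c → S (par v) := by
    intro v hv hvn hSv hvc
    by_contra hcon
    have hp := h.par_lt v (by omega) hvn
    have h1 := hub v (par v) (by omega) hvn (h.par_pos v hv hvn) (by omega) hSv hcon
    have h2 := h.cut hsymm hg hv hvn hc hvn hcn (h.self v (by omega) hvn) hvc
    rw [hsymm v (par v)] at h1
    linarith
  -- The same argument from the parent when the hub lies below v. Together the two facts say that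
  -- one step in the tree towards the hub stays in S.
  have hdown : ∀ v, 2 ≤ v → v ≤ n → S (par v) → sub v c → S v := by
    intro v hv hvn hSv hvc
    by_contra hcon
    have hp := h.par_lt v (by omega) hvn
    have hp1 := h.par_pos v hv hvn
    have h1 := hub (par v) v hp1 (by omega) (by omega) hvn hSv hcon
    have h2 := h.cut hsymm hg hv hvn hp1 hcn (by omega) hvc fun h' => by
      have := h.le_of_sub (by omega) (by omega) h'
      omega
    rw [hsymm c (par v)] at h2
    linarith
  by_cases hvc : sub v c
  -- The hub is below v and y is not, so the path from y to the hub crosses this edge downwards. The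
  -- path first climbs from y to an ancestor of v, and then descends to the parent of v.
  · suffices hS : S (par v) from ⟨hdown v hv hvn hS hvc, hS⟩
    clear hvx hSx hxn x
    induction v using Nat.strong_induction_on with
    | _ v ih =>
      have hp := h.par_lt v (by omega) hvn
      have hp1 := h.par_pos v hv hvn
      by_cases huy : sub (par v) y
      · clear ih
        induction y using Nat.strong_induction_on with
        | _ y ih =>
          by_cases hyu : par v = y
          · rwa [hyu]
          have hle := h.le_of_sub hp1 hyn huy
          -- As long as the climb from y has not reached the parent of v, the hub is not below it,
          -- so the next step upwards stays in S.
          have hyc : ¬ sub y c := by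
            intro hyc
            rcases h.comparable hy (by omega) hcn hyc hvc with h' | h'
            · by_cases hvy' : y = v
              · rw [hvy'] at hvy; exact hvy (h.self v (by omega) hvn)
              · rw [h.step y v hy (by omega) hvn hvy'] at h'
                have := h.le_of_sub hy (by omega) h'
                omega
            · exact hvy h'
          have hy2 : 2 ≤ y := by omega
          have hpy := h.par_lt y hy hyn
          refine ih (par y) hpy (h.par_pos y hy2 hyn) (by omega) (hup y hy2 hyn hSy hyc) ?_ ?_
          · intro h'
            refine hvy ((h.step v y (by omega) hy hyn ?_).2 h')
            rintro rfl
            exact hvy (h.self v (by omega) hvn)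
          · exact (h.step (par v) y hp1 hy hyn hyu).1 huy
      · have hu2 : 2 ≤ par v := by
          by_contra hcon
          have : par v = 1 := by omega
          rw [this] at huy
          exact huy (h.root hy hyn)
        have huc : sub (par v) c := by
          refine h.trans hp1 (by omega) hcn ?_ hvc
          rw [h.step (par v) v hp1 (by omega) hvn hp.ne]
          exact h.self _ hp1 (by omega)
        exact hdown _ hu2 (by omega) (ih _ hp hu2 (by omega) huy huc) huc
  -- The hub is outside the subtree of v, so the path from x to the hub climbs to v and leaves
  -- through its parent.
  · suffices hS : S v from ⟨hS, hup v hv hvn hS hvc⟩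
    clear hvy hSy hyn hy y
    induction x using Nat.strong_induction_on with
    | _ x ih =>
      by_cases hvx' : v = x
      · rwa [hvx']
      have hle := h.le_of_sub (by omega) hxn hvx
      have hp := h.par_lt x (by omega) hxn
      refine ih (par x) hp (by omega) (hup x (by omega) hxn hSx fun h' => hvc ?_)
        ((h.step v x (by omega) (by omega) hxn hvx').1 hvx)
      exact h.trans (by omega) (by omega) hcn hvx h'

end IsRootedTree

/-- The local condition on the labels `c` of the parent of `t` and `c'` of `t`. -/
def Allowed (sub : ℕ → ℕ → Prop) (t c c' : ℕ) : Prop :=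
  c' = c ∨ (¬ sub t c ∧ sub t c')

/-- The labeling `φ` satisfies the local conditions. -/
structure IsTreeLabeling (n : ℕ) (par : ℕ → ℕ) (sub : ℕ → ℕ → Prop) (φ : ℕ → ℕ) : Prop where
  zero : φ 0 = 0
  pos : ∀ t, 1 ≤ t → t ≤ n → 1 ≤ φ t
  le : ∀ t, 1 ≤ t → t ≤ n → φ t ≤ n
  allowed : ∀ t, 1 ≤ t → t ≤ n → Allowed sub t (φ (par t)) (φ t)

/-- A label that differs from the label of the parent names a vertex in the subtree of t. On the
path down to that vertex the label cannot change again, so the vertex carries its own name. A label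
equal to that of the parent is handled by induction; at the root this case is excluded by the label
0 of position 0. -/
theorem IsTreeLabeling.idem {n : ℕ} {par : ℕ → ℕ} {sub : ℕ → ℕ → Prop} {φ : ℕ → ℕ}
    (hφ : IsTreeLabeling n par sub φ) (h : IsRootedTree n par sub) {t : ℕ} (ht : 1 ≤ t)
    (htn : t ≤ n) : φ (φ t) = φ t := by
  induction t using Nat.strong_induction_on with
  | _ t ih =>
    have hp := h.par_lt t ht htn
    have hc := hφ.pos t ht htn
    have hcn := hφ.le t ht htn
    rcases hφ.allowed t ht htn with h1 | ⟨-, h1⟩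
    · rcases Nat.eq_zero_or_pos (par t) with h0 | h0
      · rw [h0, hφ.zero] at h1
        omega
      · rw [h1]; exact ih _ hp h0 (by omega)
    -- Every x on the path has the named vertex below it. By induction this vertex is the label of
    -- the parent of x, so the second alternative of the local condition fails at x.
    · have key : ∀ x, x ≤ n → sub t x → sub x (φ t) → φ x = φ t := by
        intro x
        induction x using Nat.strong_induction_on with
        | _ x ihx =>
          intro hx htx hxc
          by_cases hx' : t = x
          · rw [hx']
          have hle := h.le_of_sub ht hx htx
          have hpx := h.par_lt x (by omega) hx
          have htp := (h.step t x ht (by omega) hx hx').1 htx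
          have hlep := h.le_of_sub ht (by omega) htp
          have hpc : sub (par x) (φ t) := by
            refine h.trans (by omega) (by omega) hcn ?_ hxc
            rw [h.step (par x) x (by omega) (by omega) hx hpx.ne]
            exact h.self _ (by omega) (by omega)
          have h2 := ihx _ hpx (by omega) htp hpc
          rcases hφ.allowed x (by omega) hx with h3 | ⟨h3, -⟩
          · rw [h3, h2]
          · rw [h2] at h3
            exact absurd hxc h3
      exact key _ hcn h1 (h.self _ hc hcn)

/-- A labeling of clusters with hubs by one element of each cluster satisfies the local
conditions. -/
theorem isTreeLabeling_of_hubs {n : ℕ} {par : ℕ → ℕ} {sub : ℕ → ℕ → Prop}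
    (h : IsRootedTree n par sub) {D : ℕ → ℕ → ℝ} (hsymm : ∀ x y, D x y = D y x)
    (hg : IsGreedyTree n D par) {α : Type*} {κ : ℕ → α} {φ hub : ℕ → ℕ}
    (h0 : φ 0 = 0) (hφ1 : ∀ t, 1 ≤ t → t ≤ n → 1 ≤ φ t) (hφn : ∀ t, 1 ≤ t → t ≤ n → φ t ≤ n)
    (hκ : ∀ t, 1 ≤ t → t ≤ n → κ (φ t) = κ t)
    (hφκ : ∀ s t, 1 ≤ s → s ≤ n → 1 ≤ t → t ≤ n → κ s = κ t → φ s = φ t)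
    (hhub1 : ∀ t, 1 ≤ t → t ≤ n → 1 ≤ hub t) (hhubn : ∀ t, 1 ≤ t → t ≤ n → hub t ≤ n)
    (hhubκ : ∀ s t, 1 ≤ s → s ≤ n → 1 ≤ t → t ≤ n → κ s = κ t → hub s = hub t)
    (hhub : ∀ x z, 1 ≤ x → x ≤ n → 1 ≤ z → z ≤ n → κ x ≠ κ z → D x (hub x) < D x z) :
    IsTreeLabeling n par sub φ where
  zero := h0
  pos := hφ1
  le := hφn
  allowed t ht htn := by
    -- At the root the label of the missing parent is 0, which lies in no subtree, so every label is
    -- permitted.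
    by_cases ht1 : t = 1
    · right
      have := h.par_lt t ht htn
      have hp : par t = 0 := by omega
      rw [hp, h0, ht1]
      exact ⟨h.zero 1 le_rfl, h.root (hφ1 1 le_rfl (by omega)) (hφn 1 le_rfl (by omega))⟩
    have ht2 : 2 ≤ t := by omega
    have hp := h.par_lt t ht htn
    have hp1 := h.par_pos t ht2 htn
    have hpn : par t ≤ n := by omega
    by_cases hκt : κ t = κ (par t)
    · left; exact hφκ _ _ ht htn hp1 hpn hκt
    -- If the edge above t joins different clusters, connectedness forbids any cluster to have
    -- elements on both sides. So the center of the parent stays outside the subtree of t and the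
    -- center of t inside.
    have hconn : ∀ s, 1 ≤ s → s ≤ n → ∀ x y, x ≤ n → 1 ≤ y → y ≤ n → κ x = κ s → κ y = κ s →
        sub t x → sub t y := by
      intro s hs hsn x y hx hy hyn hxs hys htx
      by_contra hty
      obtain ⟨h1, h2⟩ := h.connected (S := fun z => κ z = κ s) hsymm hg (hhub1 s hs hsn)
        (hhubn s hs hsn) (fun x z hx1 hxn hz1 hzn hx hz => by
          rw [← hhubκ x s hx1 hxn hs hsn hx]
          exact hhub x z hx1 hxn hz1 hzn fun h' => hz (h' ▸ hx))
        ht2 htn hx hy hyn hxs hys htx hty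
      exact hκt (h1.trans h2.symm)
    right
    constructor
    · intro hsub
      have h1 := hconn (par t) hp1 hpn _ (par t) (hφn _ hp1 hpn) hp1 hpn (hκ _ hp1 hpn) rfl hsub
      have := h.le_of_sub ht hpn h1
      omega
    · exact hconn t ht htn t _ htn (hφ1 t ht htn) (hφn t ht htn) rfl (hκ t ht htn)
        (h.self t ht htn)

/-! ## Dynamic programming on rooted trees -/

/-- The first child of `p` that is at least `t`, or `0` if there is none. -/
noncomputable def head (n : ℕ) (par : ℕ → ℕ) (t p : ℕ) : ℕ :=
  sInf {s | t ≤ s ∧ s ≤ n ∧ par s = p}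

theorem head_of_lt {n : ℕ} {par : ℕ → ℕ} {t : ℕ} (p : ℕ) (ht : n < t) : head n par t p = 0 := by
  have : {s | t ≤ s ∧ s ≤ n ∧ par s = p} = ∅ := by
    ext s
    simp only [Set.mem_ofPred_eq, Set.mem_empty_iff_false, iff_false]
    omega
  rw [head, this, Nat.sInf_empty]

theorem head_par {n : ℕ} {par : ℕ → ℕ} {t : ℕ} (ht : t ≤ n) : head n par t (par t) = t := by
  refine le_antisymm (Nat.sInf_le ⟨le_rfl, ht, rfl⟩) ?_
  exact (Nat.sInf_mem (s := {s | t ≤ s ∧ s ≤ n ∧ par s = par t}) ⟨t, le_rfl, ht, rfl⟩).1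

theorem head_of_ne {n : ℕ} {par : ℕ → ℕ} {t p : ℕ} (hp : p ≠ par t) :
    head n par t p = head n par (t + 1) p := by
  unfold head
  congr 1
  ext s
  simp only [Set.mem_ofPred_eq]
  constructor
  · rintro ⟨h1, h2, h3⟩
    refine ⟨?_, h2, h3⟩
    have : t ≠ s := by rintro rfl; exact hp h3.symm
    omega
  · rintro ⟨h1, h2, h3⟩
    exact ⟨by omega, h2, h3⟩

section Fold

variable {α : Type*} (op : α → α → α) [Std.Commutative op] [Std.Associative op] (e : α)

/-- Bookkeeping for one vertex t with parent p: the remaining children of p are t and its later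
siblings, so the entry at p combines the own share w of t, the entry of its children and the entry
of its siblings. -/
theorem fold_range_step {A A' : ℕ → α} {w : α} {p t : ℕ} (hp : p < t)
    (hne : ∀ q, q < t → q ≠ p → A' q = A q) (hA' : A' p = op (op w (A t)) (A p)) :
    (Finset.range t).fold op e A' = op w ((Finset.range (t + 1)).fold op e A) := by
  have hmem : p ∈ Finset.range t := Finset.mem_range.2 hp
  rw [Finset.range_add_one, Finset.fold_insert Finset.notMem_range_self, ← Finset.insert_erase hmem,
    Finset.fold_insert (Finset.notMem_erase _ _), Finset.fold_insert (Finset.notMem_erase _ _), hA',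
    Finset.fold_congr (g := A) fun q hq => hne q (Finset.mem_range.1 (Finset.mem_of_mem_erase hq))
      (Finset.ne_of_mem_erase hq)]
  simp only [Std.Associative.assoc (op := op)]

theorem fold_const_of_idem (he : op e e = e) (s : Finset ℕ) : s.fold op e (fun _ => e) = e := by
  classical
  induction s using Finset.induction_on with
  | empty => rfl
  | insert a s ha ih => rw [Finset.fold_insert ha, ih, he]

/-- The value e need not be neutral: for maxima it is only a lower bound of the costs. Idempotency
is the property that covers this case as well as zero for sums. -/
theorem op_fold_of_idem (he : op e e = e) (s : Finset ℕ) (f : ℕ → α) :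
    op (s.fold op e f) e = s.fold op e f := by
  classical
  induction s using Finset.induction_on with
  | empty => exact he
  | insert a s ha ih => rw [Finset.fold_insert ha, Std.Associative.assoc (op := op), ih]

end Fold

/-- Indicator of the positions that are centers. -/
def selfCount (t c : ℕ) : ℕ := if c = t then 1 else 0

/-- The number of centers of a labeling. -/
def centerCount (n : ℕ) (φ : ℕ → ℕ) : ℕ :=
  (Finset.Ico 1 (n + 1)).fold ((· + ·) : ℕ → ℕ → ℕ) 0 fun t => selfCount t (φ t)

/-- The combined cost of a labeling. -/
noncomputable def labelCost (n : ℕ) (op : ℝ → ℝ → ℝ) [Std.Commutative op] [Std.Associative op]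
    (e : ℝ) (own : ℕ → ℕ → ℝ) (φ : ℕ → ℕ) : ℝ :=
  (Finset.Ico 1 (n + 1)).fold op e fun t => own t (φ t)

/-- The table of the dynamic program. The entry `(t, j, c)` stands for the labelings of the
subtrees of `t` and of its later siblings that have `j` centers, where `c` is the label of the
parent of `t`: it says if they exist, their smallest cost, and for a labeling of smallest cost
the label of `t` and the numbers of centers below `t` and in the subtrees of the later siblings. -/
structure Table where
  feas : ℕ → ℕ → ℕ → Prop
  val : ℕ → ℕ → ℕ → ℝ
  label : ℕ → ℕ → ℕ → ℕ
  below : ℕ → ℕ → ℕ → ℕ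
  later : ℕ → ℕ → ℕ → ℕ

section DP

variable (n : ℕ) (par : ℕ → ℕ) (sub : ℕ → ℕ → Prop) (op : ℝ → ℝ → ℝ) (e : ℝ) (own : ℕ → ℕ → ℝ)

/-- The entries for the empty set of subtrees. -/
structure Table.Null (B : Table) : Prop where
  feas : ∀ j c, c ≤ n → (B.feas 0 j c ↔ j = 0)
  val : ∀ c, c ≤ n → B.val 0 0 c = e

/-- No choice at `t` is better than the entries of the table. -/
def Table.Relaxed (B : Table) (t : ℕ) : Prop :=
  ∀ c c' j₁ j₂, c ≤ n → 1 ≤ c' → c' ≤ n → j₁ ≤ n → j₂ ≤ n → Allowed sub t c c' →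
    B.feas (head n par (t + 1) t) j₁ c' → B.feas (head n par (t + 1) (par t)) j₂ c →
    B.feas t (j₁ + j₂ + selfCount t c') c ∧
      B.val t (j₁ + j₂ + selfCount t c') c ≤
        op (op (own t c') (B.val (head n par (t + 1) t) j₁ c'))
          (B.val (head n par (t + 1) (par t)) j₂ c)

/-- The entry of the table at `(t, j, c)` is the result of a choice at `t`. -/
structure Table.AttainedAt (B : Table) (t j c : ℕ) : Prop where
  pos : 1 ≤ B.label t j c
  le : B.label t j c ≤ n
  allowed : Allowed sub t c (B.label t j c)
  feas_below : B.feas (head n par (t + 1) t) (B.below t j c) (B.label t j c)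
  feas_later : B.feas (head n par (t + 1) (par t)) (B.later t j c) c
  count : j = B.below t j c + B.later t j c + selfCount t (B.label t j c)
  val : B.val t j c = op (op (own t (B.label t j c))
    (B.val (head n par (t + 1) t) (B.below t j c) (B.label t j c)))
    (B.val (head n par (t + 1) (par t)) (B.later t j c) c)

/-- The table is correct. -/
structure Table.Correct (B : Table) : Prop where
  null : B.Null n e
  relaxed : ∀ t, 1 ≤ t → t ≤ n → B.Relaxed n par sub op own t
  attained : ∀ t j c, 1 ≤ t → t ≤ n → c ≤ n → B.feas t j c → B.AttainedAt n par sub op own t j c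

variable {n par sub op e own} {B : Table}

theorem Ico_one_eq_insert {t : ℕ} (ht : 1 ≤ t) :
    Finset.Ico 1 (t + 1) = insert t (Finset.Ico 1 t) := by
  ext s; simp only [Finset.mem_Ico, Finset.mem_insert]; omega

theorem Ico_succ_eq_insert {n t : ℕ} (ht : t ≤ n) :
    Finset.Ico t (n + 1) = insert t (Finset.Ico (t + 1) (n + 1)) := by
  ext s; simp only [Finset.mem_Ico, Finset.mem_insert]; omega

theorem centerCount_eq_card (n : ℕ) (φ : ℕ → ℕ) :
    centerCount n φ = ((Finset.Ico 1 (n + 1)).filter fun t => φ t = t).card := by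
  rw [Finset.card_filter, Finset.sum_eq_fold]; rfl

theorem fold_selfCount_le (s : Finset ℕ) (φ : ℕ → ℕ) :
    (s.fold ((· + ·) : ℕ → ℕ → ℕ) 0 fun t => selfCount t (φ t)) ≤ s.card := by
  have : (s.fold ((· + ·) : ℕ → ℕ → ℕ) 0 fun t => selfCount t (φ t)) = (s.filter fun t => φ t = t).card := by
    rw [Finset.card_filter, Finset.sum_eq_fold]; rfl
  rw [this]
  exact Finset.card_filter_le _ _

/-- The positions from t on form a forest whose trees hang below positions p < t. For the part below
p, N p is its number of centers under φ and W p its cost. Going from t + 1 down to t, the parts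
below t and below its parent merge, together with t itself. -/
theorem Table.Correct.lower_bound [Std.Commutative op] [Std.Associative op]
    (hmono : ∀ a b c d, a ≤ b → c ≤ d → op a c ≤ op b d) (he : op e e = e)
    (hB : B.Correct n par sub op e own) (h : IsRootedTree n par sub) {φ : ℕ → ℕ}
    (hφ : IsTreeLabeling n par sub φ) {t : ℕ} (ht : 1 ≤ t) (htn : t ≤ n + 1) :
    ∃ (N : ℕ → ℕ) (W : ℕ → ℝ),
      (∀ p, p < t → B.feas (head n par t p) (N p) (φ p) ∧
        B.val (head n par t p) (N p) (φ p) ≤ W p) ∧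
      (Finset.range t).fold ((· + ·) : ℕ → ℕ → ℕ) 0 N =
        (Finset.Ico t (n + 1)).fold ((· + ·) : ℕ → ℕ → ℕ) 0 (fun s => selfCount s (φ s)) ∧
      (Finset.range t).fold op e W = (Finset.Ico t (n + 1)).fold op e (fun s => own s (φ s)) := by
  have hφn : ∀ p, p ≤ n → φ p ≤ n := by
    intro p hp
    rcases Nat.eq_zero_or_pos p with rfl | hp0
    · rw [hφ.zero]; exact Nat.zero_le _
    · exact hφ.le p hp0 hp
  induction hk : n + 1 - t generalizing t with
  | zero =>
    obtain rfl : t = n + 1 := by omega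
    refine ⟨fun _ => 0, fun _ => e, fun p hp => ?_, ?_, ?_⟩
    · rw [head_of_lt p (Nat.lt_succ_self n)]
      exact ⟨(hB.null.feas _ _ (hφn p (by omega))).2 rfl, (hB.null.val _ (hφn p (by omega))).le⟩
    · rw [fold_const_of_idem ((· + ·) : ℕ → ℕ → ℕ) 0 rfl]; simp
    · rw [fold_const_of_idem _ _ he]; simp
  | succ k ih =>
    have htn' : t ≤ n := by omega
    obtain ⟨N, W, h1, h2, h3⟩ := ih (t := t + 1) (by omega) (by omega) (by omega)
    have hp := h.par_lt t ht htn'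
    -- The table is only known to be relaxed for numbers of centers up to n, since the program tries
    -- no others.
    have hN : ∀ p, p < t + 1 → N p ≤ n := by
      intro p hp
      have h4 : N p ≤ ∑ q ∈ Finset.range (t + 1), N q :=
        Finset.single_le_sum (fun _ _ => Nat.zero_le _) (Finset.mem_range.2 hp)
      rw [Finset.sum_eq_fold, h2] at h4
      refine h4.trans ((fold_selfCount_le _ _).trans ?_)
      rw [Nat.card_Ico]
      omega
    obtain ⟨h4, h5⟩ := hB.relaxed t ht htn' (φ (par t)) (φ t) (N t) (N (par t))
      (hφn _ (by omega)) (hφ.pos t ht htn') (hφ.le t ht htn') (hN _ (by omega)) (hN _ (by omega))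
      (hφ.allowed t ht htn') (h1 t (by omega)).1 (h1 (par t) (by omega)).1
    -- The entries at t itself become irrelevant, since only p < t is considered from here on.
    refine ⟨Function.update N (par t) (selfCount t (φ t) + N t + N (par t)),
      Function.update W (par t) (op (op (own t (φ t)) (W t)) (W (par t))), fun p hp' => ?_, ?_, ?_⟩
    · by_cases hpt : p = par t
      · subst hpt
        rw [head_par htn', Function.update_self, Function.update_self]
        have : selfCount t (φ t) + N t + N (par t) = N t + N (par t) + selfCount t (φ t) := by omega
        rw [this]
        refine ⟨h4, h5.trans (hmono _ _ _ _ (hmono _ _ _ _ le_rfl ?_) ?_)⟩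
        · exact (h1 t (by omega)).2
        · exact (h1 (par t) (by omega)).2
      · rw [head_of_ne hpt, Function.update_of_ne hpt, Function.update_of_ne hpt]
        exact h1 p (by omega)
    · rw [Ico_succ_eq_insert htn', Finset.fold_insert (by simp), ← h2]
      exact fold_range_step _ _ hp (fun q _ hq => Function.update_of_ne hq _ _) (by simp)
    · rw [Ico_succ_eq_insert htn', Finset.fold_insert (by simp), ← h3]
      exact fold_range_step _ _ hp (fun q _ hq => Function.update_of_ne hq _ _) (by simp)

theorem Table.Correct.le_labelCost [Std.Commutative op] [Std.Associative op]
    (hmono : ∀ a b c d, a ≤ b → c ≤ d → op a c ≤ op b d) (he : op e e = e)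
    (hB : B.Correct n par sub op e own) (h : IsRootedTree n par sub) {φ : ℕ → ℕ}
    (hφ : IsTreeLabeling n par sub φ) :
    B.feas (head n par 1 0) (centerCount n φ) 0 ∧
      op (B.val (head n par 1 0) (centerCount n φ) 0) e ≤ labelCost n op e own φ := by
  obtain ⟨N, W, h1, h2, h3⟩ := hB.lower_bound hmono he h hφ le_rfl (by omega)
  have h4 := h1 0 (by omega)
  have h5 : N 0 = centerCount n φ := by
    rw [centerCount, ← h2]; simp
  rw [hφ.zero, h5] at h4
  refine ⟨h4.1, ?_⟩
  rw [labelCost, ← h3]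
  simpa using hmono _ _ _ _ h4.2 le_rfl

/-- State of the construction of a labeling from the table, after the positions below `t` have
been labeled: `K p` is the number of centers in the subtrees of the remaining children of `p`. -/
structure Table.PartialLabeling (B : Table) (n : ℕ) (par : ℕ → ℕ) (sub : ℕ → ℕ → Prop)
    (op : ℝ → ℝ → ℝ) [Std.Commutative op] [Std.Associative op] (e : ℝ) (own : ℕ → ℕ → ℝ)
    (k t : ℕ) (K φ : ℕ → ℕ) : Prop where
  zero : φ 0 = 0
  pos : ∀ s, 1 ≤ s → s < t → 1 ≤ φ s
  le : ∀ s, 1 ≤ s → s < t → φ s ≤ n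
  allowed : ∀ s, 1 ≤ s → s < t → Allowed sub s (φ (par s)) (φ s)
  feas : ∀ p, p < t → B.feas (head n par t p) (K p) (φ p)
  count : (Finset.Ico 1 t).fold ((· + ·) : ℕ → ℕ → ℕ) 0 (fun s => selfCount s (φ s)) +
    (Finset.range t).fold ((· + ·) : ℕ → ℕ → ℕ) 0 K = k
  cost : op ((Finset.Ico 1 t).fold op e fun s => own s (φ s))
    ((Finset.range t).fold op e fun p => B.val (head n par t p) (K p) (φ p)) =
    op (B.val (head n par 1 0) k 0) e

theorem Table.PartialLabeling.init [Std.Commutative op] [Std.Associative op] (he : op e e = e)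
    {k : ℕ} {K φ : ℕ → ℕ} (hf : B.feas (head n par 1 0) k 0) (hK : K 0 = k) (hφ : φ 0 = 0) :
    B.PartialLabeling n par sub op e own k 1 K φ where
  zero := hφ
  pos s h1 h2 := by omega
  le s h1 h2 := by omega
  allowed s h1 h2 := by omega
  feas p hp := by
    obtain rfl : p = 0 := by omega
    rwa [hK, hφ]
  count := by simpa using hK
  cost := by
    simp only [Finset.Ico_self, Finset.fold_empty, Finset.range_one, Finset.fold_singleton, hK, hφ]
    rw [Std.Commutative.comm (op := op) e, Std.Associative.assoc (op := op), he]

/-- The merging of the lower bound in reverse: the entry attained at t splits the demand at the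
parent into the demand of the children of t, that of its later siblings, and possibly one center at
t. Total count and cost are preserved. -/
theorem Table.PartialLabeling.step [Std.Commutative op] [Std.Associative op]
    (hB : B.Correct n par sub op e own) (h : IsRootedTree n par sub) {k t : ℕ} {K φ K' φ' : ℕ → ℕ}
    (ht : 1 ≤ t) (htn : t ≤ n) (hP : B.PartialLabeling n par sub op e own k t K φ)
    (hφ' : φ' = Function.update φ t (B.label t (K (par t)) (φ (par t))))
    (hK' : K' = Function.update (Function.update K t (B.below t (K (par t)) (φ (par t)))) (par t)
      (B.later t (K (par t)) (φ (par t)))) :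
    B.PartialLabeling n par sub op e own k (t + 1) K' φ' := by
  have hp := h.par_lt t ht htn
  have hφlt : ∀ s, s < t → φ' s = φ s := fun s hs => by
    rw [hφ', Function.update_of_ne hs.ne]
  have hpn : φ (par t) ≤ n := by
    rcases Nat.eq_zero_or_pos (par t) with h0 | h0
    · rw [h0, hP.zero]; exact Nat.zero_le _
    · exact hP.le _ h0 hp
  have hfeas := hP.feas (par t) hp
  rw [head_par htn] at hfeas
  have hA := hB.attained t _ _ ht htn hpn hfeas
  have hφt : φ' t = B.label t (K (par t)) (φ (par t)) := by rw [hφ', Function.update_self]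
  have hKt : K' t = B.below t (K (par t)) (φ (par t)) := by
    rw [hK', Function.update_of_ne hp.ne', Function.update_self]
  have hKp : K' (par t) = B.later t (K (par t)) (φ (par t)) := by
    rw [hK', Function.update_self]
  have hKne : ∀ s, s < t → s ≠ par t → K' s = K s := fun s hs hs' => by
    rw [hK', Function.update_of_ne hs', Function.update_of_ne hs.ne]
  constructor
  · rw [hφlt 0 (by omega), hP.zero]
  · intro s h1 h2
    rcases Nat.lt_succ_iff_lt_or_eq.1 h2 with h3 | rfl
    · rw [hφlt s h3]; exact hP.pos s h1 h3
    · rw [hφt]; exact hA.pos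
  · intro s h1 h2
    rcases Nat.lt_succ_iff_lt_or_eq.1 h2 with h3 | rfl
    · rw [hφlt s h3]; exact hP.le s h1 h3
    · rw [hφt]; exact hA.le
  · intro s h1 h2
    rcases Nat.lt_succ_iff_lt_or_eq.1 h2 with h3 | rfl
    · have := h.par_lt s h1 (by omega)
      rw [hφlt s h3, hφlt _ (by omega)]; exact hP.allowed s h1 h3
    · rw [hφlt _ hp, hφt]; exact hA.allowed
  · intro p hp'
    rcases Nat.lt_succ_iff_lt_or_eq.1 hp' with h3 | rfl
    · by_cases hpt : p = par t
      · rw [hpt, hφlt _ hp, hKp]; exact hA.feas_later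
      · rw [hφlt _ h3, hKne _ h3 hpt, ← head_of_ne hpt]
        exact hP.feas p h3
    · rw [hφt, hKt]; exact hA.feas_below
  · rw [← hP.count, Ico_one_eq_insert ht, Finset.fold_insert (by simp),
      Finset.fold_congr (g := fun s => selfCount s (φ s)) fun s hs => by
        rw [hφlt s (Finset.mem_Ico.1 hs).2],
      fold_range_step (A := K') (A' := K) (w := selfCount t (φ' t)) ((· + ·) : ℕ → ℕ → ℕ) 0 hp
        (fun q hq hq' => (hKne q hq hq').symm)
        (by rw [hKt, hKp, hφt]; have := hA.count; omega)]
    omega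
  · rw [← hP.cost, Ico_one_eq_insert ht, Finset.fold_insert (by simp),
      Finset.fold_congr (g := fun s => own s (φ s)) fun s hs => by
        rw [hφlt s (Finset.mem_Ico.1 hs).2],
      fold_range_step (A := fun p => B.val (head n par (t + 1) p) (K' p) (φ' p))
        (A' := fun p => B.val (head n par t p) (K p) (φ p)) (w := own t (φ' t)) op e hp]
    · rw [Std.Commutative.comm (op := op) (own t (φ' t)), Std.Associative.assoc (op := op)]
    · intro q hq hq'
      rw [head_of_ne hq', hKne q hq hq', hφlt q hq]
    · rw [head_par htn, hKt, hKp, hφt, hφlt _ hp]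
      exact hA.val

theorem Table.PartialLabeling.isTreeLabeling [Std.Commutative op] [Std.Associative op] {k : ℕ}
    {K φ : ℕ → ℕ} (hP : B.PartialLabeling n par sub op e own k (n + 1) K φ) :
    IsTreeLabeling n par sub φ :=
  ⟨hP.zero, fun s h1 h2 => hP.pos s h1 (by omega), fun s h1 h2 => hP.le s h1 (by omega),
    fun s h1 h2 => hP.allowed s h1 (by omega)⟩

/-- When all positions are labeled, every remaining list of children is empty. Null entries have
zero centers and value e, so all k centers have been placed and the cost of φ is the value at the
root, which bounds every competitor from below. -/
theorem Table.PartialLabeling.optimal [Std.Commutative op] [Std.Associative op]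
    (hmono : ∀ a b c d, a ≤ b → c ≤ d → op a c ≤ op b d) (he : op e e = e)
    (hB : B.Correct n par sub op e own) (h : IsRootedTree n par sub) {k : ℕ} {K φ : ℕ → ℕ}
    (hP : B.PartialLabeling n par sub op e own k (n + 1) K φ) :
    centerCount n φ = k ∧ ∀ ψ, IsTreeLabeling n par sub ψ → centerCount n ψ = k →
      labelCost n op e own φ ≤ labelCost n op e own ψ := by
  have hφ := hP.isTreeLabeling
  have hφn : ∀ p, p < n + 1 → φ p ≤ n := by
    intro p hp
    rcases Nat.eq_zero_or_pos p with rfl | hp0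
    · rw [hφ.zero]; exact Nat.zero_le _
    · exact hφ.le p hp0 (by omega)
  have hK : ∀ p, p < n + 1 → K p = 0 := by
    intro p hp
    have := hP.feas p hp
    rw [head_of_lt p (Nat.lt_succ_self n)] at this
    exact (hB.null.feas _ _ (hφn p hp)).1 this
  constructor
  · rw [← hP.count, Finset.fold_congr (s := Finset.range (n + 1)) (g := fun _ => 0) fun p hp =>
      hK p (Finset.mem_range.1 hp), fold_const_of_idem ((· + ·) : ℕ → ℕ → ℕ) 0 rfl]
    rfl
  · intro ψ hψ hk
    have h1 := (hB.le_labelCost hmono he h hψ).2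
    rw [hk, ← hP.cost, Finset.fold_congr (s := Finset.range (n + 1)) (g := fun _ => e),
      fold_const_of_idem _ _ he, op_fold_of_idem _ _ he] at h1
    · exact h1
    · intro p hp
      rw [head_of_lt p (Nat.lt_succ_self n), hK p (Finset.mem_range.1 hp)]
      exact hB.null.val _ (hφn p (Finset.mem_range.1 hp))

end DP

/-! ## Programs with bounded loops -/

/-- Writing a natural cell. -/
def Store.putNat (s : Store) (x : Cell) (v : ℕ) : Store :=
  { s with nat := Function.update s.nat x v }

/-- Writing a real cell. -/
noncomputable def Store.putReal (s : Store) (x : Cell) (v : ℝ) : Store :=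
  { s with real := Function.update s.real x v }

@[simp] theorem Store.putNat_nat (s : Store) (x y : Cell) (v : ℕ) :
    (s.putNat x v).nat y = if y = x then v else s.nat y := Function.update_apply _ _ _ _

@[simp] theorem Store.putNat_real (s : Store) (x : Cell) (v : ℕ) :
    (s.putNat x v).real = s.real := rfl

@[simp] theorem Store.putReal_real (s : Store) (x y : Cell) (v : ℝ) :
    (s.putReal x v).real y = if y = x then v else s.real y := Function.update_apply _ _ _ _

@[simp] theorem Store.putReal_nat (s : Store) (x : Cell) (v : ℝ) :
    (s.putReal x v).nat = s.nat := rfl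

/-- The natural variable with the name `a`. -/
def NExp.var (a : ℕ) : NExp := .get a (.lit 0) (.lit 0) (.lit 0)

/-- The entry `i` of the natural array `a`. -/
def NExp.at (a : ℕ) (i : NExp) : NExp := .get a i (.lit 0) (.lit 0)

/-- The real variable with the name `a`. -/
def RExp.var (a : ℕ) : RExp := .get a (.lit 0) (.lit 0) (.lit 0)

/-- Programs in which each loop runs through the numbers `0, …, n`. -/
inductive Blk
  | skip
  | setNat (a : ℕ) (i j l e : NExp)
  | setReal (a : ℕ) (i j l : NExp) (e : RExp)
  | seq (p q : Blk)
  | branch (b : BExp) (p q : Blk)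
  | loop (a : ℕ) (p : Blk)

namespace Blk

/-- Assignment to a natural variable. -/
def letNat (a : ℕ) (e : NExp) : Blk := .setNat a (.lit 0) (.lit 0) (.lit 0) e

/-- Assignment to a real variable. -/
def letReal (a : ℕ) (e : RExp) : Blk := .setReal a (.lit 0) (.lit 0) (.lit 0) e

/-- Translation to the machine model. -/
def compile : Blk → Prog
  | skip => .skip
  | setNat a i j l e => .setNat a i j l e
  | setReal a i j l e => .setReal a i j l e
  | seq p q => .seq p.compile q.compile
  | branch b p q => .branch b p.compile q.compile
  | loop a p => .seq (.setNat a (.lit 0) (.lit 0) (.lit 0) (.lit 0))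
      (.loop (.natLt (.var a) (.add .size (.lit 1)))
        (.seq p.compile (.setNat a (.lit 0) (.lit 0) (.lit 0) (.add (.var a) (.lit 1)))))

/-- The memory after `m` rounds. -/
def iterate (s : Store) (f : ℕ → Store → Store) : ℕ → Store
  | 0 => s
  | m + 1 => f m (iterate s f m)

open Classical in
/-- The memory after the execution of a program. -/
noncomputable def exec (I : Input) : Blk → Store → Store
  | skip, s => s
  | setNat a i j l e, s => s.putNat (a, i.eval I s, j.eval I s, l.eval I s) (e.eval I s)
  | setReal a i j l e, s => s.putReal (a, i.eval I s, j.eval I s, l.eval I s) (e.eval I s)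
  | seq p q, s => q.exec I (p.exec I s)
  | branch b p q, s => if b.Holds I s then p.exec I s else q.exec I s
  | loop a p, s => iterate (s.putNat (a, 0, 0, 0) 0)
      (fun i s' => (p.exec I s').putNat (a, 0, 0, 0) (i + 1)) (I.size + 1)

/-- The names of the arrays that a program may change. -/
def writes : Blk → List ℕ
  | skip => []
  | setNat a _ _ _ _ => [a]
  | setReal a _ _ _ _ => [a]
  | seq p q => p.writes ++ q.writes
  | branch _ p q => p.writes ++ q.writes
  | loop a p => a :: p.writes

/-- Loops do not change their counters. -/
def WellFormed : Blk → Prop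
  | skip => True
  | setNat _ _ _ _ _ => True
  | setReal _ _ _ _ _ => True
  | seq p q => p.WellFormed ∧ q.WellFormed
  | branch _ p q => p.WellFormed ∧ q.WellFormed
  | loop a p => a ∉ p.writes ∧ p.WellFormed

open Polynomial in
/-- A bound for the number of steps, as a polynomial in the size of the input. -/
noncomputable def bound : Blk → Polynomial ℕ
  | skip => C 1
  | setNat _ i j l e => C (i.steps + j.steps + l.steps + e.steps + 1)
  | setReal _ i j l e => C (i.steps + j.steps + l.steps + e.steps + 1)
  | seq p q => p.bound + q.bound
  | branch b p q => C (b.steps + 1) + p.bound + q.bound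
  | loop _ p => C 20 + (X + 1) * (p.bound + C 20)

end Blk

/-- The memories agree on all arrays whose names are not in `L`. -/
def Store.EqOff (L : List ℕ) (s s' : Store) : Prop :=
  ∀ b, b ∉ L → ∀ i j l, s.nat (b, i, j, l) = s'.nat (b, i, j, l) ∧
    s.real (b, i, j, l) = s'.real (b, i, j, l)

theorem Store.EqOff.refl (L : List ℕ) (s : Store) : s.EqOff L s := fun _ _ _ _ _ => ⟨rfl, rfl⟩

theorem Store.EqOff.trans {L L' : List ℕ} {s₁ s₂ s₃ : Store} (h : s₁.EqOff L s₂)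
    (h' : s₂.EqOff L' s₃) (hL : L ⊆ L') : s₁.EqOff L' s₃ := fun b hb i j l => by
  have h1 := h b (fun hb' => hb (hL hb')) i j l
  have h2 := h' b hb i j l
  exact ⟨h1.1.trans h2.1, h1.2.trans h2.2⟩

theorem Store.EqOff.mono {L L' : List ℕ} {s₁ s₂ : Store} (h : s₁.EqOff L s₂) (hL : L ⊆ L') :
    s₁.EqOff L' s₂ := fun b hb => h b fun hb' => hb (hL hb')

namespace Blk

variable {I : Input}

/-- The frame property that lets each phase of the algorithm be verified separately: arrays that a
program does not name in an assignment or as a counter keep their contents. -/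
theorem exec_eqOff (p : Blk) (s : Store) : (p.exec I s).EqOff p.writes s := by
  induction p generalizing s with
  | skip => exact Store.EqOff.refl _ _
  | setNat a i j l e =>
    intro b hb i' j' l'
    simp only [writes, List.mem_singleton] at hb
    simp [exec, hb]
  | setReal a i j l e =>
    intro b hb i' j' l'
    simp only [writes, List.mem_singleton] at hb
    simp [exec, hb]
  | seq p q hp hq =>
    refine Store.EqOff.trans ((hq _).mono ?_) ((hp s).mono ?_) (List.Subset.refl _)
    · exact List.subset_append_right _ _
    · exact List.subset_append_left _ _
  | branch b p q hp hq =>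
    simp only [exec]
    split_ifs
    · exact (hp s).mono (List.subset_append_left _ _)
    · exact (hq s).mono (List.subset_append_right _ _)
  | loop a p hp =>
    simp only [exec]
    induction I.size + 1 with
    | zero =>
      intro b hb i' j' l'
      simp only [writes, List.mem_cons, not_or] at hb
      simp [iterate, hb.1]
    | succ m ih =>
      intro b hb i' j' l'
      have hb' := hb
      simp only [writes, List.mem_cons, not_or] at hb'
      have h1 := hp (iterate (s.putNat (a, 0, 0, 0) 0)
      (fun i s' => (p.exec I s').putNat (a, 0, 0, 0) (i + 1)) m) b hb'.2 i' j' l'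
      have h2 := ih b hb i' j' l'
      simp only [iterate, Store.putNat_nat, Store.putNat_real, Prod.mk.injEq, hb'.1, false_and, if_false]
      exact ⟨h1.1.trans h2.1, h1.2.trans h2.2⟩

/-- The machine overwrites the counter between rounds, so the invariant must tolerate this. The body
may assume the value of the counter and that foreign arrays are as before the loop. -/
theorem exec_loop_invariant {a : ℕ} {p : Blk} (Inv : ℕ → Store → Prop)
    {s : Store} (h0 : Inv 0 s) (hput : ∀ i s' v, Inv i s' → Inv i (s'.putNat (a, 0, 0, 0) v))
    (hstep : ∀ i s', i ≤ I.size → s'.nat (a, 0, 0, 0) = i → s'.EqOff (a :: p.writes) s →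
      Inv i s' → Inv (i + 1) (p.exec I s')) : Inv (I.size + 1) ((loop a p).exec I s) := by
  simp only [exec]
  suffices h : ∀ m, m ≤ I.size + 1 → ∀ s', s' = (iterate (s.putNat (a, 0, 0, 0) 0)
      (fun i s' => (p.exec I s').putNat (a, 0, 0, 0) (i + 1)) m : Store) →
      s'.nat (a, 0, 0, 0) = m ∧ s'.EqOff (a :: p.writes) s ∧ Inv m s' from
    (h _ le_rfl _ rfl).2.2
  intro m
  induction m with
  | zero =>
    rintro - s' rfl
    refine ⟨by simp [iterate], ?_, hput _ _ _ h0⟩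
    intro b hb i j l
    simp only [List.mem_cons, not_or] at hb
    simp [iterate, hb.1]
  | succ m ih =>
    rintro hm s' rfl
    obtain ⟨h1, h2, h3⟩ := ih (by omega) _ rfl
    refine ⟨by simp [iterate], ?_, hput _ _ _ (hstep m _ (by omega) h1 h2 h3)⟩
    refine Store.EqOff.trans (L := a :: p.writes) ?_ h2 (List.Subset.refl _)
    intro b hb i j l
    have hb' := hb
    simp only [List.mem_cons, not_or] at hb'
    have := exec_eqOff (I := I) p (iterate (s.putNat (a, 0, 0, 0) 0)
      (fun i s' => (p.exec I s').putNat (a, 0, 0, 0) (i + 1)) m) b hb'.2 i j l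
    simpa [iterate, hb'.1] using this

/-- A body that does not write its counter is executed exactly n + 1 times, so nested loops multiply
to a polynomial. -/
theorem runs_exec {p : Blk} (hwf : p.WellFormed) (s : Store) :
    ∃ t, Runs I p.compile s (p.exec I s) t ∧ t ≤ p.bound.eval I.size := by
  induction p generalizing s with
  | skip => exact ⟨1, .skip s, by simp [bound]⟩
  | setNat a i j l e => exact ⟨_, .setNat s a i j l e, by simp [bound]⟩
  | setReal a i j l e => exact ⟨_, .setReal s a i j l e, by simp [bound]⟩
  | seq p q hp hq =>
    obtain ⟨t, h1, h2⟩ := hp hwf.1 s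
    obtain ⟨t', h1', h2'⟩ := hq hwf.2 (p.exec I s)
    exact ⟨_, .seq h1 h1', by simp only [bound, Polynomial.eval_add]; omega⟩
  | branch b p q hp hq =>
    obtain ⟨t, h1, h2⟩ := hp hwf.1 s
    obtain ⟨t', h1', h2'⟩ := hq hwf.2 s
    simp only [exec, bound, Polynomial.eval_add, Polynomial.eval_C]
    split_ifs with hb
    · exact ⟨_, .branch_pos hb h1, by omega⟩
    · exact ⟨_, .branch_neg hb h1', by omega⟩
  | loop a p hp =>
    let st : ℕ → Store := fun m => iterate (s.putNat (a, 0, 0, 0) 0)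
      (fun i s' => (p.exec I s').putNat (a, 0, 0, 0) (i + 1)) m
    have hst : ∀ m, (st m).nat (a, 0, 0, 0) = m := by
      intro m
      cases m <;> simp [st, iterate]
    -- Here r counts the rounds still to come. Test and increment add 19 steps to a round and the
    -- final failing test takes 9, so 20 and 10 suffice.
    have key : ∀ r m, m + r = I.size + 1 → ∃ t, Runs I
        (.loop (.natLt (.var a) (.add .size (.lit 1)))
          (.seq p.compile (.setNat a (.lit 0) (.lit 0) (.lit 0) (.add (.var a) (.lit 1)))))
        (st m) (st (I.size + 1)) t ∧ t ≤ r * (p.bound.eval I.size + 20) + 10 := by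
      intro r
      induction r with
      | zero =>
        intro m hm
        obtain rfl : m = I.size + 1 := hm
        refine ⟨_, .loop_halt ?_, ?_⟩
        · have := hst (I.size + 1)
          simp [BExp.Holds, NExp.eval, NExp.var, this]
        · simp [BExp.steps, NExp.steps, NExp.var]
      | succ r ih =>
        intro m hm
        obtain ⟨t, h1, h2⟩ := hp hwf.2 (st m)
        obtain ⟨t', h1', h2'⟩ := ih (m + 1) (by omega)
        have hval : (p.exec I (st m)).nat (a, 0, 0, 0) = m := by
          rw [(exec_eqOff p (st m) a hwf.1 0 0 0).1, hst]
        have h3 := Runs.setNat (I := I) (p.exec I (st m)) a (.lit 0) (.lit 0) (.lit 0)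
          (.add (.var a) (.lit 1))
        have h4 : (NExp.add (.var a) (.lit 1)).eval I (p.exec I (st m)) = m + 1 := by
          simp [NExp.eval, NExp.var, hval]
        rw [h4] at h3
        refine ⟨_, .loop_next ?_ (.seq h1 h3) h1', ?_⟩
        · have := hst m
          simp only [BExp.Holds, NExp.eval, NExp.var, this]
          omega
        · simp only [BExp.steps, NExp.steps, NExp.var]
          rw [add_mul]
          omega
    obtain ⟨t, h1, h2⟩ := key (I.size + 1) 0 (by omega)
    refine ⟨_, .seq (.setNat s a _ _ _ _) h1, ?_⟩
    simp only [NExp.steps, bound, Polynomial.eval_add, Polynomial.eval_mul, Polynomial.eval_C,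
      Polynomial.eval_X, Polynomial.eval_one]
    omega

/-! ### Loops that improve a memory monotonically -/

/-- From the memory `s`, the program keeps the invariant `J`, moves up in the preorder `Le`, and
reaches the goal `G`. -/
def Achieves (I : Input) (J : Store → Prop) (Le : Store → Store → Prop) (p : Blk) (s : Store)
    (G : Store → Prop) : Prop :=
  J s → J (p.exec I s) ∧ Le s (p.exec I s) ∧ G (p.exec I s)

/-- Goals that are stable under improvement accumulate: what round i achieves cannot be lost later.
This handles all searches for minima, including nested ones, as the conclusion has the shape
required of a loop body. -/
theorem achieves_loop {J : Store → Prop} {Le : Store → Store → Prop} {a : ℕ} {p : Blk} {s : Store}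
    {G : ℕ → Store → Prop} (hrefl : ∀ s, Le s s)
    (htrans : ∀ s₁ s₂ s₃, Le s₁ s₂ → Le s₂ s₃ → Le s₁ s₃)
    (hJ : ∀ s' v, J s' → J (s'.putNat (a, 0, 0, 0) v))
    (hLe : ∀ s' v, Le s' (s'.putNat (a, 0, 0, 0) v))
    (hG : ∀ i s₁ s₂, Le s₁ s₂ → G i s₁ → G i s₂)
    (hstep : ∀ i s', i ≤ I.size → s'.nat (a, 0, 0, 0) = i → s'.EqOff (a :: p.writes) s →
      Achieves I J Le p s' (G i)) :
    Achieves I J Le (loop a p) s fun s' => ∀ i, i ≤ I.size → G i s' := by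
  intro hJs
  have := exec_loop_invariant (I := I)
    (fun i s' => J s' ∧ Le s s' ∧ ∀ i', i' < i → G i' s') (s := s)
    ⟨hJs, hrefl s, fun i' h => absurd h (Nat.not_lt_zero _)⟩
    (fun i s' v h => ⟨hJ _ _ h.1, htrans _ _ _ h.2.1 (hLe _ _), fun i' hi' =>
      hG _ _ _ (hLe _ _) (h.2.2 i' hi')⟩)
    (fun i s' hi hval hoff h => by
      obtain ⟨h1, h2, h3⟩ := hstep i s' hi hval hoff h.1
      refine ⟨h1, htrans _ _ _ h.2.1 h2, fun i' hi' => ?_⟩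
      rcases Nat.lt_succ_iff_lt_or_eq.1 hi' with h4 | rfl
      · exact hG _ _ _ h2 (h.2.2 i' h4)
      · exact h3)
  exact ⟨this.1, this.2.1, fun i hi => this.2.2 i (by omega)⟩

end Blk

attribute [simp] NExp.eval RExp.eval BExp.Holds NExp.var NExp.at RExp.var

/-- Equality test. -/
def BExp.eq (x y : NExp) : BExp := .conj (.neg (.natLt x y)) (.neg (.natLt y x))

@[simp] theorem BExp.holds_eq (I : Input) (s : Store) (x y : NExp) :
    (BExp.eq x y).Holds I s ↔ x.eval I s = y.eval I s := by
  simp only [BExp.eq, BExp.Holds, not_lt]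
  exact ⟨fun h => le_antisymm h.2 h.1, fun h => ⟨h.ge, h.le⟩⟩

/-- Test for being positive. -/
def BExp.pos (x : NExp) : BExp := .natLt (.lit 0) x

@[simp] theorem BExp.holds_pos (I : Input) (s : Store) (x : NExp) :
    (BExp.pos x).Holds I s ↔ 0 < x.eval I s := Iff.rfl

theorem Store.EqOff.nat {L : List ℕ} {s s' : Store} (h : s.EqOff L s') (b : ℕ) (i j l : ℕ)
    (hb : b ∉ L := by decide) : s.nat (b, i, j, l) = s'.nat (b, i, j, l) := (h b hb i j l).1

theorem Store.EqOff.real {L : List ℕ} {s s' : Store} (h : s.EqOff L s') (b : ℕ) (i j l : ℕ)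
    (hb : b ∉ L := by decide) : s.real (b, i, j, l) = s'.real (b, i, j, l) := (h b hb i j l).2

namespace Blk

section Exec

variable (I : Input) (s : Store)

@[simp] theorem exec_skip : exec I skip s = s := rfl

@[simp] theorem exec_setNat (a : ℕ) (i j l e : NExp) : (setNat a i j l e).exec I s =
    s.putNat (a, i.eval I s, j.eval I s, l.eval I s) (e.eval I s) := rfl

@[simp] theorem exec_setReal (a : ℕ) (i j l : NExp) (e : RExp) : (setReal a i j l e).exec I s =
    s.putReal (a, i.eval I s, j.eval I s, l.eval I s) (e.eval I s) := rfl

@[simp] theorem exec_letNat (a : ℕ) (e : NExp) :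
    (letNat a e).exec I s = s.putNat (a, 0, 0, 0) (e.eval I s) := rfl

@[simp] theorem exec_letReal (a : ℕ) (e : RExp) :
    (letReal a e).exec I s = s.putReal (a, 0, 0, 0) (e.eval I s) := rfl

@[simp] theorem exec_seq (p q : Blk) : (seq p q).exec I s = q.exec I (p.exec I s) := rfl

open Classical in
theorem exec_branch (b : BExp) (p q : Blk) :
    (branch b p q).exec I s = if b.Holds I s then p.exec I s else q.exec I s := rfl

end Exec

variable {I : Input}

/-! ## The program

Natural arrays: `0` output, `1` the point at a position, `2` parent, `3` mark of the points that
have a position, `4` subtree relation, `5` head of the list of children, `6` to `9` the table of the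
dynamic program (feasibility, label, centers below, centers in later siblings), `10` remaining
number of centers, `11` label, `12` number of the cluster of a center. Natural variables: `13`
number of centers so far, `14` to `16` the search of Prim's algorithm (found, position, point), `17`
current position, `18` number of centers, `20` to `24` counters. Real arrays: `40` value of the null
entries of the table, `41` smallest distance, `42` values of the table, `43` current cost. -/

/-- Lowers the real variable `40` to the value of `e`. -/
def lowerTo (e : RExp) : Blk := .branch (.realLt e (.var 40)) (letReal 40 e) .skip

/-- Computes the cost of the empty labeling: zero for sums, a lower bound of all costs for
maxima. -/
def nullCost : Blk :=
  .seq
    (.loop 20 (.loop 21 (.seq (lowerTo (.connCost (.var 20) (.var 21)))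
      (lowerTo (.centerCost (.var 20))))))
    (.branch (.natLt .kind (.lit 1)) (letReal 40 .zero) .skip)

theorem exec_lowerTo_le (e : RExp) (s : Store) :
    ((lowerTo e).exec I s).real (40, 0, 0, 0) ≤ e.eval I s ∧
    ((lowerTo e).exec I s).real (40, 0, 0, 0) ≤ s.real (40, 0, 0, 0) := by
  unfold lowerTo
  rw [exec_branch]
  split_ifs with h
  · simp only [BExp.Holds, RExp.var, RExp.eval, NExp.eval] at h
    simpa using h.le
  · simp only [BExp.Holds, RExp.var, RExp.eval, NExp.eval, not_lt] at h
    simpa using h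

/-- The variable is only ever lowered, so it ends below every value that was queried. Queries
outside the range are harmless, since any lower bound will do for maxima. -/
theorem exec_nullCost (s : Store) :
    (I.kind = .total → (nullCost.exec I s).real (40, 0, 0, 0) = 0) ∧
    (I.kind = .bottleneck → ∀ u c, u ≤ I.size → c ≤ I.size →
      (nullCost.exec I s).real (40, 0, 0, 0) ≤ I.connCost u c ∧
      (nullCost.exec I s).real (40, 0, 0, 0) ≤ I.centerCost u) := by
  have key := achieves_loop (I := I) (J := fun _ => True)
    (Le := fun s₁ s₂ => s₂.real (40, 0, 0, 0) ≤ s₁.real (40, 0, 0, 0)) (a := 20) (s := s)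
    (p := .loop 21 (.seq (lowerTo (.connCost (.var 20) (.var 21)))
      (lowerTo (.centerCost (.var 20)))))
    (G := fun u s' => ∀ c, c ≤ I.size → s'.real (40, 0, 0, 0) ≤ I.connCost u c ∧
      s'.real (40, 0, 0, 0) ≤ I.centerCost u)
    (fun _ => le_rfl) (fun _ _ _ h h' => h'.trans h) (fun _ _ _ => trivial) (fun _ _ => le_rfl)
    (fun u s₁ s₂ h h' c hc => ⟨h.trans (h' c hc).1, h.trans (h' c hc).2⟩)
    (fun u s₁ _ hu _ => achieves_loop (fun _ => le_rfl) (fun _ _ _ h h' => h'.trans h)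
      (fun _ _ _ => trivial) (fun _ _ => le_rfl)
      (fun c s₁ s₂ h h' => ⟨h.trans h'.1, h.trans h'.2⟩)
      (fun c s₂ _ hc h2 _ => by
        have hu2 : s₂.nat (20, 0, 0, 0) = u := by rw [h2.nat 20 0 0 0, hu]
        have h3 := exec_lowerTo_le (I := I) (.connCost (.var 20) (.var 21)) s₂
        have h4 := exec_lowerTo_le (I := I) (.centerCost (.var 20))
          ((lowerTo (.connCost (.var 20) (.var 21))).exec I s₂)
        have hu3 := (exec_eqOff (I := I) (lowerTo (.connCost (.var 20) (.var 21))) s₂).nat 20 0 0 0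
        exact ⟨trivial, h4.2.trans h3.2, (h4.2.trans h3.1).trans_eq (congrArg₂ I.connCost hu2 hc),
          h4.1.trans_eq (congrArg I.centerCost (hu3.trans hu2))⟩))
  have hkey := (key trivial).2.2
  unfold nullCost
  rw [exec_seq, exec_branch]
  constructor
  · intro hk
    rw [if_pos (by simp [hk])]
    simp
  · intro hk u c hu hc
    rw [if_neg (by simp [hk])]
    exact hkey u hu c hc

/-! ### Prim's algorithm -/

/-- One comparison in the search for a shortest edge that leaves the tree. -/
def scanStep : Blk :=
  .branch (.conj (.pos (.var 21)) (.conj (.natLt (.var 21) (.var 20))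
      (.conj (.natLt (.var 22) .size) (.conj (.natLt (.at 3 (.var 22)) (.lit 1))
        (.neg (.conj (.pos (.var 14))
          (.neg (.realLt (.dist (.at 1 (.var 21)) (.var 22)) (.var 41)))))))))
    (.seq (letNat 14 (.lit 1)) (.seq (letReal 41 (.dist (.at 1 (.var 21)) (.var 22)))
      (.seq (letNat 15 (.var 21)) (letNat 16 (.var 22)))))
    .skip

/-- Search for a shortest edge that leaves the tree. -/
def scan : Blk := .seq (letNat 14 (.lit 0)) (.loop 21 (.loop 22 scanStep))

/-- Adds a point to the tree. -/
def primStep : Blk :=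
  .branch (.pos (.var 20))
    (.seq scan (.seq (.setNat 1 (.var 20) (.lit 0) (.lit 0) (.var 16))
      (.seq (.setNat 2 (.var 20) (.lit 0) (.lit 0) (.var 15))
        (.setNat 3 (.var 16) (.lit 0) (.lit 0) (.lit 1)))))
    .skip

/-- Prim's algorithm. -/
def prim : Blk := .loop 20 primStep

/-- The state of the search. -/
structure ScanInv (I : Input) (s₀ : Store) (t : ℕ) (s : Store) : Prop where
  found : s.nat (14, 0, 0, 0) ≠ 0 → 1 ≤ s.nat (15, 0, 0, 0) ∧ s.nat (15, 0, 0, 0) < t ∧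
    s.nat (16, 0, 0, 0) < I.size ∧ s₀.nat (3, s.nat (16, 0, 0, 0), 0, 0) = 0 ∧
    s.real (41, 0, 0, 0) = I.dist (s₀.nat (1, s.nat (15, 0, 0, 0), 0, 0)) (s.nat (16, 0, 0, 0))
  notFound : s.nat (14, 0, 0, 0) = 0 → s.nat (15, 0, 0, 0) = s₀.nat (15, 0, 0, 0) ∧
    s.nat (16, 0, 0, 0) = s₀.nat (16, 0, 0, 0)

/-- Improvement means that a found edge stays found and that its length does not increase. A
comparison makes the current edge count as covered, whether it is stored or rejected. -/
theorem exec_scan {s : Store} {t : ℕ} (ht : s.nat (20, 0, 0, 0) = t) (htn : t ≤ I.size) :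
    ScanInv I s t (scan.exec I s) ∧ ∀ a, 1 ≤ a → a < t → ∀ v, v < I.size →
      s.nat (3, v, 0, 0) = 0 → (scan.exec I s).nat (14, 0, 0, 0) ≠ 0 ∧
        (scan.exec I s).real (41, 0, 0, 0) ≤ I.dist (s.nat (1, a, 0, 0)) v := by
  set Le : Store → Store → Prop := fun s₁ s₂ => s₁.nat (14, 0, 0, 0) ≠ 0 →
    s₂.nat (14, 0, 0, 0) ≠ 0 ∧ s₂.real (41, 0, 0, 0) ≤ s₁.real (41, 0, 0, 0) with hLe
  have hrefl : ∀ s, Le s s := fun s h => ⟨h, le_rfl⟩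
  have htrans : ∀ s₁ s₂ s₃, Le s₁ s₂ → Le s₂ s₃ → Le s₁ s₃ := fun s₁ s₂ s₃ h h' h0 =>
    ⟨(h' (h h0).1).1, (h' (h h0).1).2.trans (h h0).2⟩
  have hG : ∀ (P : Prop) (b : ℝ) (s₁ s₂ : Store), Le s₁ s₂ →
      (P → s₁.nat (14, 0, 0, 0) ≠ 0 ∧ s₁.real (41, 0, 0, 0) ≤ b) →
      (P → s₂.nat (14, 0, 0, 0) ≠ 0 ∧ s₂.real (41, 0, 0, 0) ≤ b) := fun P b s₁ s₂ h h' hP =>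
    ⟨(h (h' hP).1).1, ((h (h' hP).1).2).trans (h' hP).2⟩
  have key := achieves_loop (I := I) (J := ScanInv I s t) (Le := Le) (a := 21)
    (s := (letNat 14 (.lit 0)).exec I s) (p := .loop 22 scanStep)
    (G := fun a s' => ∀ v, v ≤ I.size → (1 ≤ a ∧ a < t ∧ v < I.size ∧ s.nat (3, v, 0, 0) = 0) →
      s'.nat (14, 0, 0, 0) ≠ 0 ∧ s'.real (41, 0, 0, 0) ≤ I.dist (s.nat (1, a, 0, 0)) v)
    hrefl htrans (fun s' v h => ⟨by simpa using h.found, by simpa using h.notFound⟩)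
    (fun s' v h => by simpa using h)
    (fun a s₁ s₂ h h' v hv => hG _ _ _ _ h (h' v hv))
    (fun a s₁ _ ha h1 => achieves_loop hrefl htrans
      (fun s' v h => ⟨by simpa using h.found, by simpa using h.notFound⟩)
      (fun s' v h => by simpa using h)
      (fun v s₁ s₂ h h' => hG _ _ _ _ h h')
      (fun v s₂ _ hv h2 hJ => by
        have e20 : s₂.nat (20, 0, 0, 0) = t := by
          rw [h2.nat 20 0 0 0, h1.nat 20 0 0 0]; simpa using ht
        have e21 : s₂.nat (21, 0, 0, 0) = a := by rw [h2.nat 21 0 0 0, ha]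
        have e3 : ∀ v, s₂.nat (3, v, 0, 0) = s.nat (3, v, 0, 0) := fun v => by
          rw [h2.nat 3, h1.nat 3]; simp
        have e1 : ∀ v, s₂.nat (1, v, 0, 0) = s.nat (1, v, 0, 0) := fun v => by
          rw [h2.nat 1, h1.nat 1]; simp
        unfold scanStep
        rw [exec_branch]
        split_ifs with h
        · simp only [BExp.Holds, BExp.holds_pos, NExp.eval, RExp.eval, NExp.var, NExp.at,
            RExp.var, e20, e21, hv, e3, e1] at h
          obtain ⟨h3, h4, h5, h6, h7⟩ := h
          refine ⟨⟨?_, ?_⟩, ?_, ?_⟩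
          · simp [e21, hv, e1]
            exact ⟨h3, h4, h5, by omega⟩
          · simp
          · intro hf
            simp [e21, hv, e1]
            by_contra hcon
            exact h7 ⟨Nat.pos_of_ne_zero hf, fun hlt => hcon hlt.le⟩
          · simp [e21, hv, e1]
        · refine ⟨hJ, hrefl _, fun hP => ?_⟩
          simp only [BExp.Holds, BExp.holds_pos, NExp.eval, RExp.eval, NExp.var, NExp.at,
            RExp.var, e20, e21, hv, e3, e1] at h
          obtain ⟨h3, h4, h5, h6⟩ := hP
          by_contra hcon
          refine h ⟨h3, h4, h5, by omega, fun hf => hcon ⟨hf.1.ne', not_lt.1 hf.2⟩⟩))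
  obtain ⟨h1, -, h3⟩ := key ⟨by simp, by simp⟩
  unfold scan
  exact ⟨h1, fun a ha hat v hv hu => h3 a (by omega) v hv.le ⟨ha, hat, hv, hu⟩⟩

/-- The state of Prim's algorithm before position `t` is filled. -/
structure PrimInv (I : Input) (t : ℕ) (s : Store) : Prop where
  lt : ∀ r, 1 ≤ r → r < t → s.nat (1, r, 0, 0) < I.size
  used : ∀ v, s.nat (3, v, 0, 0) ≠ 0 ↔ ∃ r, 1 ≤ r ∧ r < t ∧ s.nat (1, r, 0, 0) = v
  inj : ∀ r r', 1 ≤ r → r < r' → r' < t → s.nat (1, r, 0, 0) ≠ s.nat (1, r', 0, 0)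
  par : ∀ r, 2 ≤ r → r < t → 1 ≤ s.nat (2, r, 0, 0) ∧ s.nat (2, r, 0, 0) < r
  greedy : ∀ r a v, 2 ≤ r → r < t → 1 ≤ a → a < r → v < I.size →
    (∀ r', 1 ≤ r' → r' < r → s.nat (1, r', 0, 0) ≠ v) →
    I.dist (s.nat (1, s.nat (2, r, 0, 0), 0, 0)) (s.nat (1, r, 0, 0)) ≤
      I.dist (s.nat (1, a, 0, 0)) v
  par_zero : s.nat (2, 0, 0, 0) = 0
  par_one : s.nat (2, 1, 0, 0) = 0
  start : t ≤ 1 → s.nat (15, 0, 0, 0) = 0 ∧ s.nat (16, 0, 0, 0) = 0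

end Blk

namespace Blk

variable {I : Input}

theorem PrimInv.exists_unused {t : ℕ} {s : Store} (h : PrimInv I t s) (htn : t ≤ I.size)
    (ht : 1 ≤ t) : ∃ v, v < I.size ∧ s.nat (3, v, 0, 0) = 0 := by
  by_contra hcon
  push Not at hcon
  have hsub : Finset.range I.size ⊆ (Finset.Ico 1 t).image fun r => s.nat (1, r, 0, 0) := by
    intro v hv
    obtain ⟨r, h1, h2, h3⟩ := (h.used v).1 (hcon v (Finset.mem_range.1 hv))
    exact Finset.mem_image.2 ⟨r, Finset.mem_Ico.2 ⟨h1, h2⟩, h3⟩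
  have := (Finset.card_le_card hsub).trans Finset.card_image_le
  rw [Finset.card_range, Nat.card_Ico] at this
  omega

theorem PrimInv.step {t bs bv : ℕ} {s s' : Store} (h : PrimInv I t s) (ht : 1 ≤ t)
    (h1 : ∀ r, s'.nat (1, r, 0, 0) = if r = t then bv else s.nat (1, r, 0, 0))
    (h2 : ∀ r, s'.nat (2, r, 0, 0) = if r = t then bs else s.nat (2, r, 0, 0))
    (h3 : ∀ v, s'.nat (3, v, 0, 0) = if v = bv then 1 else s.nat (3, v, 0, 0))
    (hbv : bv < I.size) (hu : s.nat (3, bv, 0, 0) = 0) (hone : t = 1 → bs = 0)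
    (hbs : 2 ≤ t → 1 ≤ bs ∧ bs < t)
    (hmin : 2 ≤ t → ∀ a v, 1 ≤ a → a < t → v < I.size → s.nat (3, v, 0, 0) = 0 →
      I.dist (s.nat (1, bs, 0, 0)) bv ≤ I.dist (s.nat (1, a, 0, 0)) v) :
    PrimInv I (t + 1) s' := by
  have h1' : ∀ r, r < t → s'.nat (1, r, 0, 0) = s.nat (1, r, 0, 0) := fun r hr => by
    rw [h1, if_neg hr.ne]
  have h2' : ∀ r, r < t → s'.nat (2, r, 0, 0) = s.nat (2, r, 0, 0) := fun r hr => by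
    rw [h2, if_neg hr.ne]
  have h1t : s'.nat (1, t, 0, 0) = bv := by rw [h1, if_pos rfl]
  have h2t : s'.nat (2, t, 0, 0) = bs := by rw [h2, if_pos rfl]
  have hnew : ∀ r, 1 ≤ r → r < t → s.nat (1, r, 0, 0) ≠ bv := fun r hr hrt hrv =>
    (h.used bv).2 ⟨r, hr, hrt, hrv⟩ hu
  constructor
  · intro r hr hrt
    rcases Nat.lt_succ_iff_lt_or_eq.1 hrt with hlt | rfl
    · rw [h1' r hlt]; exact h.lt r hr hlt
    · rw [h1t]; exact hbv
  · intro v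
    rw [h3]
    split_ifs with hv
    · simp only [ne_eq, one_ne_zero, not_false_eq_true, true_iff]
      exact ⟨t, ht, Nat.lt_succ_self t, by rw [h1t, hv]⟩
    · rw [h.used v]
      constructor
      · rintro ⟨r, hr, hrt, hrv⟩
        exact ⟨r, hr, by omega, by rw [h1' r hrt, hrv]⟩
      · rintro ⟨r, hr, hrt, hrv⟩
        rcases Nat.lt_succ_iff_lt_or_eq.1 hrt with hlt | rfl
        · exact ⟨r, hr, hlt, by rw [← h1' r hlt, hrv]⟩
        · rw [h1t] at hrv
          exact absurd hrv.symm hv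
  · intro r r' hr hrr' hrt
    rcases Nat.lt_succ_iff_lt_or_eq.1 hrt with hlt | rfl
    · rw [h1' r (by omega), h1' r' hlt]; exact h.inj r r' hr hrr' hlt
    · rw [h1' r hrr', h1t]; exact hnew r hr hrr'
  · intro r hr hrt
    rcases Nat.lt_succ_iff_lt_or_eq.1 hrt with hlt | rfl
    · rw [h2' r hlt]; exact h.par r hr hlt
    · rw [h2t]; exact hbs hr
  · intro r a v hr hrt ha har hv hun
    rcases Nat.lt_succ_iff_lt_or_eq.1 hrt with hlt | rfl
    · have := h.par r hr hlt
      rw [h2' r hlt, h1' _ (by omega), h1' r hlt, h1' a (by omega)]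
      refine h.greedy r a v hr hlt ha har hv fun r' hr' hrr' => ?_
      rw [← h1' r' (by omega)]
      exact hun r' hr' hrr'
    · rw [h2t, h1' bs (hbs hr).2, h1t, h1' a har]
      refine hmin hr a v ha har hv ?_
      by_contra hcon
      obtain ⟨r', hr', hrt', hrv⟩ := (h.used v).1 hcon
      exact hun r' hr' hrt' (by rw [h1' r' hrt', hrv])
  · rw [h2' 0 (by omega)]; exact h.par_zero
  · by_cases ht1 : t = 1
    · rw [h2, if_pos ht1.symm]; exact hone ht1
    · rw [h2' 1 (by omega)]; exact h.par_one
  · intro h'; omega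

theorem exec_primStep {s : Store} {t : ℕ} (ht : s.nat (20, 0, 0, 0) = t) (htn : t ≤ I.size)
    (h : PrimInv I t s) : PrimInv I (t + 1) (primStep.exec I s) := by
  unfold primStep
  rw [exec_branch]
  simp only [BExp.holds_pos, NExp.var, NExp.eval, ht]
  split_ifs with ht0
  · obtain ⟨hJ, hG⟩ := exec_scan ht htn
    have hoff := exec_eqOff (I := I) scan s
    simp only [exec_seq]
    set s₁ := scan.exec I s with hs₁
    have e20 : s₁.nat (20, 0, 0, 0) = t := by rw [hoff.nat 20 0 0 0, ht]
    have hfound : 2 ≤ t → s₁.nat (14, 0, 0, 0) ≠ 0 := by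
      intro ht2
      obtain ⟨v, hv, hv'⟩ := h.exists_unused htn ht0
      exact (hG 1 le_rfl (by omega) v hv hv').1
    -- At position 1 there is no tree yet and the search finds nothing. The result variables still
    -- have their initial value 0, which makes point 0 the root, with parent 0.
    have hstart : t = 1 → s₁.nat (15, 0, 0, 0) = 0 ∧ s₁.nat (16, 0, 0, 0) = 0 := by
      intro ht1
      have h0 : s₁.nat (14, 0, 0, 0) = 0 := by
        by_contra hf
        have := hJ.found hf
        omega
      rw [(hJ.notFound h0).1, (hJ.notFound h0).2]
      exact h.start ht1.le
    have hcase : t = 1 ∨ 2 ≤ t := by omega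
    refine h.step (bs := s₁.nat (15, 0, 0, 0)) (bv := s₁.nat (16, 0, 0, 0)) ht0 ?_ ?_ ?_ ?_ ?_
      (fun h1 => (hstart h1).1)
      (fun h2 => ⟨(hJ.found (hfound h2)).1, (hJ.found (hfound h2)).2.1⟩) ?_
    · intro r; simp [e20, hoff.nat 1]
    · intro r; simp [e20, hoff.nat 2]
    · intro r; simp [hoff.nat 3]
    · rcases hcase with h1 | h2
      · rw [(hstart h1).2]; omega
      · exact (hJ.found (hfound h2)).2.2.1
    · rcases hcase with h1 | h2
      · by_contra hcon
        obtain ⟨r, hr, hrt, -⟩ := (h.used _).1 hcon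
        omega
      · exact (hJ.found (hfound h2)).2.2.2.1
    · intro h2 a v ha hat hv hu
      rw [← (hJ.found (hfound h2)).2.2.2.2]
      exact (hG a ha hat v hv hu).2
  · obtain rfl : t = 0 := by omega
    simp only [exec_skip]
    refine ⟨fun r _ _ => by omega, fun v => ?_, fun r r' _ _ _ => by omega, fun r _ _ => by omega,
      fun r a v _ _ => by omega, h.par_zero, h.par_one, fun _ => h.start (by omega)⟩
    rw [h.used]
    constructor
    · rintro ⟨r, h1, h2, -⟩; omega
    · rintro ⟨r, h1, h2, -⟩; omega

theorem exec_prim {s : Store} (h2 : ∀ r, s.nat (2, r, 0, 0) = 0) (h3 : ∀ v, s.nat (3, v, 0, 0) = 0)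
    (h15 : s.nat (15, 0, 0, 0) = 0) (h16 : s.nat (16, 0, 0, 0) = 0) :
    PrimInv I (I.size + 1) (prim.exec I s) := by
  refine exec_loop_invariant (fun t s' => PrimInv I t s') ?_ ?_ ?_
  · refine ⟨fun r _ _ => by omega, fun v => ?_, fun r r' _ _ _ => by omega, fun r _ _ => by omega,
      fun r a v _ _ => by omega, h2 0, h2 1, fun _ => ⟨h15, h16⟩⟩
    simp only [h3, ne_eq, not_true_eq_false, false_iff]
    rintro ⟨r, h1, h2, -⟩
    omega
  · intro t s' v h
    exact ⟨by simpa using h.lt, by simpa using h.used, by simpa using h.inj, by simpa using h.par,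
      by simpa using h.greedy, by simpa using h.par_zero, by simpa using h.par_one,
      by simpa using h.start⟩
  · intro t s' htn ht _ h
    exact exec_primStep ht htn h

/-! ### The subtree relation -/

/-- Computes the subtree relation. -/
def subtrees : Blk :=
  .loop 20 (.seq
    (.loop 21 (.setNat 4 (.var 21) (.var 20) (.lit 0) (.get 4 (.var 21) (.at 2 (.var 20)) (.lit 0))))
    (.setNat 4 (.var 20) (.var 20) (.lit 0) (.lit 1)))

/-- The ancestors of x are those of its parent together with x. Parents precede children, so the
column of the parent is complete when it is copied. Column 0 copies itself and stays zero in all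
rows t ≥ 1. -/
theorem exec_subtrees {s : Store} (h4 : ∀ t x, s.nat (4, t, x, 0) = 0)
    (h2 : ∀ x, 1 ≤ x → x ≤ I.size → s.nat (2, x, 0, 0) < x) (h20 : s.nat (2, 0, 0, 0) = 0) :
    (∀ t, 1 ≤ t → t ≤ I.size → (subtrees.exec I s).nat (4, t, 0, 0) = 0) ∧
    (∀ t, 1 ≤ t → t ≤ I.size → (subtrees.exec I s).nat (4, t, t, 0) = 1) ∧
    ∀ t x, 1 ≤ x → x ≤ I.size → t ≤ I.size → t ≠ x → (subtrees.exec I s).nat (4, t, x, 0) =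
      (subtrees.exec I s).nat (4, t, s.nat (2, x, 0, 0), 0) := by
  have key := exec_loop_invariant (I := I) (a := 20) (s := s) (p := .seq
    (.loop 21 (.setNat 4 (.var 21) (.var 20) (.lit 0) (.get 4 (.var 21) (.at 2 (.var 20)) (.lit 0))))
    (.setNat 4 (.var 20) (.var 20) (.lit 0) (.lit 1)))
    (fun i s' => (∀ t, 1 ≤ t → t ≤ I.size → s'.nat (4, t, 0, 0) = 0) ∧
      (∀ t, 1 ≤ t → t < i → s'.nat (4, t, t, 0) = 1) ∧
      ∀ t x, 1 ≤ x → x < i → t ≤ I.size → t ≠ x → s'.nat (4, t, x, 0) =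
        s'.nat (4, t, s.nat (2, x, 0, 0), 0))
    ⟨fun t _ _ => h4 t 0, fun t h h' => by omega, fun t x h h' => by omega⟩
    (fun i s' v h => by simpa using h) ?_
  · exact ⟨key.1, fun t h h' => key.2.1 t h (by omega), fun t x h h' => key.2.2 t x h (by omega)⟩
  · rintro x s₁ hx hx' hoff ⟨k1, k2, k3⟩
    have e2 : ∀ r, s₁.nat (2, r, 0, 0) = s.nat (2, r, 0, 0) := fun r => hoff.nat 2 r 0 0
    have hpar : s.nat (2, x, 0, 0) ≤ x := by
      rcases Nat.eq_zero_or_pos x with rfl | h0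
      · exact h20.le
      · exact (h2 x h0 hx).le
    have inner := exec_loop_invariant (I := I) (a := 21) (s := s₁)
      (p := .setNat 4 (.var 21) (.var 20) (.lit 0) (.get 4 (.var 21) (.at 2 (.var 20)) (.lit 0)))
      (fun i s' => ∀ t y, s'.nat (4, t, y, 0) =
        if t < i ∧ y = x then s₁.nat (4, t, s.nat (2, x, 0, 0), 0) else s₁.nat (4, t, y, 0))
      (by intro t y; rw [if_neg (by omega)]) (fun i s' v h => by simpa using h)
      (by
        intro i s₂ hi hi' hoff₂ h t y
        have e20 : s₂.nat (20, 0, 0, 0) = x := by rw [hoff₂.nat 20 0 0 0, hx']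
        have e2' : s₂.nat (2, x, 0, 0) = s.nat (2, x, 0, 0) := by rw [hoff₂.nat 2 x 0 0, e2]
        simp only [exec_setNat, Store.putNat_nat, NExp.eval, NExp.var, NExp.at, hi', e20, e2', h,
          Prod.mk.injEq, true_and, and_true]
        rcases lt_trichotomy t i with h5 | rfl | h5
        · rw [if_neg (by omega)]
          by_cases hy : y = x
          · rw [if_pos ⟨h5, hy⟩, if_pos ⟨by omega, hy⟩]
          · rw [if_neg (fun h' => hy h'.2), if_neg (fun h' => hy h'.2)]
        · by_cases hy : y = x
          · rw [if_pos ⟨rfl, hy⟩, if_neg (by omega), if_pos ⟨by omega, hy⟩]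
          · rw [if_neg (fun h' => hy h'.2), if_neg (by omega), if_neg (fun h' => hy h'.2)]
        · rw [if_neg (by omega), if_neg (by omega), if_neg (by omega)])
    have hoff' := exec_eqOff (I := I) (.loop 21 (.setNat 4 (.var 21) (.var 20) (.lit 0)
      (.get 4 (.var 21) (.at 2 (.var 20)) (.lit 0)))) s₁
    rw [exec_seq]
    set s₂ := (loop 21 (.setNat 4 (.var 21) (.var 20) (.lit 0)
      (.get 4 (.var 21) (.at 2 (.var 20)) (.lit 0)))).exec I s₁
    have e20 : s₂.nat (20, 0, 0, 0) = x := by rw [hoff'.nat 20 0 0 0, hx']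
    have final : ∀ t y, t ≤ I.size → ((setNat 4 (.var 20) (.var 20) (.lit 0) (.lit 1)).exec I s₂).nat
        (4, t, y, 0) = if y = x then (if t = x then 1 else s₁.nat (4, t, s.nat (2, x, 0, 0), 0))
          else s₁.nat (4, t, y, 0) := by
      intro t y ht
      simp only [exec_setNat, Store.putNat_nat, NExp.eval, NExp.var, e20, inner, Prod.mk.injEq,
        true_and, and_true]
      by_cases hy : y = x
      · by_cases htx : t = x
        · rw [if_pos ⟨htx, hy⟩, if_pos hy, if_pos htx]
        · rw [if_neg (fun h' => htx h'.1), if_pos ⟨by omega, hy⟩, if_pos hy, if_neg htx]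
      · rw [if_neg (fun h' => hy h'.2), if_neg (fun h' => hy h'.2), if_neg hy]
    refine ⟨fun t ht htn => ?_, fun t ht htx => ?_, fun t y hy hyx htn hty => ?_⟩
    · rw [final t 0 htn]
      by_cases hx0 : 0 = x
      · rw [if_pos hx0, if_neg (by omega), ← hx0, h20]
        exact k1 t ht htn
      · rw [if_neg hx0]
        exact k1 t ht htn
    · rw [final t t (by omega)]
      by_cases hx0 : t = x
      · rw [if_pos hx0, if_pos hx0]
      · rw [if_neg hx0]
        exact k2 t ht (by omega)
    · have hp := h2 y hy (by omega)
      rw [final t y htn, final t _ htn, if_neg (c := s.nat (2, y, 0, 0) = x) (by omega)]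
      by_cases hx0 : y = x
      · rw [if_pos hx0, if_neg (by omega), hx0]
      · rw [if_neg hx0]
        exact k3 t y hy (by omega) htn hty

end Blk

theorem head_eq_zero_or_le (n : ℕ) (par : ℕ → ℕ) (t p : ℕ) :
    head n par t p = 0 ∨ t ≤ head n par t p := by
  unfold head
  rcases Set.eq_empty_or_nonempty {s | t ≤ s ∧ s ≤ n ∧ par s = p} with h | h
  · left; rw [h, Nat.sInf_empty]
  · right; exact (Nat.sInf_mem h).1

/-! ## Improving a row of the table -/

namespace Table

/-- The tables have the same entries for `t`. -/
def SameRow (B B' : Table) (t : ℕ) : Prop :=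
  B.feas t = B'.feas t ∧ B.val t = B'.val t ∧ B.label t = B'.label t ∧ B.below t = B'.below t ∧
    B.later t = B'.later t

/-- Replaces the entry `(t, j, c)`. -/
noncomputable def replace (B : Table) (t j c : ℕ) (v : ℝ) (c' j₁ j₂ : ℕ) : Table where
  feas t' j' c₁ := (t' = t ∧ j' = j ∧ c₁ = c) ∨ B.feas t' j' c₁
  val t' j' c₁ := if t' = t ∧ j' = j ∧ c₁ = c then v else B.val t' j' c₁
  label t' j' c₁ := if t' = t ∧ j' = j ∧ c₁ = c then c' else B.label t' j' c₁
  below t' j' c₁ := if t' = t ∧ j' = j ∧ c₁ = c then j₁ else B.below t' j' c₁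
  later t' j' c₁ := if t' = t ∧ j' = j ∧ c₁ = c then j₂ else B.later t' j' c₁

theorem sameRow_replace (B : Table) {t t' : ℕ} (h : t' ≠ t) (j c : ℕ) (v : ℝ) (c' j₁ j₂ : ℕ) :
    B.SameRow (B.replace t j c v c' j₁ j₂) t' := by
  refine ⟨?_, ?_, ?_, ?_, ?_⟩ <;> · funext j' c₁; simp [replace, h]

section

variable {n : ℕ} {par : ℕ → ℕ} {sub : ℕ → ℕ → Prop} {op : ℝ → ℝ → ℝ} {e : ℝ} {own : ℕ → ℕ → ℝ}

theorem Relaxed.congr {B B' : Table} {t : ℕ} (h : B.Relaxed n par sub op own t)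
    (h0 : B.SameRow B' t) (h1 : B.SameRow B' (head n par (t + 1) t))
    (h2 : B.SameRow B' (head n par (t + 1) (par t))) : B'.Relaxed n par sub op own t := by
  unfold Relaxed
  rw [← h0.1, ← h0.2.1, ← h1.1, ← h1.2.1, ← h2.1, ← h2.2.1]
  exact h

theorem AttainedAt.congr {B B' : Table} {t j c : ℕ} (h : B.AttainedAt n par sub op own t j c)
    (h0 : B.SameRow B' t) (h1 : B.SameRow B' (head n par (t + 1) t))
    (h2 : B.SameRow B' (head n par (t + 1) (par t))) : B'.AttainedAt n par sub op own t j c := by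
  obtain ⟨a1, a2, a3, a4, a5, a6, a7⟩ := h
  rw [h0.2.2.1] at a1 a2 a3 a4 a6 a7
  rw [h0.2.2.2.1] at a4 a6 a7
  rw [h0.2.2.2.2] at a5 a6 a7
  rw [h0.2.1] at a7
  rw [h1.1] at a4
  rw [h2.1] at a5
  rw [h1.2.1, h2.2.1] at a7
  exact ⟨a1, a2, a3, a4, a5, a6, a7⟩

theorem Null.congr {B B' : Table} (h : B.Null n e) (h0 : B.SameRow B' 0) : B'.Null n e := by
  obtain ⟨h1, h2⟩ := h
  rw [h0.1] at h1
  rw [h0.2.1] at h2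
  exact ⟨h1, h2⟩

/-- `B` differs from `B₀` only in the row `t`, whose entries are results of choices. -/
structure RowInv (n : ℕ) (par : ℕ → ℕ) (sub : ℕ → ℕ → Prop) (op : ℝ → ℝ → ℝ) (own : ℕ → ℕ → ℝ)
    (B₀ : Table) (t : ℕ) (B : Table) : Prop where
  same : ∀ t', t' ≠ t → B₀.SameRow B t'
  attained : ∀ j c, c ≤ n → B.feas t j c → B.AttainedAt n par sub op own t j c

/-- The row `t` of the second table is at least as good. -/
def RowLe (t : ℕ) (B B' : Table) : Prop :=
  ∀ j c, B.feas t j c → B'.feas t j c ∧ B'.val t j c ≤ B.val t j c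

theorem RowLe.refl (t : ℕ) (B : Table) : RowLe t B B := fun _ _ h => ⟨h, le_rfl⟩

theorem RowLe.trans {t : ℕ} {B₁ B₂ B₃ : Table} (h : RowLe t B₁ B₂) (h' : RowLe t B₂ B₃) :
    RowLe t B₁ B₃ := fun j c hf =>
  ⟨(h' j c (h j c hf).1).1, (h' j c (h j c hf).1).2.trans (h j c hf).2⟩

/-- The cost of a choice. -/
noncomputable def choiceVal (n : ℕ) (par : ℕ → ℕ) (op : ℝ → ℝ → ℝ) (own : ℕ → ℕ → ℝ) (B : Table)
    (t c c' j₁ j₂ : ℕ) : ℝ :=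
  op (op (own t c') (B.val (head n par (t + 1) t) j₁ c')) (B.val (head n par (t + 1) (par t)) j₂ c)

/-- The choice is possible. -/
def Choice (n : ℕ) (par : ℕ → ℕ) (sub : ℕ → ℕ → Prop) (B : Table) (t c c' j₁ j₂ : ℕ) : Prop :=
  0 < c' ∧ B.feas (head n par (t + 1) t) j₁ c' ∧ B.feas (head n par (t + 1) (par t)) j₂ c ∧
    Allowed sub t c c'

/-- The table is at least as good as a choice. -/
def Covers (n : ℕ) (par : ℕ → ℕ) (sub : ℕ → ℕ → Prop) (op : ℝ → ℝ → ℝ) (own : ℕ → ℕ → ℝ)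
    (B₀ : Table) (t c c' j₁ j₂ : ℕ) (B : Table) : Prop :=
  Choice n par sub B₀ t c c' j₁ j₂ → B.feas t (j₁ + j₂ + selfCount t c') c ∧
    B.val t (j₁ + j₂ + selfCount t c') c ≤ choiceVal n par op own B₀ t c c' j₁ j₂

theorem Covers.mono {B₀ B B' : Table} {t c c' j₁ j₂ : ℕ} (h : RowLe t B B')
    (hc : Covers n par sub op own B₀ t c c' j₁ j₂ B) : Covers n par sub op own B₀ t c c' j₁ j₂ B' :=
  fun hch => ⟨(h _ _ (hc hch).1).1, (h _ _ (hc hch).1).2.trans (hc hch).2⟩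

theorem RowInv.replace {B₀ B : Table} {t c c' j₁ j₂ : ℕ} (h : RowInv n par sub op own B₀ t B)
    (ht : 0 < t) (hc' : c' ≤ n) (hch : Choice n par sub B₀ t c c' j₁ j₂)
    (hbetter : ¬ (B.feas t (j₁ + j₂ + selfCount t c') c ∧
      ¬ choiceVal n par op own B₀ t c c' j₁ j₂ < B.val t (j₁ + j₂ + selfCount t c') c)) :
    RowInv n par sub op own B₀ t (B.replace t (j₁ + j₂ + selfCount t c') c
      (choiceVal n par op own B₀ t c c' j₁ j₂) c' j₁ j₂) ∧
    RowLe t B (B.replace t (j₁ + j₂ + selfCount t c') c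
      (choiceVal n par op own B₀ t c c' j₁ j₂) c' j₁ j₂) ∧
    Covers n par sub op own B₀ t c c' j₁ j₂ (B.replace t (j₁ + j₂ + selfCount t c') c
      (choiceVal n par op own B₀ t c c' j₁ j₂) c' j₁ j₂) := by
  -- The rows that a choice at t reads are row 0 or later rows, never the row being written.
  have hne : ∀ p, head n par (t + 1) p ≠ t := fun p => by
    rcases head_eq_zero_or_le n par (t + 1) p with h | h <;> omega
  have hsame : ∀ t', t' ≠ t → B₀.SameRow (B.replace t (j₁ + j₂ + selfCount t c') c
      (choiceVal n par op own B₀ t c c' j₁ j₂) c' j₁ j₂) t' := fun t' ht' => by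
    have h1 := h.same t' ht'
    have h2 := B.sameRow_replace ht' (j₁ + j₂ + selfCount t c') c
      (choiceVal n par op own B₀ t c c' j₁ j₂) c' j₁ j₂
    exact ⟨h1.1.trans h2.1, h1.2.1.trans h2.2.1, h1.2.2.1.trans h2.2.2.1,
      h1.2.2.2.1.trans h2.2.2.2.1, h1.2.2.2.2.trans h2.2.2.2.2⟩
  refine ⟨⟨hsame, fun j c₁ hc₁ hf => ?_⟩, fun j c₁ hf => ?_, fun _ => ?_⟩
  · have hs1 := hsame _ (hne t)
    have hs2 := hsame _ (hne (par t))
    by_cases hjc : j = j₁ + j₂ + selfCount t c' ∧ c₁ = c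
    · obtain ⟨rfl, rfl⟩ := hjc
      obtain ⟨k1, k2, k3, k4⟩ := hch
      constructor
      · simp only [Table.replace, and_self, if_true]; exact k1
      · simpa [Table.replace] using hc'
      · simpa [Table.replace] using k4
      · rw [← hs1.1]; simpa [Table.replace] using k2
      · rw [← hs2.1]; simpa [Table.replace] using k3
      · simp [Table.replace]
      · rw [← hs1.2.1, ← hs2.2.1]; simp [Table.replace, choiceVal]
    · have hf' : B.feas t j c₁ := hf.resolve_left fun h' => hjc h'.2
      obtain ⟨a1, a2, a3, a4, a5, a6, a7⟩ := h.attained j c₁ hc₁ hf'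
      have hs1' := h.same _ (hne t)
      have hs2' := h.same _ (hne (par t))
      rw [← hs1'.1] at a4
      rw [← hs2'.1] at a5
      rw [← hs1'.2.1, ← hs2'.2.1] at a7
      constructor
      · simpa [Table.replace, hjc] using a1
      · simpa [Table.replace, hjc] using a2
      · simpa [Table.replace, hjc] using a3
      · rw [← hs1.1]; simpa [Table.replace, hjc] using a4
      · rw [← hs2.1]; simpa [Table.replace, hjc] using a5
      · simpa [Table.replace, hjc] using a6
      · rw [← hs1.2.1, ← hs2.2.1]; simpa [Table.replace, hjc] using a7
  · by_cases hjc : j = j₁ + j₂ + selfCount t c' ∧ c₁ = c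
    · obtain ⟨rfl, rfl⟩ := hjc
      refine ⟨Or.inl ⟨rfl, rfl, rfl⟩, ?_⟩
      simp only [Table.replace, and_self, if_true]
      by_contra hcon
      exact hbetter ⟨hf, fun hlt => hcon hlt.le⟩
    · exact ⟨Or.inr hf, by simp [Table.replace, hjc]⟩
  · simp [Table.replace]

end

end Table

/-! ### Computation of a row of the table in memory -/

/-- The table in the memory. -/
def Store.table (s : Store) : Table where
  feas t j c := 0 < s.nat (6, t, j, c)
  val t j c := s.real (42, t, j, c)
  label t j c := s.nat (7, t, j, c)
  below t j c := s.nat (8, t, j, c)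
  later t j c := s.nat (9, t, j, c)

/-- The contribution of position `t` to the cost if its label is `c`. -/
noncomputable def Input.own (I : Input) (ord : ℕ → ℕ) (t c : ℕ) : ℝ :=
  if c = t then I.kind.op (I.connCost (ord t) (ord c)) (I.centerCost (ord t))
  else I.connCost (ord t) (ord c)

namespace Blk

variable {I : Input}

/-- Combines the real variable `43` with the value of `x`. -/
def combine (x : RExp) : Blk :=
  .branch (.natLt .kind (.lit 1)) (letReal 43 (.add (.var 43) x))
    (.branch (.realLt (.var 43) x) (letReal 43 x) .skip)

theorem exec_combine (x : RExp) (s : Store) : (combine x).exec I s =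
    s.putReal (43, 0, 0, 0) (I.kind.op (s.real (43, 0, 0, 0)) (x.eval I s)) := by
  unfold combine
  rw [exec_branch, exec_branch]
  cases hk : I.kind
  · rw [if_pos (by simp [hk])]
    simp [Kind.op]
  · rw [if_neg (by simp [hk])]
    simp only [BExp.Holds, RExp.var, RExp.eval, NExp.eval, Kind.op]
    split_ifs with h
    · rw [max_eq_right h.le]; rfl
    · rw [max_eq_left (not_lt.1 h)]
      simp [Store.putReal]

/-- Test if the choice that is given by the counters is possible. -/
def choiceTest : BExp :=
  .conj (.pos (.var 22)) (.conj (.pos (.get 6 (.at 5 (.var 17)) (.var 23) (.var 22)))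
    (.conj (.pos (.get 6 (.at 5 (.at 2 (.var 17))) (.var 24) (.var 21)))
      (.neg (.conj (.neg (.eq (.var 22) (.var 21)))
        (.neg (.conj (.neg (.pos (.get 4 (.var 17) (.var 21) (.lit 0))))
          (.pos (.get 4 (.var 17) (.var 22) (.lit 0)))))))))

/-- Computes the cost and the number of centers of the choice that is given by the counters. -/
def choiceCost : Blk :=
  .seq (letReal 43 (.connCost (.at 1 (.var 17)) (.at 1 (.var 22))))
    (.seq (letNat 18 (.add (.var 23) (.var 24)))
      (.seq (.branch (.eq (.var 22) (.var 17)) (.seq (combine (.centerCost (.at 1 (.var 17))))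
          (letNat 18 (.add (.var 18) (.lit 1)))) .skip)
        (.seq (combine (.get 42 (.at 5 (.var 17)) (.var 23) (.var 22)))
          (combine (.get 42 (.at 5 (.at 2 (.var 17))) (.var 24) (.var 21))))))

/-- Writes the choice into the table. -/
def choiceStore : Blk :=
  .seq (.setNat 6 (.var 17) (.var 18) (.var 21) (.lit 1))
    (.seq (.setReal 42 (.var 17) (.var 18) (.var 21) (.var 43))
      (.seq (.setNat 7 (.var 17) (.var 18) (.var 21) (.var 22))
        (.seq (.setNat 8 (.var 17) (.var 18) (.var 21) (.var 23))
          (.setNat 9 (.var 17) (.var 18) (.var 21) (.var 24)))))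

/-- Improves the table by the choice that is given by the counters. -/
def relaxStep : Blk :=
  .branch choiceTest (.seq choiceCost
    (.branch (.neg (.conj (.pos (.get 6 (.var 17) (.var 18) (.var 21)))
      (.neg (.realLt (.var 43) (.get 42 (.var 17) (.var 18) (.var 21)))))) choiceStore .skip)) .skip

/-- The variables of the step of the dynamic program. -/
structure ChoiceVars (n : ℕ) (ord par : ℕ → ℕ) (sub : ℕ → ℕ → Prop) (t c c' j₁ j₂ : ℕ)
    (s : Store) : Prop where
  ord_eq : ∀ r, s.nat (1, r, 0, 0) = ord r
  par_eq : s.nat (2, t, 0, 0) = par t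
  sub_iff : ∀ x, 0 < s.nat (4, t, x, 0) ↔ sub t x
  head_eq : ∀ p, s.nat (5, p, 0, 0) = head n par (t + 1) p
  pos : s.nat (17, 0, 0, 0) = t
  v21 : s.nat (21, 0, 0, 0) = c
  v22 : s.nat (22, 0, 0, 0) = c'
  v23 : s.nat (23, 0, 0, 0) = j₁
  v24 : s.nat (24, 0, 0, 0) = j₂

variable {n : ℕ} {ord par : ℕ → ℕ} {sub : ℕ → ℕ → Prop} {t c c' j₁ j₂ : ℕ} {s : Store}

theorem holds_choiceTest (h : ChoiceVars n ord par sub t c c' j₁ j₂ s) :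
    choiceTest.Holds I s ↔ s.table.Choice n par sub t c c' j₁ j₂ := by
  simp only [choiceTest, BExp.Holds, BExp.holds_pos, BExp.holds_eq, NExp.eval, NExp.var, NExp.at,
    h.pos, h.v21, h.v22, h.v23, h.v24, h.par_eq, h.head_eq, h.sub_iff, Table.Choice, Store.table, Allowed]
  tauto

theorem exec_choiceCost (h : ChoiceVars n ord par sub t c c' j₁ j₂ s) :
    choiceCost.exec I s = (s.putNat (18, 0, 0, 0) (j₁ + j₂ + selfCount t c')).putReal (43, 0, 0, 0)
      (s.table.choiceVal n par I.kind.op (I.own ord) t c c' j₁ j₂) := by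
  have hupd : ∀ (s : Store) (x : Cell) (v w : ℕ), (s.putNat x v).putNat x w = s.putNat x w := by
    intro s x v w; simp [Store.putNat]
  have hupd' : ∀ (s : Store) (x : Cell) (v w : ℝ), (s.putReal x v).putReal x w = s.putReal x w := by
    intro s x v w; simp [Store.putReal]
  have hcomm : ∀ (s : Store) (x y : Cell) (v : ℕ) (w : ℝ), (s.putReal x w).putNat y v =
    (s.putNat y v).putReal x w := fun _ _ _ _ _ => rfl
  unfold choiceCost
  simp only [exec_seq, exec_combine, exec_branch, exec_letReal, exec_letNat, BExp.holds_eq,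
    NExp.eval, RExp.eval, NExp.var, NExp.at]
  by_cases hc : c' = t <;>
    simp [h.ord_eq, h.par_eq, h.head_eq, h.pos, h.v21, h.v22, h.v23, h.v24, hc, hupd, hupd', hcomm,
      selfCount, Table.choiceVal, Input.own, Store.table]

theorem table_choiceStore {j : ℕ} {v : ℝ} (ht : s.nat (17, 0, 0, 0) = t)
    (hj : s.nat (18, 0, 0, 0) = j) (hv : s.real (43, 0, 0, 0) = v)
    (h21 : s.nat (21, 0, 0, 0) = c) (h22 : s.nat (22, 0, 0, 0) = c')
    (h23 : s.nat (23, 0, 0, 0) = j₁) (h24 : s.nat (24, 0, 0, 0) = j₂) :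
    (choiceStore.exec I s).table = s.table.replace t j c v c' j₁ j₂ := by
  unfold choiceStore Store.table Table.replace
  simp [ht, hj, hv, h21, h22, h23, h24]
  funext t' j' c₁
  split_ifs with h <;> simp [h]

/-- The choice reads only rows in which the memory still agrees with `B₀`, so its feasibility and
its value can be taken from `B₀`, whatever has happened to row t. -/
theorem exec_relaxStep (h : ChoiceVars n ord par sub t c c' j₁ j₂ s) (ht : 0 < t) (hc' : c' ≤ n)
    {B₀ : Table} (hB : B₀.RowInv n par sub I.kind.op (I.own ord) t s.table) :
    B₀.RowInv n par sub I.kind.op (I.own ord) t (relaxStep.exec I s).table ∧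
    Table.RowLe t s.table (relaxStep.exec I s).table ∧
    B₀.Covers n par sub I.kind.op (I.own ord) t c c' j₁ j₂ (relaxStep.exec I s).table := by
  have hne : ∀ p, head n par (t + 1) p ≠ t := fun p => by
    rcases head_eq_zero_or_le n par (t + 1) p with h | h <;> omega
  have hs1 := hB.same _ (hne t)
  have hs2 := hB.same _ (hne (par t))
  have hch : s.table.Choice n par sub t c c' j₁ j₂ ↔ B₀.Choice n par sub t c c' j₁ j₂ := by
    unfold Table.Choice
    rw [hs1.1, hs2.1]
  have hval : s.table.choiceVal n par I.kind.op (I.own ord) t c c' j₁ j₂ =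
      B₀.choiceVal n par I.kind.op (I.own ord) t c c' j₁ j₂ := by
    unfold Table.choiceVal
    rw [hs1.2.1, hs2.2.1]
  unfold relaxStep
  rw [exec_branch]
  split_ifs with h1
  · rw [holds_choiceTest h, hch] at h1
    rw [exec_seq, exec_choiceCost h, exec_branch, hval]
    set s₁ := (s.putNat (18, 0, 0, 0) (j₁ + j₂ + selfCount t c')).putReal (43, 0, 0, 0)
      (B₀.choiceVal n par I.kind.op (I.own ord) t c c' j₁ j₂) with hs₁
    have htab : s₁.table = s.table := by simp [Store.table, hs₁]
    split_ifs with h2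
    · rw [table_choiceStore (j := j₁ + j₂ + selfCount t c')
        (v := B₀.choiceVal n par I.kind.op (I.own ord) t c c' j₁ j₂) (t := t) (c := c) (c' := c') (j₁ := j₁) (j₂ := j₂)
        (by simp [hs₁, h.pos]) (by simp [hs₁]) (by simp [hs₁]) (by simp [hs₁, h.v21])
        (by simp [hs₁, h.v22]) (by simp [hs₁, h.v23]) (by simp [hs₁, h.v24]), htab]
      refine hB.replace ht hc' h1 ?_
      simpa [hs₁, BExp.Holds, h.pos, h.v21, Store.table] using h2
    · rw [exec_skip, htab]
      refine ⟨hB, Table.RowLe.refl _ _, fun _ => ?_⟩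
      have h3 : s.table.feas t (j₁ + j₂ + selfCount t c') c ∧
          ¬ B₀.choiceVal n par I.kind.op (I.own ord) t c c' j₁ j₂ <
            s.table.val t (j₁ + j₂ + selfCount t c') c := by
        by_contra hcon
        refine h2 ?_
        simpa [hs₁, BExp.Holds, h.pos, h.v21, Store.table] using hcon
      exact ⟨h3.1, not_lt.1 h3.2⟩
  · rw [holds_choiceTest h, hch] at h1
    exact ⟨hB, Table.RowLe.refl _ _, fun h2 => absurd h2 h1⟩

/-- Computes a row of the table. -/
def relaxRow : Blk := .loop 21 (.loop 22 (.loop 23 (.loop 24 relaxStep)))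

/-- The variables of the computation of a row of the table. -/
structure RowVars (n : ℕ) (ord par : ℕ → ℕ) (sub : ℕ → ℕ → Prop) (t : ℕ) (s : Store) : Prop where
  ord_eq : ∀ r, s.nat (1, r, 0, 0) = ord r
  par_eq : s.nat (2, t, 0, 0) = par t
  sub_iff : ∀ x, 0 < s.nat (4, t, x, 0) ↔ sub t x
  head_eq : ∀ p, s.nat (5, p, 0, 0) = head n par (t + 1) p
  pos : s.nat (17, 0, 0, 0) = t

/-- Four nested improvement loops over the labels of the parent and of t and the two numbers of
centers. The row starts without feasible entries, so the invariant holds vacuously at first. -/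
theorem exec_relaxRow (h : RowVars I.size ord par sub t s) (ht : 0 < t)
    (hfeas : ∀ j c, c ≤ I.size → ¬ s.table.feas t j c) :
    s.table.RowInv I.size par sub I.kind.op (I.own ord) t (relaxRow.exec I s).table ∧
    ∀ c, c ≤ I.size → ∀ c', c' ≤ I.size → ∀ j₁, j₁ ≤ I.size → ∀ j₂, j₂ ≤ I.size →
      s.table.Covers I.size par sub I.kind.op (I.own ord) t c c' j₁ j₂
        (relaxRow.exec I s).table := by
  have hrefl : ∀ s : Store, Table.RowLe t s.table s.table := fun s => Table.RowLe.refl _ _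
  have htrans : ∀ s₁ s₂ s₃ : Store, Table.RowLe t s₁.table s₂.table →
      Table.RowLe t s₂.table s₃.table → Table.RowLe t s₁.table s₃.table :=
    fun _ _ _ h h' => h.trans h'
  have hput : ∀ (s' : Store) (a v : ℕ), 20 ≤ a → (s'.putNat (a, 0, 0, 0) v).table = s'.table := by
    intro s' a v ha
    have h6 : 6 ≠ a := by omega
    have h7 : 7 ≠ a := by omega
    have h8 : 8 ≠ a := by omega
    have h9 : 9 ≠ a := by omega
    simp [Store.table, h6, h7, h8, h9]
  have hJ : ∀ a, 20 ≤ a → ∀ (s' : Store) (v : ℕ),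
      s.table.RowInv I.size par sub I.kind.op (I.own ord) t s'.table →
      s.table.RowInv I.size par sub I.kind.op (I.own ord) t (s'.putNat (a, 0, 0, 0) v).table :=
    fun a ha s' v h => by rwa [hput s' a v ha]
  have hLe : ∀ a, 20 ≤ a → ∀ (s' : Store) (v : ℕ),
      Table.RowLe t s'.table (s'.putNat (a, 0, 0, 0) v).table :=
    fun a ha s' v => by rw [hput s' a v ha]; exact Table.RowLe.refl _ _
  have key := achieves_loop (I := I) (a := 21) (p := .loop 22 (.loop 23 (.loop 24 relaxStep)))
    (s := s) (J := fun s' => s.table.RowInv I.size par sub I.kind.op (I.own ord) t s'.table)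
    (Le := fun s₁ s₂ => Table.RowLe t s₁.table s₂.table)
    (G := fun c s' => ∀ c', c' ≤ I.size → ∀ j₁, j₁ ≤ I.size → ∀ j₂, j₂ ≤ I.size →
      s.table.Covers I.size par sub I.kind.op (I.own ord) t c c' j₁ j₂ s'.table)
    hrefl htrans (hJ 21 (by omega)) (hLe 21 (by omega))
    (fun c s₁ s₂ hle hg c' hc' j₁ hj₁ j₂ hj₂ => (hg c' hc' j₁ hj₁ j₂ hj₂).mono hle)
    (fun c s₁ hc e₁ o₁ => achieves_loop hrefl htrans (hJ 22 (by omega)) (hLe 22 (by omega))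
      (fun c' s₁ s₂ hle hg j₁ hj₁ j₂ hj₂ => (hg j₁ hj₁ j₂ hj₂).mono hle)
      (fun c' s₂ hc' e₂ o₂ => achieves_loop hrefl htrans (hJ 23 (by omega)) (hLe 23 (by omega))
        (fun j₁ s₁ s₂ hle hg j₂ hj₂ => (hg j₂ hj₂).mono hle)
        (fun j₁ s₃ hj₁ e₃ o₃ => achieves_loop hrefl htrans (hJ 24 (by omega)) (hLe 24 (by omega))
          (fun j₂ s₁ s₂ hle hg => hg.mono hle)
          (fun j₂ s₄ hj₂ e₄ o₄ hinv => exec_relaxStep (by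
            constructor
            · intro r
              rw [o₄.nat 1, o₃.nat 1, o₂.nat 1, o₁.nat 1, h.ord_eq]
            · rw [o₄.nat 2, o₃.nat 2, o₂.nat 2, o₁.nat 2, h.par_eq]
            · intro x
              rw [o₄.nat 4, o₃.nat 4, o₂.nat 4, o₁.nat 4, h.sub_iff]
            · intro p
              rw [o₄.nat 5, o₃.nat 5, o₂.nat 5, o₁.nat 5, h.head_eq]
            · rw [o₄.nat 17, o₃.nat 17, o₂.nat 17, o₁.nat 17, h.pos]
            · rw [o₄.nat 21, o₃.nat 21, o₂.nat 21, e₁]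
            · rw [o₄.nat 22, o₃.nat 22, e₂]
            · rw [o₄.nat 23, e₃]
            · exact e₄) ht hc' hinv))))
  obtain ⟨h1, -, h3⟩ := key ⟨fun _ _ => ⟨rfl, rfl, rfl, rfl, rfl⟩,
    fun j c hc hf => absurd hf (hfeas j c hc)⟩
  exact ⟨h1, h3⟩

/-! ### Filling the table from the last position to the first -/

/-- Writes the null entries of the table. -/
def initNull : Blk :=
  .loop 20 (.seq (.setNat 6 (.lit 0) (.lit 0) (.var 20) (.lit 1))
    (.setReal 42 (.lit 0) (.lit 0) (.var 20) (.var 40)))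

theorem exec_initNull {e : ℝ} (h6 : ∀ t j c, s.nat (6, t, j, c) = 0)
    (h40 : s.real (40, 0, 0, 0) = e) :
    (initNull.exec I s).table.Null I.size e ∧
    ∀ t j c, 1 ≤ t → ¬ (initNull.exec I s).table.feas t j c := by
  have key := exec_loop_invariant (I := I) (a := 20) (s := s)
    (p := .seq (.setNat 6 (.lit 0) (.lit 0) (.var 20) (.lit 1))
      (.setReal 42 (.lit 0) (.lit 0) (.var 20) (.var 40)))
    (fun i s' => s'.real (40, 0, 0, 0) = e ∧
      (∀ t j c, 0 < s'.nat (6, t, j, c) → t = 0 ∧ j = 0) ∧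
      ∀ c, c < i → 0 < s'.nat (6, 0, 0, c) ∧ s'.real (42, 0, 0, c) = e)
    ⟨h40, fun t j c h => absurd h (by rw [h6]; omega), fun c h => absurd h (Nat.not_lt_zero _)⟩
    (fun i s' v h => by simpa using h) ?_
  · obtain ⟨-, h1, h2⟩ := key
    refine ⟨⟨fun j c hc => ⟨fun h => (h1 _ _ _ h).2, ?_⟩, fun c hc => (h2 c (by omega)).2⟩,
      fun t j c ht hf => ?_⟩
    · rintro rfl
      exact (h2 c (by omega)).1
    · have := h1 _ _ _ hf
      omega
  · rintro i s₁ hi hi' - ⟨h1, h2, h3⟩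
    refine ⟨by simpa using h1, fun t j c => ?_, fun c hc => ?_⟩
    · simp only [exec_seq, exec_setNat, exec_setReal, Store.putReal_nat, Store.putNat_nat,
        NExp.eval, NExp.var, hi', Prod.mk.injEq, true_and]
      split_ifs with h
      · exact fun _ => ⟨h.1, h.2.1⟩
      · exact h2 t j c
    · by_cases hc' : c = i
      · simp [hc', hi', h1]
      · simpa [hc', hi'] using h3 c (by omega)

/-- A step of the dynamic program. -/
def dpStep : Blk :=
  .seq (letNat 17 (.sub .size (.var 20)))
    (.branch (.pos (.var 17)) (.seq relaxRow
      (.setNat 5 (.at 2 (.var 17)) (.lit 0) (.lit 0) (.var 17))) .skip)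

/-- The dynamic program. -/
def dp : Blk := .seq initNull (.loop 20 dpStep)

/-- The state of the dynamic program after `i` steps. -/
structure DPInv (I : Input) (ord par : ℕ → ℕ) (sub : ℕ → ℕ → Prop) (e : ℝ) (i : ℕ) (s : Store) :
    Prop where
  null : s.table.Null I.size e
  head_eq : i ≤ I.size → ∀ p, s.nat (5, p, 0, 0) = head I.size par (I.size + 1 - i) p
  relaxed : ∀ t, 1 ≤ t → t ≤ I.size → I.size < t + i →
    s.table.Relaxed I.size par sub I.kind.op (I.own ord) t
  attained : ∀ t j c, 1 ≤ t → t ≤ I.size → I.size < t + i → c ≤ I.size → s.table.feas t j c →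
    s.table.AttainedAt I.size par sub I.kind.op (I.own ord) t j c
  infeas : ∀ t j c, 1 ≤ t → t + i ≤ I.size → ¬ s.table.feas t j c

/-- Round i treats t = n - i. The list heads then describe the children greater than t, so the head
at t is its first child and the head at its parent is its next sibling; both rows are finished. -/
theorem exec_dpStep {e : ℝ} {i : ℕ} (hi : i ≤ I.size) (hi' : s.nat (20, 0, 0, 0) = i)
    (hord : ∀ r, s.nat (1, r, 0, 0) = ord r) (hpar : ∀ r, s.nat (2, r, 0, 0) = par r)
    (hsub : ∀ t x, t ≤ I.size → (0 < s.nat (4, t, x, 0) ↔ sub t x)) (h : DPInv I ord par sub e i s) :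
    DPInv I ord par sub e (i + 1) (dpStep.exec I s) := by
  unfold dpStep
  have hev : (NExp.sub .size (.var 20)).eval I s = I.size - i := by simp [hi']
  rw [exec_seq, exec_letNat, exec_branch, hev]
  set s₁ := s.putNat (17, 0, 0, 0) (I.size - i) with hs₁
  have htab : s₁.table = s.table := by simp [Store.table, hs₁]
  have e17 : s₁.nat (17, 0, 0, 0) = I.size - i := by simp [hs₁]
  have htest : (BExp.pos (.var 17)).Holds I s₁ ↔ 0 < I.size - i := by simp [e17]
  simp only [htest]
  split_ifs with hpos
  · have hvars : RowVars I.size ord par sub (I.size - i) s₁ := by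
      constructor
      · intro r; simp [hs₁, hord]
      · simp [hs₁, hpar]
      · intro x; simpa [hs₁] using hsub _ x (Nat.sub_le _ _)
      · intro p
        have := h.head_eq hi p
        rw [Nat.sub_add_comm hi] at this
        simpa [hs₁] using this
      · exact e17
    obtain ⟨h1, h2⟩ := exec_relaxRow (I := I) hvars hpos
      fun j c _ => by rw [htab]; exact h.infeas _ _ _ hpos (by omega)
    have hoff := exec_eqOff (I := I) relaxRow s₁
    rw [exec_seq]
    set s₂ := relaxRow.exec I s₁
    rw [htab] at h1 h2
    have e2 : s₂.nat (2, I.size - i, 0, 0) = par (I.size - i) := by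
      rw [hoff.nat 2]; simp [hs₁, hpar]
    have e17' : s₂.nat (17, 0, 0, 0) = I.size - i := by rw [hoff.nat 17, e17]
    have e5 : ∀ p, s₂.nat (5, p, 0, 0) = head I.size par (I.size - i + 1) p := fun p => by
      rw [hoff.nat 5]; exact hvars.head_eq p
    have htab' : ((setNat 5 (.at 2 (.var 17)) (.lit 0) (.lit 0) (.var 17)).exec I s₂).table =
        s₂.table := by simp [Store.table]
    generalize hT : I.size - i = t at *
    have hne : ∀ t' p, t ≤ t' → head I.size par (t' + 1) p ≠ t := fun t' p htt => by
      rcases head_eq_zero_or_le I.size par (t' + 1) p with h | h <;> omega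
    constructor
    · rw [htab']
      exact h.null.congr (h1.same 0 (by omega))
    · intro hi1 p
      -- Putting t in front of the list of its parent is the only change in the heads from t + 1 to
      -- t.
      have : I.size + 1 - (i + 1) = t := by omega
      rw [this]
      simp only [exec_setNat, NExp.eval, NExp.var, NExp.at, e17', e2, Store.putNat_nat,
        Prod.mk.injEq, true_and, and_true, e5]
      split_ifs with hp
      · rw [hp, head_par (by omega)]
      · rw [head_of_ne hp]
    · intro t' ht1 htn hti
      rw [htab']
      by_cases htt : t' = t
      · subst htt
        intro c c' j₁ j₂ hc hc'1 hc' hj₁ hj₂ hall hf1 hf2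
        have hs1 := h1.same _ (hne t' t' le_rfl)
        have hs2 := h1.same _ (hne t' (par t') le_rfl)
        have h3 := h2 c hc c' hc' j₁ hj₁ j₂ hj₂
          ⟨hc'1, by rw [hs1.1]; exact hf1, by rw [hs2.1]; exact hf2, hall⟩
        unfold Table.choiceVal at h3
        rw [hs1.2.1, hs2.2.1] at h3
        exact h3
      · exact (h.relaxed t' ht1 htn (by omega)).congr (h1.same _ htt)
          (h1.same _ (hne _ _ (by omega))) (h1.same _ (hne _ _ (by omega)))
    · intro t' j c ht1 htn hti hc hf
      rw [htab'] at hf ⊢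
      by_cases htt : t' = t
      · subst htt
        exact h1.attained j c hc hf
      · rw [← (h1.same _ htt).1] at hf
        exact (h.attained t' j c ht1 htn (by omega) hc hf).congr (h1.same _ htt)
          (h1.same _ (hne _ _ (by omega))) (h1.same _ (hne _ _ (by omega)))
    · intro t' j c ht1 hti
      rw [htab', ← (h1.same t' (by omega)).1]
      exact h.infeas t' j c ht1 (by omega)
  · rw [exec_skip]
    constructor
    · rw [htab]; exact h.null
    -- The round for position 0 changes no list, and the claim about the heads is void after it.
    · intro hi1; omega
    · intro t' ht1 htn hti
      rw [htab]; exact h.relaxed t' ht1 htn (by omega)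
    · intro t' j c ht1 htn hti hc hf
      rw [htab] at hf ⊢
      exact h.attained t' j c ht1 htn (by omega) hc hf
    · intro t' j c ht1 hti; omega

theorem exec_dp {e : ℝ} (h6 : ∀ t j c, s.nat (6, t, j, c) = 0) (h5 : ∀ p, s.nat (5, p, 0, 0) = 0)
    (h40 : s.real (40, 0, 0, 0) = e)
    (hord : ∀ r, s.nat (1, r, 0, 0) = ord r) (hpar : ∀ r, s.nat (2, r, 0, 0) = par r)
    (hsub : ∀ t x, t ≤ I.size → (0 < s.nat (4, t, x, 0) ↔ sub t x)) :
    (dp.exec I s).table.Correct I.size par sub I.kind.op e (I.own ord) := by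
  obtain ⟨h1, h2⟩ := exec_initNull (I := I) h6 h40
  have hoff := exec_eqOff (I := I) initNull s
  unfold dp
  rw [exec_seq]
  set s₁ := initNull.exec I s
  have key := exec_loop_invariant (I := I) (a := 20) (s := s₁) (p := dpStep)
    (fun i s' => DPInv I ord par sub e i s')
    ⟨h1, fun _ p => by rw [hoff.nat 5, h5, head_of_lt p (by omega)],
      fun t _ _ h => by omega, fun t _ _ _ _ h => by omega, fun t j c ht _ => h2 t j c ht⟩
    (fun i s' v h => by
      have htab : (s'.putNat (20, 0, 0, 0) v).table = s'.table := by simp [Store.table]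
      refine ⟨?_, ?_, ?_, ?_, ?_⟩
      · rw [htab]; exact h.null
      · simpa using h.head_eq
      · rw [htab]; exact h.relaxed
      · rw [htab]; exact h.attained
      · rw [htab]; exact h.infeas)
    (fun i s₂ hi hi' hoff₂ h => exec_dpStep hi hi'
      (fun r => by rw [hoff₂.nat 1, hoff.nat 1, hord])
      (fun r => by rw [hoff₂.nat 2, hoff.nat 2, hpar])
      (fun t x ht => by rw [hoff₂.nat 4, hoff.nat 4, hsub t x ht]) h)
  exact ⟨key.null, fun t h h' => key.relaxed t h h' (by omega),
    fun t j c h h' => key.attained t j c h h' (by omega)⟩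

end Blk

/-! ### Laws of the combination of costs -/

instance (κ : Kind) : Std.Commutative κ.op :=
  ⟨fun x y => by cases κ <;> simp only [Kind.op, add_comm, max_comm]⟩

instance (κ : Kind) : Std.Associative κ.op :=
  ⟨fun x y z => by cases κ <;> simp only [Kind.op, add_assoc, max_assoc]⟩

theorem Kind.op_mono (κ : Kind) (a b c d : ℝ) (h : a ≤ b) (h' : c ≤ d) :
    κ.op a c ≤ κ.op b d := by
  cases κ
  · exact add_le_add h h'
  · exact max_le_max h h'

theorem fold_total (s : Finset ℕ) (e : ℝ) (f : ℕ → ℝ) :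
    s.fold Kind.total.op e f = e + ∑ i ∈ s, f i := by
  induction s using Finset.induction_on with
  | empty => simp
  | insert a s ha ih =>
    rw [Finset.fold_insert ha, ih, Finset.sum_insert ha]
    simp only [Kind.op]
    ring

theorem fold_bottleneck_le (s : Finset ℕ) (e x : ℝ) (f : ℕ → ℝ) :
    s.fold Kind.bottleneck.op e f ≤ x ↔ e ≤ x ∧ ∀ i ∈ s, f i ≤ x := by
  induction s using Finset.induction_on with
  | empty => simp
  | insert a s ha ih =>
    rw [Finset.fold_insert ha, Finset.forall_mem_insert]
    simp only [Kind.op, max_le_iff, ih]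
    tauto

/-! ### Reading off the labeling and writing the output -/

namespace Blk

variable {I : Input}

/-- Labels a position by an entry of the table. -/
def labelStep : Blk :=
  .branch (.pos (.var 20))
    (.seq (.setNat 11 (.var 20) (.lit 0) (.lit 0)
        (.get 7 (.var 20) (.at 10 (.at 2 (.var 20))) (.at 11 (.at 2 (.var 20)))))
      (.seq (.setNat 10 (.var 20) (.lit 0) (.lit 0)
          (.get 8 (.var 20) (.at 10 (.at 2 (.var 20))) (.at 11 (.at 2 (.var 20)))))
        (.setNat 10 (.at 2 (.var 20)) (.lit 0) (.lit 0)
          (.get 9 (.var 20) (.at 10 (.at 2 (.var 20))) (.at 11 (.at 2 (.var 20)))))))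
    .skip

/-- Extracts an optimal labeling from the table. -/
def labels : Blk :=
  .seq (.setNat 10 (.lit 0) (.lit 0) (.lit 0) .clusters) (.loop 20 labelStep)

theorem exec_labels {s : Store} {par : ℕ → ℕ} {sub : ℕ → ℕ → Prop} {e : ℝ} {op : ℝ → ℝ → ℝ}
    [Std.Commutative op] [Std.Associative op] {own : ℕ → ℕ → ℝ} (he : op e e = e)
    (h11 : s.nat (11, 0, 0, 0) = 0) (hpar : ∀ r, s.nat (2, r, 0, 0) = par r)
    (hB : s.table.Correct I.size par sub op e own) (h : IsRootedTree I.size par sub)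
    (hf : s.table.feas (head I.size par 1 0) I.clusters 0) :
    s.table.PartialLabeling I.size par sub op e own I.clusters (I.size + 1)
      (fun p => (labels.exec I s).nat (10, p, 0, 0))
      (fun t => (labels.exec I s).nat (11, t, 0, 0)) := by
  unfold labels
  rw [exec_seq]
  set s₁ := (setNat 10 (.lit 0) (.lit 0) (.lit 0) .clusters).exec I s with hs₁
  -- Round 0 does nothing, so the state before round 0 and the state before round 1 both count as
  -- stage 1.
  have key := exec_loop_invariant (I := I) (a := 20) (s := s₁) (p := labelStep)
    (fun i s' => s.table.PartialLabeling I.size par sub op e own I.clusters (max i 1)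
      (fun p => s'.nat (10, p, 0, 0)) (fun t => s'.nat (11, t, 0, 0)))
    (Table.PartialLabeling.init he hf (by simp [hs₁]) (by simp [hs₁, h11]))
    (fun i s' v hP => by simpa using hP) ?_
  · rwa [max_eq_left (by omega)] at key
  · intro t s₂ ht ht' hoff hP
    unfold labelStep
    rw [exec_branch]
    have htest : (BExp.pos (.var 20)).Holds I s₂ ↔ 0 < t := by simp [ht']
    simp only [htest]
    split_ifs with hpos
    · rw [max_eq_left (by omega)] at hP ⊢
      have hp := h.par_lt t hpos ht
      have e2 : ∀ r, s₂.nat (2, r, 0, 0) = par r := fun r => by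
        rw [hoff.nat 2]; simp [hs₁, hpar]
      have e7 : ∀ j c, s₂.nat (7, t, j, c) = s.nat (7, t, j, c) := fun j c => by
        rw [hoff.nat 7]; simp [hs₁]
      have e8 : ∀ j c, s₂.nat (8, t, j, c) = s.nat (8, t, j, c) := fun j c => by
        rw [hoff.nat 8]; simp [hs₁]
      have e9 : ∀ j c, s₂.nat (9, t, j, c) = s.nat (9, t, j, c) := fun j c => by
        rw [hoff.nat 9]; simp [hs₁]
      -- The write at t leaves the demand of its parent intact, because the parent is a different
      -- position. Hence the last assignment still reads the old demand before it replaces it.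
      refine hP.step hB h hpos ht ?_ ?_
      · funext r
        simp [ht', e2, e7, Store.table, Function.update_apply]
      · funext r
        simp [ht', e2, e8, e9, hp.ne, Store.table, Function.update_apply]
    · obtain rfl : t = 0 := by omega
      simpa using hP

/-- Numbers the clusters. -/
def number : Blk :=
  .loop 20 (.branch (.conj (.pos (.var 20)) (.eq (.at 11 (.var 20)) (.var 20)))
    (.seq (.setNat 12 (.var 20) (.lit 0) (.lit 0) (.var 13)) (letNat 13 (.add (.var 13) (.lit 1))))
    .skip)

theorem exec_number {s : Store} {φ : ℕ → ℕ} (h11 : ∀ t, s.nat (11, t, 0, 0) = φ t)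
    (h13 : s.nat (13, 0, 0, 0) = 0) {t : ℕ} (ht : 1 ≤ t) (htn : t ≤ I.size) (hφ : φ t = t) :
    (number.exec I s).nat (12, t, 0, 0) = ((Finset.Ico 1 t).filter fun r => φ r = r).card := by
  have key := exec_loop_invariant (I := I) (a := 20) (s := s)
    (p := .branch (.conj (.pos (.var 20)) (.eq (.at 11 (.var 20)) (.var 20)))
      (.seq (.setNat 12 (.var 20) (.lit 0) (.lit 0) (.var 13))
        (letNat 13 (.add (.var 13) (.lit 1)))) .skip)
    (fun i s' => s'.nat (13, 0, 0, 0) = ((Finset.Ico 1 i).filter fun r => φ r = r).card ∧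
      ∀ t, 1 ≤ t → t < i → φ t = t →
        s'.nat (12, t, 0, 0) = ((Finset.Ico 1 t).filter fun r => φ r = r).card)
    ⟨by simpa using h13, fun t _ h => absurd h (Nat.not_lt_zero _)⟩
    (fun i s' v h => by simpa using h) ?_
  · exact key.2 t ht (by omega) hφ
  · rintro i s₁ hi hi' hoff ⟨h1, h2⟩
    have e11 : s₁.nat (11, i, 0, 0) = φ i := by rw [hoff.nat 11, h11]
    rw [exec_branch]
    have htest : (BExp.conj (.pos (.var 20)) (.eq (.at 11 (.var 20)) (.var 20))).Holds I s₁ ↔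
        0 < i ∧ φ i = i := by simp [hi', e11]
    simp only [htest]
    split_ifs with h
    · constructor
      · rw [Ico_one_eq_insert h.1, Finset.filter_insert, if_pos h.2,
          Finset.card_insert_of_notMem (by simp)]
        simp [h1]
      · intro t ht hti hφt
        simp only [exec_seq, exec_setNat, exec_letNat, Store.putNat_nat, NExp.eval, NExp.var, hi',
          Prod.mk.injEq, and_true, true_and]
        by_cases hte : t = i
        · simp [hte, h1]
        · simpa [hte] using h2 t ht (by omega) hφt
    · rw [exec_skip]
      refine ⟨?_, fun t ht hti hφt => h2 t ht ?_ hφt⟩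
      · rcases Nat.eq_zero_or_pos i with rfl | h0
        · simpa using h1
        · rw [Ico_one_eq_insert h0, Finset.filter_insert, if_neg fun h' => h ⟨h0, h'⟩]
          exact h1
      · have : t ≠ i := by rintro rfl; exact h ⟨ht, hφt⟩
        omega

/-- Writes the output. -/
def output : Blk :=
  .loop 20 (.branch (.pos (.var 20))
    (.setNat 0 (.at 1 (.var 20)) (.lit 0) (.lit 0) (.at 12 (.at 11 (.var 20)))) .skip)

theorem exec_output {s : Store} {t : ℕ} (ht : 1 ≤ t) (htn : t ≤ I.size)
    (hinj : ∀ r r', 1 ≤ r → r < r' → r' ≤ I.size → s.nat (1, r, 0, 0) ≠ s.nat (1, r', 0, 0)) :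
    (output.exec I s).nat (0, s.nat (1, t, 0, 0), 0, 0) =
      s.nat (12, s.nat (11, t, 0, 0), 0, 0) := by
  have key := exec_loop_invariant (I := I) (a := 20) (s := s)
    (p := .branch (.pos (.var 20))
      (.setNat 0 (.at 1 (.var 20)) (.lit 0) (.lit 0) (.at 12 (.at 11 (.var 20)))) .skip)
    (fun i s' => ∀ t, 1 ≤ t → t < i → s'.nat (0, s.nat (1, t, 0, 0), 0, 0) =
      s.nat (12, s.nat (11, t, 0, 0), 0, 0))
    (fun t _ h => absurd h (Nat.not_lt_zero _)) (fun i s' v h => by simpa using h) ?_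
  · exact key t ht (by omega)
  · intro i s₁ hi hi' hoff h t ht hti
    rw [exec_branch]
    have htest : (BExp.pos (.var 20)).Holds I s₁ ↔ 0 < i := by simp [hi']
    simp only [htest]
    rw [if_pos (by omega)]
    simp only [exec_setNat, Store.putNat_nat, NExp.eval, NExp.var, NExp.at, hi', hoff.nat 1,
      hoff.nat 11, hoff.nat 12, Prod.mk.injEq, and_true, true_and]
    rcases Nat.lt_succ_iff_lt_or_eq.1 hti with hlt | rfl
    · rw [if_neg (hinj t i ht hlt hi)]
      exact h t ht hlt
    · rw [if_pos rfl]

/-- The whole algorithm. -/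
def clustering : Blk :=
  .seq nullCost (.seq prim (.seq subtrees (.seq dp (.seq labels (.seq number output)))))

theorem wellFormed_clustering : clustering.WellFormed := by
  simp only [clustering, nullCost, prim, subtrees, dp, labels, number, output, WellFormed,
    lowerTo, primStep, scan, scanStep, initNull, dpStep, relaxRow, relaxStep, choiceCost,
    choiceStore, combine, labelStep, letNat, letReal, writes]
  simp

/-- The result of the algorithm: it orders the points, finds a greedy tree on the positions, and
computes a cheapest labeling of the tree with the given number of centers, provided that there is
a labeling with this number of centers. -/
theorem exec_clustering :
    ∃ (ord par : ℕ → ℕ) (sub : ℕ → ℕ → Prop) (e : ℝ),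
      (∀ t, 1 ≤ t → t ≤ I.size → ord t < I.size) ∧
      (∀ r t, 1 ≤ r → r < t → t ≤ I.size → ord r ≠ ord t) ∧
      IsRootedTree I.size par sub ∧
      IsGreedyTree I.size (fun x y => I.dist (ord x) (ord y)) par ∧
      (I.kind = .total → e = 0) ∧
      (I.kind = .bottleneck → ∀ u c, u ≤ I.size → c ≤ I.size →
        e ≤ I.connCost u c ∧ e ≤ I.centerCost u) ∧
      ((∃ ψ, IsTreeLabeling I.size par sub ψ ∧ centerCount I.size ψ = I.clusters) →
        ∃ φ, IsTreeLabeling I.size par sub φ ∧ centerCount I.size φ = I.clusters ∧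
          (∀ ψ, IsTreeLabeling I.size par sub ψ → centerCount I.size ψ = I.clusters →
            labelCost I.size I.kind.op e (I.own ord) φ ≤
              labelCost I.size I.kind.op e (I.own ord) ψ) ∧
          ∀ t, 1 ≤ t → t ≤ I.size → (clustering.exec I Store.init).nat (0, ord t, 0, 0) =
            ((Finset.Ico 1 (φ t)).filter fun r => φ r = r).card) := by
  obtain ⟨hL0, hL1⟩ := exec_nullCost (I := I) Store.init
  have o1 := exec_eqOff (I := I) nullCost Store.init
  unfold clustering
  simp only [exec_seq]
  generalize nullCost.exec I Store.init = s₁ at *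
  have hP := exec_prim (I := I) (s := s₁) (fun r => by rw [o1.nat 2]; rfl)
    (fun v => by rw [o1.nat 3]; rfl) (by rw [o1.nat 15]; rfl) (by rw [o1.nat 16]; rfl)
  have o2 := exec_eqOff (I := I) prim s₁
  generalize prim.exec I s₁ = s₂ at *
  have hpar_lt : ∀ x, 1 ≤ x → x ≤ I.size → s₂.nat (2, x, 0, 0) < x := by
    intro x hx hxn
    by_cases hx1 : x = 1
    · rw [hx1, hP.par_one]; exact Nat.one_pos
    · exact (hP.par x (by omega) (by omega)).2
  obtain ⟨hS0, hS1, hS2⟩ := exec_subtrees (I := I) (s := s₂)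
    (fun t x => by rw [o2.nat 4, o1.nat 4]; rfl) hpar_lt hP.par_zero
  have o3 := exec_eqOff (I := I) subtrees s₂
  generalize subtrees.exec I s₂ = s₃ at *
  have hB := exec_dp (I := I) (s := s₃) (e := s₁.real (40, 0, 0, 0))
    (ord := fun t => s₂.nat (1, t, 0, 0)) (par := fun t => s₂.nat (2, t, 0, 0))
    (sub := fun t x => t ≤ I.size ∧ 0 < s₃.nat (4, t, x, 0))
    (fun t j c => by rw [o3.nat 6, o2.nat 6, o1.nat 6]; rfl)
    (fun p => by rw [o3.nat 5, o2.nat 5, o1.nat 5]; rfl)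
    (by rw [o3.real 40, o2.real 40]) (fun r => o3.nat 1 r 0 0) (fun r => o3.nat 2 r 0 0)
    (fun t x ht => by simp [ht])
  have o4 := exec_eqOff (I := I) dp s₃
  generalize dp.exec I s₃ = s₄ at *
  -- The bound t ≤ n is part of the relation because the tree axioms quantify over all t ≥ 1, while
  -- the memory is only known to be correct in rows up to n.
  have htree : IsRootedTree I.size (fun t => s₂.nat (2, t, 0, 0))
      (fun t x => t ≤ I.size ∧ 0 < s₃.nat (4, t, x, 0)) := by
    refine ⟨hpar_lt, fun t ht htn => (hP.par t ht (by omega)).1,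
      fun t ht htn => ⟨htn, by rw [hS1 t ht htn]; exact Nat.one_pos⟩,
      fun t x ht hx hxn htx => ?_, fun t ht h => ?_⟩
    · by_cases htn : t ≤ I.size
      · rw [hS2 t x hx hxn htn htx]
      · simp [htn]
    · rw [hS0 t ht h.1] at h
      exact absurd h.2 (lt_irrefl _)
  have he : I.kind.op (s₁.real (40, 0, 0, 0)) (s₁.real (40, 0, 0, 0)) = s₁.real (40, 0, 0, 0) := by
    cases hk : I.kind
    · simp [Kind.op, hL0 hk]
    · simp [Kind.op]
  refine ⟨fun t => s₂.nat (1, t, 0, 0), fun t => s₂.nat (2, t, 0, 0),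
    fun t x => t ≤ I.size ∧ 0 < s₃.nat (4, t, x, 0), s₁.real (40, 0, 0, 0),
    fun t ht htn => hP.lt t ht (by omega), fun r t hr hrt htn => hP.inj r t hr hrt (by omega),
    htree, ?_, hL0, hL1, ?_⟩
  · intro t a b ht ha hat htb hb
    exact hP.greedy t a _ ht (by omega) ha hat (hP.lt b (by omega) (by omega))
      fun r hr hrt => hP.inj r b hr (by omega) (by omega)
  -- The given labeling serves only to show that the root entry for the required number of centers
  -- is feasible.
  · rintro ⟨ψ, hψ, hψk⟩
    have hmono := Kind.op_mono I.kind
    have hf := (hB.le_labelCost hmono he htree hψ).1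
    rw [hψk] at hf
    have hlab := exec_labels (I := I) (s := s₄) he
      (by rw [o4.nat 11, o3.nat 11, o2.nat 11, o1.nat 11]; rfl) (fun r => by rw [o4.nat 2, o3.nat 2]) hB htree hf
    have o5 := exec_eqOff (I := I) labels s₄
    generalize labels.exec I s₄ = s₅ at *
    obtain ⟨hk, hopt⟩ := hlab.optimal hmono he hB htree
    refine ⟨_, hlab.isTreeLabeling, hk, hopt, fun t ht htn => ?_⟩
    have hφ := hlab.isTreeLabeling
    have hnum := exec_number (I := I) (s := s₅) (fun t => rfl)
      (by rw [o5.nat 13, o4.nat 13, o3.nat 13, o2.nat 13, o1.nat 13]; rfl)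
      (hφ.pos t ht htn) (hφ.le t ht htn) (hφ.idem htree ht htn)
    have o6 := exec_eqOff (I := I) number s₅
    generalize number.exec I s₅ = s₆ at *
    have e1 : ∀ r, s₆.nat (1, r, 0, 0) = s₂.nat (1, r, 0, 0) := fun r => by
      rw [o6.nat 1, o5.nat 1, o4.nat 1, o3.nat 1]
    have hout := exec_output (I := I) (s := s₆) ht htn fun r r' hr hrr' hr' => by
      rw [e1, e1]; exact hP.inj r r' hr hrr' (by omega)
    rw [e1, o6.nat 11] at hout
    rw [hout, hnum]

end Blk

/-! ### From positions back to points: correctness of the algorithm -/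

/-- The two cost functions agree if the labeling `φ` of the positions corresponds to the center
map `m`. -/
theorem labelCost_eq_mapCost {n k : ℕ} (hn : 0 < n) {R : CostData n} {d : Fin n → Fin n → ℝ}
    {ord : ℕ → ℕ} {e : ℝ} (hlt : ∀ t, 1 ≤ t → t ≤ n → ord t < n) {pos : Fin n → ℕ}
    (hpos1 : ∀ u, 1 ≤ pos u) (hposn : ∀ u, pos u ≤ n) (hord : ∀ u, ord (pos u) = u)
    (hpos : ∀ t (ht : 1 ≤ t) (htn : t ≤ n), pos ⟨ord t, hlt t ht htn⟩ = t)
    (he0 : R.kind = .total → e = 0)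
    (he1 : R.kind = .bottleneck → ∀ u c, u ≤ n → c ≤ n →
      e ≤ (instanceInput k R d).connCost u c ∧ e ≤ (instanceInput k R d).centerCost u)
    {φ : ℕ → ℕ} {m : Fin n → Fin n} (hφm : ∀ u, φ (pos u) = pos (m u)) :
    labelCost n R.kind.op e ((instanceInput k R d).own ord) φ = R.mapCost m d := by
  have hinj : Function.Injective pos := fun u v huv => by
    apply Fin.ext
    rw [← hord u, ← hord v, huv]
  have hown : ∀ u, (instanceInput k R d).own ord (pos u) (φ (pos u)) = R.own d u (m u) := by
    intro u
    unfold Input.own CostData.own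
    rw [hφm, hord, hord]
    simp only [hinj.eq_iff]
    simp [instanceInput]
  unfold labelCost CostData.mapCost
  cases hk : R.kind
  · rw [fold_total, he0 hk, zero_add]
    refine (Finset.sum_bij (fun u _ => pos u) (fun u _ => ?_) (fun u _ v _ h => hinj h)
      (fun t ht => ?_) (fun u _ => (hown u).symm)).symm
    · exact Finset.mem_Ico.2 ⟨hpos1 u, Nat.lt_succ_of_le (hposn u)⟩
    · obtain ⟨h1, h2⟩ := Finset.mem_Ico.1 ht
      exact ⟨_, Finset.mem_univ _, hpos t h1 (by omega)⟩
  · have : Nonempty (Fin n) := ⟨⟨0, hn⟩⟩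
    refine eq_of_forall_ge_iff fun x => ?_
    rw [fold_bottleneck_le, ciSup_le_iff (Set.finite_range _).bddAbove]
    constructor
    · rintro ⟨-, h⟩ u
      rw [← hown]
      exact h _ (Finset.mem_Ico.2 ⟨hpos1 u, Nat.lt_succ_of_le (hposn u)⟩)
    · intro h
      refine ⟨?_, fun t ht => ?_⟩
      -- The start value of the maximum lies below the contribution of any single point, here the
      -- point 0, and therefore does not matter.
      · refine le_trans ?_ (h ⟨0, hn⟩)
        have hu := he1 hk 0 (m ⟨0, hn⟩) (Nat.zero_le _) (m ⟨0, hn⟩).2.le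
        have h1 : e ≤ R.g ⟨0, hn⟩ (d ⟨0, hn⟩ (m ⟨0, hn⟩)) := by
          simpa [instanceInput, hn] using hu.1
        unfold CostData.own
        rw [hk]
        split_ifs
        · exact h1.trans (le_max_left _ _)
        · exact h1
      · obtain ⟨h1, h2⟩ := Finset.mem_Ico.1 ht
        have h3 := h ⟨ord t, hlt t h1 (by omega)⟩
        rw [← hown, hpos t h1 (by omega)] at h3
        exact h3

/-- An injective assignment of n points to n positions is a bijection, and this is its inverse. -/
theorem exists_positions {n : ℕ} {ord : ℕ → ℕ} (hlt : ∀ t, 1 ≤ t → t ≤ n → ord t < n)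
    (hinj : ∀ r t, 1 ≤ r → r < t → t ≤ n → ord r ≠ ord t) :
    ∃ pos : Fin n → ℕ, (∀ u, 1 ≤ pos u) ∧ (∀ u, pos u ≤ n) ∧ (∀ u, ord (pos u) = u) ∧
      ∀ t (ht : 1 ≤ t) (htn : t ≤ n), pos ⟨ord t, hlt t ht htn⟩ = t := by
  have hinj' : ∀ r t, 1 ≤ r → r ≤ n → 1 ≤ t → t ≤ n → ord r = ord t → r = t := by
    intro r t hr hrn ht htn h
    rcases lt_trichotomy r t with h1 | h1 | h1
    · exact absurd h (hinj r t hr h1 htn)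
    · exact h1
    · exact absurd h.symm (hinj t r ht h1 hrn)
  have hs : Function.Surjective fun i : Fin n =>
      (⟨ord (i + 1), hlt _ (by omega) (by omega)⟩ : Fin n) := by
    refine Finite.surjective_of_injective fun i j hij => ?_
    have := hinj' (i + 1) (j + 1) (by omega) (by omega) (by omega) (by omega) (Fin.mk.inj hij)
    exact Fin.ext (by omega)
  choose p hp using hs
  have hord : ∀ u, ord (p u + 1) = u := fun u => congrArg Fin.val (hp u)
  refine ⟨fun u => p u + 1, fun u => Nat.le_add_left _ _, fun u => (p u).2, hord,
    fun t ht htn => ?_⟩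
  exact hinj' _ _ (Nat.le_add_left _ _) (p ⟨ord t, hlt t ht htn⟩).2 ht htn (hord _)

/-- Sending each center to the number of smaller centers numbers the centers. -/
theorem rank_injective {n k : ℕ} {φ : ℕ → ℕ} (hk : centerCount n φ = k) :
    (∀ t, 1 ≤ t → t ≤ n → φ t = t → ((Finset.Ico 1 t).filter fun r => φ r = r).card < k) ∧
    ∀ t t', 1 ≤ t → 1 ≤ t' → φ t = t → φ t' = t' →
      ((Finset.Ico 1 t).filter fun r => φ r = r).card =
        ((Finset.Ico 1 t').filter fun r => φ r = r).card → t = t' := by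
  have hlt : ∀ t t', 1 ≤ t → t < t' → φ t = t →
      ((Finset.Ico 1 t).filter fun r => φ r = r).card <
        ((Finset.Ico 1 t').filter fun r => φ r = r).card := by
    intro t t' ht htt hφ
    refine Finset.card_lt_card ⟨Finset.filter_subset_filter _
      (Finset.Ico_subset_Ico_right htt.le), fun h => ?_⟩
    have := h (Finset.mem_filter.2 ⟨Finset.mem_Ico.2 ⟨ht, htt⟩, hφ⟩)
    simp at this
  refine ⟨fun t ht htn hφ => ?_, fun t t' ht ht' hφ hφ' h => ?_⟩
  · rw [← hk, centerCount_eq_card]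
    exact hlt t (n + 1) ht (by omega) hφ
  · rcases lt_trichotomy t t' with h1 | h1 | h1
    · exact absurd h (hlt t t' ht h1 hφ).ne
    · exact h1
    · exact absurd h (hlt t' t ht' h1 hφ').ne'

/-- The algorithm is correct on resilient instances. -/
theorem outputs_clustering {n k : ℕ} {d : Fin n → Fin n → ℝ} {H : Objective n k} {R : CostData n}
    (hk : 0 < k) (hd : IsMetric d) (hH : IsNaturalWith H R)
    (hres : IsMetricPerturbationResilient 2 H d) :
    ∃ C : Fin n → Fin k, Outputs (Blk.clustering.exec (instanceInput k R d) Store.init) C ∧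
      IsOptimal H d C ∧ ∀ C', IsOptimal H d C' → SamePartition C C' := by
  obtain ⟨C₀, hC₀⟩ := exists_resilientMaps hk hd hH hres
  obtain ⟨m₀, hm₀, -⟩ := hC₀.voronoi d hd
  have hker₀ := hC₀.ker d (isMetricPerturbation_self hd) m₀ hm₀
  obtain ⟨hub, hubC, hubeq, hubd⟩ := hC₀.exists_hubs
  have hn : 0 < n := by
    obtain ⟨u, -⟩ := Finset.card_pos.1 (hm₀.1.card.symm ▸ hk)
    exact u.pos
  obtain ⟨ord, par, sub, e, hlt, hinj, htree, hgreedy, he0, he1, hmain⟩ :=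
    Blk.exec_clustering (I := instanceInput k R d)
  change ∀ t, 1 ≤ t → t ≤ n → ord t < n at hlt
  change IsRootedTree n par sub at htree
  obtain ⟨pos, hpos1, hposn, hord, hpos⟩ := exists_positions hlt hinj
  have hposinj : Function.Injective pos := fun u v huv => by
    apply Fin.ext
    rw [← hord u, ← hord v, huv]
  let pt : ℕ → Fin n := fun t => if h : 1 ≤ t ∧ t ≤ n then ⟨ord t, hlt t h.1 h.2⟩ else ⟨0, hn⟩
  have hpt : ∀ t, 1 ≤ t → t ≤ n → pos (pt t) = t := fun t h1 h2 => by
    simp only [pt, dif_pos (And.intro h1 h2)]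
    exact hpos t h1 h2
  have hptpos : ∀ u, pt (pos u) = u := fun u => hposinj (hpt _ (hpos1 u) (hposn u))
  have hcount : ∀ (φ : ℕ → ℕ) (m : Fin n → Fin n), (∀ u, φ (pos u) = pos (m u)) →
      centerCount n φ = (Finset.univ.filter fun u => m u = u).card := by
    intro φ m hφm
    rw [centerCount_eq_card]
    refine (Finset.card_bij (fun u _ => pos u) (fun u hu => ?_) (fun u _ v _ h => hposinj h)
      (fun t ht => ?_)).symm
    · refine Finset.mem_filter.2 ⟨Finset.mem_Ico.2 ⟨hpos1 u, Nat.lt_succ_of_le (hposn u)⟩, ?_⟩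
      rw [hφm, (Finset.mem_filter.1 hu).2]
    · obtain ⟨h1, h2⟩ := Finset.mem_filter.1 ht
      obtain ⟨h3, h4⟩ := Finset.mem_Ico.1 h1
      have h5 := hpt t h3 (by omega)
      refine ⟨pt t, Finset.mem_filter.2 ⟨Finset.mem_univ _, hposinj ?_⟩, h5⟩
      rw [← hφm, h5, h2]
  have hcost : ∀ (φ : ℕ → ℕ) (m : Fin n → Fin n), (∀ u, φ (pos u) = pos (m u)) →
      labelCost n R.kind.op e ((instanceInput k R d).own ord) φ = R.mapCost m d :=
    fun φ m hφm => labelCost_eq_mapCost hn hlt hpos1 hposn hord hpos he0 he1 hφm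
  -- The labeling of an optimal center map for d. It shows that k centers are feasible and is the
  -- competitor for the output.
  let ψ : ℕ → ℕ := fun t => if t = 0 then 0 else pos (m₀ (pt t))
  have hψ1 : ∀ t, 1 ≤ t → ψ t = pos (m₀ (pt t)) := fun t ht => if_neg (by omega)
  have hψm : ∀ u, ψ (pos u) = pos (m₀ u) := fun u => by rw [hψ1 _ (hpos1 u), hptpos]
  have hdist : ∀ x y, 1 ≤ x → x ≤ n → 1 ≤ y → y ≤ n →
      (instanceInput k R d).dist (ord x) (ord y) = d (pt x) (pt y) := by
    intro x y hx hxn hy hyn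
    simp [instanceInput, pt, hx, hxn, hy, hyn, hlt]
  -- The hubs are the centers for 2d and the labels are the centers for d. The two may differ, but
  -- they belong to the same clusters, which is all that connectedness needs.
  have hψ : IsTreeLabeling n par sub ψ := by
    refine isTreeLabeling_of_hubs htree (D := fun x y => (instanceInput k R d).dist (ord x) (ord y))
      (κ := fun t => C₀ (pt t)) (hub := fun t => pos (hub (pt t))) (fun x y => ?_) hgreedy (if_pos rfl)
      (fun t ht htn => ?_) (fun t ht htn => ?_) (fun t ht htn => ?_)
      (fun s t hs hsn ht htn h => ?_) (fun t _ _ => hpos1 _) (fun t _ _ => hposn _)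
      (fun s t _ _ _ _ h => ?_) (fun x z hx hxn hz hzn h => ?_)
    · simp only [instanceInput]
      by_cases h : ord x < n ∧ ord y < n
      · rw [dif_pos h, dif_pos h.symm, hd.symm]
      · rw [dif_neg h, dif_neg fun h' => h h'.symm]
    · rw [hψ1 t ht]; exact hpos1 _
    · rw [hψ1 t ht]; exact hposn _
    · simp only [hψ1 t ht, hptpos]
      rw [hker₀]; exact hm₀.1.idem _
    · rw [hψ1 s hs, hψ1 t ht, (hker₀ _ _).1 h]
    · simp only [hubeq _ _ h]
    · simp only [hdist x _ hx hxn (hpos1 _) (hposn _), hdist x z hx hxn hz hzn, hptpos]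
      exact hubd _ _ h
  obtain ⟨φ, hφ, hφk, hφopt, hφout⟩ := hmain ⟨ψ, hψ, (hcount ψ m₀ hψm).trans hm₀.1.card⟩
  change IsTreeLabeling n par sub φ at hφ
  let m : Fin n → Fin n := fun u => pt (φ (pos u))
  have hφm : ∀ u, φ (pos u) = pos (m u) := fun u =>
    (hpt _ (hφ.pos _ (hpos1 u) (hposn u)) (hφ.le _ (hpos1 u) (hposn u))).symm
  have hφidem : ∀ u, φ (φ (pos u)) = φ (pos u) := fun u => hφ.idem htree (hpos1 u) (hposn u)
  have hm : IsCenterMap k m :=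
    ⟨fun u => hposinj (by rw [← hφm, ← hφm, hφidem]), (hcount φ m hφm).symm.trans hφk⟩
  -- The output is a center map by idempotency and costs at most as much as the labeling of the
  -- optimal map `m₀`.
  have hmopt : IsOptimalMap R k d m := by
    refine ⟨hm, fun m' hm' => le_trans ?_ (hm₀.2 m' hm')⟩
    rw [← hcost φ m hφm, ← hcost ψ m₀ hψm]
    exact hφopt ψ hψ ((hcount ψ m₀ hψm).trans hm₀.1.card)
  obtain ⟨hrlt, hrinj⟩ := rank_injective (n := n) hφk
  have hφ1 : ∀ u, 1 ≤ φ (pos u) := fun u => hφ.pos _ (hpos1 u) (hposn u)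
  have hφn : ∀ u, φ (pos u) ≤ n := fun u => hφ.le _ (hpos1 u) (hposn u)
  let C : Fin n → Fin k := fun u =>
    ⟨((Finset.Ico 1 (φ (pos u))).filter fun r => φ r = r).card,
      hrlt _ (hφ1 u) (hφn u) (hφidem u)⟩
  have hCker : ∀ u v, C u = C v ↔ m u = m v := by
    intro u v
    constructor
    · intro h
      have := hrinj _ _ (hφ1 u) (hφ1 v) (hφidem u) (hφidem v) (Fin.mk.inj h)
      simp only [m, this]
    · intro h
      have : φ (pos u) = φ (pos v) := by rw [hφm, hφm, h]
      simp only [C, this]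
  -- The k centers receive distinct numbers below k, so every number occurs.
  have hC : IsClustering C := by
    have hinj' : Function.Injective fun x : {u // m u = u} => C x.1 := fun x y hxy =>
      Subtype.ext (by rw [← x.2, ← y.2]; exact (hCker _ _).1 hxy)
    have hbij := (Fintype.bijective_iff_injective_and_card _).2
      ⟨hinj', by rw [Fintype.card_subtype, hm.card, Fintype.card_fin]⟩
    intro i
    obtain ⟨x, hx⟩ := hbij.2 i
    exact ⟨x.1, hx⟩
  have hopt : IsOptimal H d C := isOptimal_of_ker hk hH.eq_objective hd hmopt hC hCker
  refine ⟨C, fun u => ?_, hopt, fun C' hC' u v => ?_⟩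
  · have := hφout (pos u) (hpos1 u) (hposn u)
    rw [hord] at this
    exact this
  · obtain ⟨C₁, -, hC₁⟩ := hres
    have hu := (hC₁ d (isMetricPerturbation_self hd)).2
    rw [← hu C hopt u v, hu C' hC' u v]

end Clustering

open Clustering
theorem theorem1 :
    (∃ (P : Prog) (T : Polynomial ℕ),
      ∀ (n k : ℕ) (d : Fin n → Fin n → ℝ) (H : Objective n k) (R : CostData n),
        0 < k → IsMetric d → IsNaturalWith H R → IsMetricPerturbationResilient 2 H d →
        ∃ (s : Store) (t : ℕ), Runs (instanceInput k R d) P Store.init s t ∧ t ≤ T.eval n ∧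
          ∃ C : Fin n → Fin k, Outputs s C ∧ IsOptimal H d C ∧
            ∀ C', IsOptimal H d C' → SamePartition C C') ∧
    (∀ n k : ℕ, 0 < k → k ≤ n →
      IsNaturalCenterBased (kMeans n k) ∧ IsNaturalCenterBased (kMedian n k) ∧
      IsNaturalCenterBased (kCenter n k) ∧
      ∀ f : Fin n → ℝ, IsNaturalCenterBased (facilityLocation f k)) := by
  refine ⟨⟨Blk.clustering.compile, Blk.clustering.bound, fun n k d H R hk hd hH hres => ?_⟩,
    fun n k hk hkn => ⟨isNaturalCenterBased_kMeans hk hkn, isNaturalCenterBased_kMedian hk hkn,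
      isNaturalCenterBased_kCenter hk hkn, isNaturalCenterBased_facilityLocation hk hkn⟩⟩
  obtain ⟨t, hrun, ht⟩ := Blk.runs_exec (I := instanceInput k R d) Blk.wellFormed_clustering
    Store.init
  exact ⟨_, t, hrun, ht, outputs_clustering hk hd hH hres⟩
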